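/- Let $X$ be a (not necessarily compact or connected) Kähler manifold, i.e. a Hausdorff second countable complex manifold with a smooth Hermitian metric $g$ whose fundamental form $\omega(u,v)=g(Ju,v)$ is closed. Let $\Omega(X)=\bigoplus_k\Omega^k(X)$ be the space of smooth complex-valued differential forms on $X$, $d$ the exterior derivative, $L\alpha=\omega\wedge\alpha$, $\Lambda$ the pointwise adjoint of $L$ with respect to the Hermitian inner product $\langle\cdot,\cdot\rangle$ on forms induced by $g$, and $\Delta=[\Lambda,d]=\Lambda d-d\Lambda$. A formal adjoint of an operator $A$ on $\Omega(X)$ is an operator $A^*$ on $\Omega(X)$ such that $$\int_X\langle A\alpha,\beta\rangle\,d\mathrm{vol}_g=\int_X\langle\alpha,A^*\beta\rangle\,d\mathrm{vol}_g$$ for all $\alpha,\beta\in\Omega(X)$ such that $\alpha$ has compact support. Then $d$ and $\Delta$ have formal adjoints $d^*$ and $\Delta^*$, and on $\Omega(X)$ $$d\Delta^*+\Delta^*d=0\qquad\text{and}\qquad \Delta d^*+d^*\Delta=0 .$$ -/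

import Mathlib

open scoped Manifold ContDiff ComplexConjugate
open MeasureTheory

noncomputable section

namespace KahlerGeometry

/-! ### Linear algebra of complex-valued alternating forms on a real vector space `V` -/

section LinearAlgebra

variable {V : Type*} [NormedAddCommGroup V] [NormedSpace ℝ V]

/-- The tensor product `(α ⊗ β)(v₁, …, v_{p+q}) = α(v₁, …, v_p) β(v_{p+1}, …, v_{p+q})`,
see `tensor_apply`. -/
def tensor {p q : ℕ} (α : V [⋀^Fin p]→L[ℝ] ℂ) (β : V [⋀^Fin q]→L[ℝ] ℂ) :
    ContinuousMultilinearMap ℝ (fun _ : Fin (p + q) => V) ℂ where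
  toMultilinearMap := ((LinearMap.mul' ℝ ℂ).compMultilinearMap
    (α.toMultilinearMap.domCoprod β.toMultilinearMap)).domDomCongr finSumFinEquiv
  cont := by
    refine Continuous.mul (α.cont.comp ?_) (β.cont.comp ?_) <;> fun_prop

theorem tensor_apply {p q : ℕ} (α : V [⋀^Fin p]→L[ℝ] ℂ) (β : V [⋀^Fin q]→L[ℝ] ℂ)
    (v : Fin (p + q) → V) :
    tensor α β v = α (fun i => v (Fin.castAdd q i)) * β (fun j => v (Fin.natAdd p j)) := rfl

/-- The wedge product
`(α ∧ β)(v₁, …, v_{p+q}) = 1/(p! q!) ∑_σ sign(σ) (α ⊗ β)(v_{σ(1)}, …, v_{σ(p+q)})`. -/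
def wedge {p q : ℕ} (α : V [⋀^Fin p]→L[ℝ] ℂ) (β : V [⋀^Fin q]→L[ℝ] ℂ) :
    V [⋀^Fin (p + q)]→L[ℝ] ℂ :=
  ((p.factorial : ℂ) * (q.factorial : ℂ))⁻¹ •
    ContinuousMultilinearMap.alternatization (tensor α β)

/-- An `m`-form regarded as an `n`-form when `m = n`. -/
def reindex {m n : ℕ} (h : m = n) (α : V [⋀^Fin m]→L[ℝ] ℂ) : V [⋀^Fin n]→L[ℝ] ℂ where
  toContinuousMultilinearMap := α.toContinuousMultilinearMap.domDomCongr (finCongr h)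
  map_eq_zero_of_eq' := (α.toAlternatingMap.domDomCongr (finCongr h)).map_eq_zero_of_eq'

/-- The `2`-form `(u, v) ↦ B(u, v)` of an alternating bilinear form `B`. -/
def twoForm (B : V →L[ℝ] V →L[ℝ] ℝ) (hB : ∀ v, B v v = 0) : V [⋀^Fin 2]→L[ℝ] ℂ where
  toFun v := (B (v 0) (v 1) : ℂ)
  map_update_add' v i x y := by fin_cases i <;> simp
  map_update_smul' v i c x := by fin_cases i <;> simp
  map_eq_zero_of_eq' v i j h hij := by
    have h01 : v 0 = v 1 := by fin_cases i <;> fin_cases j <;> simp_all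
    simp [h01, hB]
  cont := by fun_prop

/-- The Lefschetz operator `L α = w ∧ α` of a `2`-form `w`, in degree `k`. -/
def lefschetz (w : V [⋀^Fin 2]→L[ℝ] ℂ) {k : ℕ} (α : V [⋀^Fin k]→L[ℝ] ℂ) :
    V [⋀^Fin (k + 2)]→L[ℝ] ℂ :=
  reindex (Nat.add_comm 2 k) (wedge w α)

/-- The Gram matrix `(g(b_i, b_j))` of a bilinear form in a family of vectors. -/
def gram {ι : Type*} (g : V →L[ℝ] V →L[ℝ] ℝ) (b : ι → V) : Matrix ι ι ℝ :=
  Matrix.of fun i j => g (b i) (b j)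

variable [FiniteDimensional ℝ V]

/-- The Hermitian inner product on `k`-forms induced by the inner product `g` on `V`:
`⟨α, β⟩ = 1/k! ∑ g^{i₁j₁} ⋯ g^{i_k j_k} α(b_{i₁}, …, b_{i_k}) conj β(b_{j₁}, …, b_{j_k})`,
where `(g^{ij})` is the inverse of the Gram matrix of `g` in a basis `b` (the value does not
depend on the basis). -/
def formInner (g : V →L[ℝ] V →L[ℝ] ℝ) {k : ℕ} (α β : V [⋀^Fin k]→L[ℝ] ℂ) : ℂ :=
  (k.factorial : ℂ)⁻¹ *
    ∑ I : Fin k → Fin (Module.finrank ℝ V), ∑ J : Fin k → Fin (Module.finrank ℝ V),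
      ((∏ a, (gram g (Module.finBasis ℝ V))⁻¹ (I a) (J a) : ℝ) : ℂ) *
        (α (fun a => Module.finBasis ℝ V (I a)) *
          conj (β (fun a => Module.finBasis ℝ V (J a))))

theorem formInner_congr (g : V →L[ℝ] V →L[ℝ] ℝ) {m n : ℕ} (h : m = n)
    (α : V [⋀^Fin m]→L[ℝ] ℂ) (β : V [⋀^Fin n]→L[ℝ] ℂ) :
    formInner g (reindex h α) β =
      formInner g α (reindex h.symm β) := by
  subst h
  rfl

theorem formInner_alternatization (g : V →L[ℝ] V →L[ℝ] ℝ) {m : ℕ} (c : ℂ)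
    (T : ContinuousMultilinearMap ℝ (fun _ : Fin m => V) ℂ) (β : V [⋀^Fin m]→L[ℝ] ℂ) :
    formInner g (c • ContinuousMultilinearMap.alternatization T) β =
      c * ∑ I : Fin m → Fin (Module.finrank ℝ V), ∑ J : Fin m → Fin (Module.finrank ℝ V),
        ((∏ a, (gram g (Module.finBasis ℝ V))⁻¹ (I a) (J a) : ℝ) : ℂ) *
          (T (fun a => Module.finBasis ℝ V (I a)) *
            conj (β (fun a => Module.finBasis ℝ V (J a)))) := by
  set b := Module.finBasis ℝ V
  set H := (gram g b)⁻¹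
  have key : ∀ σ : Equiv.Perm (Fin m),
      (∑ I : Fin m → Fin (Module.finrank ℝ V), ∑ J : Fin m → Fin (Module.finrank ℝ V),
        ((∏ a, H (I a) (J a) : ℝ) : ℂ) * ((Equiv.Perm.sign σ • T (fun a => b (I (σ a)))) *
            conj (β (fun a => b (J a))))) =
      ∑ I : Fin m → Fin (Module.finrank ℝ V), ∑ J : Fin m → Fin (Module.finrank ℝ V),
        ((∏ a, H (I a) (J a) : ℝ) : ℂ) * (T (fun a => b (I a)) *
            conj (β (fun a => b (J a)))) := by
    intro σ
    let e : (Fin m → Fin (Module.finrank ℝ V)) ≃ (Fin m → Fin (Module.finrank ℝ V)) :=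
      Equiv.arrowCongr σ.symm (Equiv.refl _)
    have he : ∀ I a, e I a = I (σ a) := fun I a => rfl
    rw [← Equiv.sum_comp e (fun I => ∑ J : Fin m → Fin (Module.finrank ℝ V),
        ((∏ a, H (I a) (J a) : ℝ) : ℂ) * (T (fun a => b (I a)) *
            conj (β (fun a => b (J a)))))]
    refine Finset.sum_congr rfl fun I _ => ?_
    rw [← Equiv.sum_comp e (fun J => ((∏ a, H (e I a) (J a) : ℝ) : ℂ) *
      (T (fun a => b (e I a)) * conj (β (fun a => b (J a)))))]
    refine Finset.sum_congr rfl fun J _ => ?_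
    simp only [he]
    rw [Equiv.prod_comp σ (fun a => H (I a) (J a))]
    have hβ : β (fun a => b (J (σ a))) = Equiv.Perm.sign σ • β (fun a => b (J a)) :=
      β.toAlternatingMap.map_perm (fun a => b (J a)) σ
    rw [hβ]
    rcases Int.units_eq_one_or (Equiv.Perm.sign σ) with h | h <;> simp [h]
  have hexp : ∀ I : Fin m → Fin (Module.finrank ℝ V),
      (c • ContinuousMultilinearMap.alternatization T) (fun a => b (I a)) =
        c * ∑ σ : Equiv.Perm (Fin m), Equiv.Perm.sign σ • T (fun a => b (I (σ a))) := by
    intro I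
    rw [ContinuousAlternatingMap.smul_apply,
      ContinuousMultilinearMap.alternatization_apply_apply]
    rfl
  unfold formInner
  have : (m.factorial : ℂ) ≠ 0 := by exact_mod_cast m.factorial_ne_zero
  rw [inv_mul_eq_iff_eq_mul₀ this]
  calc _ = c * ∑ σ : Equiv.Perm (Fin m),
      (∑ I : Fin m → Fin (Module.finrank ℝ V), ∑ J : Fin m → Fin (Module.finrank ℝ V),
        ((∏ a, H (I a) (J a) : ℝ) : ℂ) * ((Equiv.Perm.sign σ • T (fun a => b (I (σ a)))) *
            conj (β (fun a => b (J a))))) := by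
        conv_rhs => rw [Finset.sum_comm, Finset.mul_sum]
        refine Finset.sum_congr rfl fun I _ => ?_
        conv_rhs => rw [Finset.sum_comm, Finset.mul_sum]
        refine Finset.sum_congr rfl fun J _ => ?_
        rw [hexp, ← Finset.mul_sum, ← Finset.sum_mul]
        ring
    _ = _ := by
        simp only [key, Finset.sum_const, Finset.card_univ, Fintype.card_perm, Fintype.card_fin,
          nsmul_eq_mul]
        ring

/-- On the finite-dimensional space of forms, `L` has an adjoint. -/
theorem exists_adjoint_lefschetz (g : V →L[ℝ] V →L[ℝ] ℝ) (w : V [⋀^Fin 2]→L[ℝ] ℂ) (k : ℕ) :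
    ∃ Λ : V [⋀^Fin (k + 2)]→L[ℝ] ℂ → V [⋀^Fin k]→L[ℝ] ℂ,
      ∀ α β, formInner g (lefschetz w α) β = formInner g α (Λ β) := by
  set b := Module.finBasis ℝ V with hb
  set H := (gram g b)⁻¹ with hH
  refine ⟨fun β => (2 : ℂ)⁻¹ • ∑ I : Fin 2 → Fin (Module.finrank ℝ V),
    ∑ J : Fin 2 → Fin (Module.finrank ℝ V),
      (((∏ a, H (I a) (J a) : ℝ) : ℂ) * conj (w (fun a => b (I a)))) •
        (β.curryLeft (b (J 0))).curryLeft (b (J 1)), fun α β => ?_⟩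
  have hβ : ∀ (J₁ : Fin 2 → Fin (Module.finrank ℝ V)) (J₂ : Fin k → Fin (Module.finrank ℝ V)),
      (reindex (Nat.add_comm 2 k).symm β)
        (fun a => b (Fin.append J₁ J₂ a)) =
      (β.curryLeft (b (J₁ 0))).curryLeft (b (J₁ 1)) (fun a => b (J₂ a)) := by
    intro J₁ J₂
    rw [ContinuousAlternatingMap.curryLeft_apply_apply,
      ContinuousAlternatingMap.curryLeft_apply_apply]
    change β _ = β _
    congr 1
    funext a
    refine Fin.cases ?_ (fun a => Fin.cases ?_ (fun a => ?_) a) a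
    · change b (Fin.append J₁ J₂ (Fin.castAdd k 0)) = _
      simp
    · change b (Fin.append J₁ J₂ (Fin.castAdd k 1)) = _
      simp
    · have : (Fin.cast (Nat.add_comm 2 k).symm a.succ.succ) = Fin.natAdd 2 a := by
        ext; simp; omega
      change b (Fin.append J₁ J₂ (Fin.cast (Nat.add_comm 2 k).symm a.succ.succ)) = _
      rw [this]
      simp
  rw [lefschetz, formInner_congr, wedge, formInner_alternatization, formInner]
  simp only [← hb, ← hH]
  rw [← Equiv.sum_comp (Fin.appendEquiv 2 k), Fintype.sum_prod_type, Finset.sum_comm]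
  rw [Finset.mul_sum, Finset.mul_sum]
  refine Finset.sum_congr rfl fun I₂ _ => ?_
  have h1 : ∀ I₁ : Fin 2 → Fin (Module.finrank ℝ V),
      ∑ J : Fin (2 + k) → Fin (Module.finrank ℝ V),
        ((∏ a, H (Fin.append I₁ I₂ a) (J a) : ℝ) : ℂ) *
          (tensor w α (fun a => b (Fin.append I₁ I₂ a)) *
            conj ((reindex (Nat.add_comm 2 k).symm β)
              (fun a => b (J a)))) =
      ∑ J₂ : Fin k → Fin (Module.finrank ℝ V), ∑ J₁ : Fin 2 → Fin (Module.finrank ℝ V),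
        ((∏ a, H (I₂ a) (J₂ a) : ℝ) : ℂ) * (α (fun a => b (I₂ a)) *
          (((∏ a, H (I₁ a) (J₁ a) : ℝ) : ℂ) * w (fun a => b (I₁ a)) *
            conj ((β.curryLeft (b (J₁ 0))).curryLeft (b (J₁ 1)) (fun a => b (J₂ a))))) := by
    intro I₁
    rw [← Equiv.sum_comp (Fin.appendEquiv 2 k), Fintype.sum_prod_type, Finset.sum_comm]
    refine Finset.sum_congr rfl fun J₂ _ => Finset.sum_congr rfl fun J₁ _ => ?_
    simp only [Fin.appendEquiv, Equiv.coe_fn_mk]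
    rw [hβ, tensor_apply, Fin.prod_univ_add]
    simp only [Fin.append_left, Fin.append_right]
    push_cast
    ring
  simp only [Fin.appendEquiv, Equiv.coe_fn_mk]
  rw [Finset.sum_congr rfl (fun I₁ _ => h1 I₁), Finset.sum_comm, Finset.mul_sum, Finset.mul_sum]
  refine Finset.sum_congr rfl fun J₂ _ => ?_
  simp only [ContinuousAlternatingMap.smul_apply, ContinuousAlternatingMap.sum_apply,
    smul_eq_mul, map_mul, map_sum, Complex.conj_conj, map_inv₀, Complex.conj_ofReal, map_ofNat,
    Finset.mul_sum]
  refine Finset.sum_congr rfl fun I₁ _ => Finset.sum_congr rfl fun J₁ _ => ?_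
  have : (k.factorial : ℂ) ≠ 0 := by exact_mod_cast k.factorial_ne_zero
  simp only [Nat.factorial_two]
  push_cast
  field_simp

/-- The operator `Λ` in degree `k + 2`: the adjoint of `L = w ∧ ·` with respect to the Hermitian
inner products on forms. It is unique whenever `g` is positive definite. -/
def dualLefschetz (g : V →L[ℝ] V →L[ℝ] ℝ) (w : V [⋀^Fin 2]→L[ℝ] ℂ) {k : ℕ} :
    V [⋀^Fin (k + 2)]→L[ℝ] ℂ → V [⋀^Fin k]→L[ℝ] ℂ :=
  Classical.choose (exists_adjoint_lefschetz g w k)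

theorem formInner_lefschetz (g : V →L[ℝ] V →L[ℝ] ℝ) (w : V [⋀^Fin 2]→L[ℝ] ℂ) {k : ℕ}
    (α : V [⋀^Fin k]→L[ℝ] ℂ) (β : V [⋀^Fin (k + 2)]→L[ℝ] ℂ) :
    formInner g (lefschetz w α) β = formInner g α (dualLefschetz g w β) :=
  Classical.choose_spec (exists_adjoint_lefschetz g w k) α β

end LinearAlgebra

/-! ### Complex manifolds and differential forms

`E` is a finite-dimensional complex vector space and `X` a complex manifold modelled on `E`. The
real tangent space `TangentSpace 𝓘(ℝ, E) x` of `X` at `x` is by definition `E`, namely the tangent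
space read in the preferred chart `chartAt E x`. -/

section Manifold

variable {E : Type*} [NormedAddCommGroup E] [NormedSpace ℂ E]
  {X : Type*} [TopologicalSpace X] [ChartedSpace E X]

/-- The smooth real manifold underlying a complex manifold. -/
instance isManifold_real [IsManifold 𝓘(ℂ, E) ω X] : IsManifold 𝓘(ℝ, E) ∞ X := by
  refine isManifold_of_contDiffOn _ _ _ fun e e' he he' => ?_
  have h := (contDiffGroupoid ω 𝓘(ℂ, E)).compatible he he'
  rw [contDiffGroupoid, mem_groupoid_of_pregroupoid] at h
  exact (ContDiffOn.restrict_scalars ℝ h.1).of_le le_top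

variable (E X) in
/-- Complex-valued differential `k`-forms (not necessarily smooth): an alternating `ℝ`-multilinear
form on the tangent space `TangentSpace 𝓘(ℝ, E) x = E` for every `x : X`. -/
abbrev KForm (k : ℕ) : Type _ := X → E [⋀^Fin k]→L[ℝ] ℂ

variable (E X) in
/-- Differential forms of mixed degree: `α k` is the component of degree `k`
(which vanishes automatically above the real dimension of `X`). -/
abbrev DiffForm : Type _ := ∀ k : ℕ, KForm E X k

/-- The real differential at `y` of the inverse `E → X` of the chart at `p`. -/
def chartSymmDeriv (p : X) (y : E) : E →L[ℝ] E :=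
  mfderiv 𝓘(ℝ, E) 𝓘(ℝ, E) (chartAt E p).symm y

/-- The expression of a `k`-form in the chart at `p`: its pullback by the inverse chart. It is
meaningful on the target of the chart. -/
def KForm.inChart {k : ℕ} (α : KForm E X k) (p : X) (y : E) : E [⋀^Fin k]→L[ℝ] ℂ :=
  (α ((chartAt E p).symm y)).compContinuousLinearMap (chartSymmDeriv p y)

/-- A form is smooth if all its components are smooth in all the charts `chartAt E p`. -/
def DiffForm.IsSmooth (α : DiffForm E X) : Prop :=
  ∀ (k : ℕ) (p : X), ContDiffOn ℝ ∞ ((α k).inChart p) (chartAt E p).target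

/-- The support of the form is compact. -/
def DiffForm.IsCompactlySupported (α : DiffForm E X) : Prop :=
  IsCompact (closure {x : X | ∃ k, α k x ≠ 0})

/-- The exterior derivative of a `k`-form, computed at `x` in the chart at `x` (which is the chart
in which `TangentSpace 𝓘(ℝ, E) x` is identified with `E`). -/
def KForm.d {k : ℕ} (α : KForm E X k) : KForm E X (k + 1) :=
  fun x => extDeriv (α.inChart x) (chartAt E x x)

/-- The exterior derivative. -/
def DiffForm.d (α : DiffForm E X) : DiffForm E X
  | 0 => 0
  | k + 1 => (α k).d

/-- The complex structure `J` on the real tangent space: multiplication by `i`. -/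
def complexStructure (x : X) : TangentSpace 𝓘(ℝ, E) x →L[ℝ] TangentSpace 𝓘(ℝ, E) x :=
  (Complex.I • ContinuousLinearMap.id ℝ E : E →L[ℝ] E)

variable [IsManifold 𝓘(ℂ, E) ω X]

variable (E X) in
/-- A Hermitian metric on a complex manifold: a smooth Riemannian metric `g` with
`g(Ju, Jv) = g(u, v)`. -/
structure HermitianMetric extends Bundle.ContMDiffRiemannianMetric 𝓘(ℝ, E) ∞ E
    (fun x : X => TangentSpace 𝓘(ℝ, E) x) where
  hermitian : ∀ (x : X) (u v : TangentSpace 𝓘(ℝ, E) x),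
    inner x (complexStructure x u) (complexStructure x v) = inner x u v

namespace HermitianMetric

variable (g : HermitianMetric E X)

/-- The metric at `x` as a bilinear form on `E = TangentSpace 𝓘(ℝ, E) x`. -/
def metricAt (x : X) : E →L[ℝ] E →L[ℝ] ℝ := g.inner x

/-- The fundamental form `w(u, v) = g(Ju, v)`. -/
def fundamentalForm : KForm E X 2 := fun x =>
  twoForm ((g.metricAt x).comp (complexStructure x : E →L[ℝ] E)) fun v => by
    have h1 : g.metricAt x (Complex.I • Complex.I • v) (Complex.I • v) =
      g.metricAt x (Complex.I • v) v := g.hermitian x (Complex.I • v : E) v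
    have h2 : g.metricAt x (Complex.I • v) v = g.metricAt x v (Complex.I • v) :=
      g.symm x (Complex.I • v : E) v
    rw [smul_smul, Complex.I_mul_I, neg_one_smul, map_neg, neg_apply,
      ← h2] at h1
    change g.metricAt x (Complex.I • v) v = 0
    linarith

end HermitianMetric

variable (E X) in
/-- A Kähler metric: a Hermitian metric whose fundamental form is closed. -/
structure KahlerMetric extends HermitianMetric E X where
  closed : toHermitianMetric.fundamentalForm.d = 0

namespace HermitianMetric

variable [FiniteDimensional ℂ E] (g : HermitianMetric E X)

/-- The pointwise Hermitian inner product of two forms (forms of different degrees are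
orthogonal). -/
def pointwiseInner (α β : DiffForm E X) (x : X) : ℂ :=
  ∑ k ∈ Finset.range (Module.finrank ℝ E + 1), formInner (g.metricAt x) (α k x) (β k x)

/-- The operator `Λ`: the pointwise adjoint of the operator `L α = w ∧ α`, where `w` is the
fundamental form. It lowers degrees by `2`. -/
def Λ (α : DiffForm E X) : DiffForm E X :=
  fun k x => dualLefschetz (g.metricAt x) (g.fundamentalForm x) (α (k + 2) x)

/-- The operator `Δ = [Λ, d] = Λ d - d Λ`. -/
def Δ (α : DiffForm E X) : DiffForm E X := g.Λ α.d - (g.Λ α).d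

/-- The metric in the chart at `p`. -/
def inChart (p : X) (y : E) : E →L[ℝ] E →L[ℝ] ℝ :=
  (g.metricAt ((chartAt E p).symm y)).bilinearComp (chartSymmDeriv p y) (chartSymmDeriv p y)

variable [MeasurableSpace E] [BorelSpace E] [MeasurableSpace X] [BorelSpace X]

/-- The Riemannian volume on the domain of the chart at `p`: in the coordinates given by a basis of
`E`, it is `√(det (g_ij))` times the Lebesgue measure. -/
def chartVolume (p : X) : Measure X :=
  (((Module.finBasis ℝ E).addHaar.restrict (chartAt E p).target).withDensity fun y =>
    ENNReal.ofReal √(gram (g.inChart p y) (Module.finBasis ℝ E)).det).map (chartAt E p).symm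

/-- The Riemannian volume measure: the smallest measure that dominates the volumes of all the
charts. As these agree on overlaps, it restricts to `chartVolume p` on the domain of the chart at
`p`. -/
def volume : Measure X := ⨆ p : X, g.chartVolume p

/-- The operator `B` on smooth forms is the formal adjoint of `A`:
`∫ ⟨Aα, β⟩ dvol = ∫ ⟨α, Bβ⟩ dvol` for all smooth `α`, `β` such that `α` has compact support. -/
structure IsFormalAdjoint (A B : DiffForm E X → DiffForm E X) : Prop where
  smooth : ∀ β : DiffForm E X, β.IsSmooth → (B β).IsSmooth
  adjoint : ∀ α β : DiffForm E X, α.IsSmooth → β.IsSmooth → α.IsCompactlySupported →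
    ∫ x, g.pointwiseInner (A α) β x ∂g.volume = ∫ x, g.pointwiseInner α (B β) x ∂g.volume

end HermitianMetric

end Manifold

end KahlerGeometry

end

open KahlerGeometry

/-! On a Kähler manifold the formal adjoint of `Δ` is the twisted differential dᶜ = J d J⁻¹, where J
acts on forms by pullback along v ↦ iv. Both identities are then consequences of d dᶜ + dᶜ d = 0. In
a holomorphic chart dᶜ is ∑ (eⁱ ∘ J) ∧ ∂_i with J constant, so d dᶜ + dᶜ d alternates a symmetric
expression in the second derivatives and vanishes (`extDeriv_flatDc_add`, `DiffForm.d_dc_add`).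

Formal adjoints are unique on smooth forms, because a smooth γ orthogonal to all compactly supported
forms is orthogonal to χγ for every bump function χ (`eq_zero_of_integral_eq_zero`,
`IsFormalAdjoint.eq`). Hence any adjoint of `Δ` agrees with dᶜ, which gives the first identity. For
the second, pairing Δd* + d*Δ with a compactly supported η and moving all operators onto η produces
d dᶜη + dᶜdη = 0 (`Δ_dStar_add`). An adjoint of d exists because d = J⁻¹ dᶜ J and J is unitary: it
is J⁻¹ Δ J (`isFormalAdjoint_d`).

The substance is the adjointness of `Δ` and dᶜ. In a chart, √(det g) (⟨Δα, β⟩ - ⟨α, dᶜβ⟩) is the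
coordinate divergence of the field √(det g) ∑ g^{ij} ⟨ι_{J b_i} α, β⟩
(`sum_lineDeriv_boundaryField`). Normal coordinates are not needed: at each point one takes a basis
orthonormal for the metric there and carries the first derivatives C of the metric along. The
principal part of [Λ, d] is ∑ ι_{J e_m} ∂_m (`IsONB.lambdaForm_alternatizeUncurryFin_succ`). The
Kähler condition is used for the zeroth-order terms, in two ways.
`IsKahlerJet.sum_curryLeft_curryLeft` matches the derivative of Λ with the derivative of the inner
product of forms; `IsKahlerJet.trace_eq` cancels the derivative of √(det g) against that of g^{ij}.

The local statement is integrated with the divergence theorem for compactly supported fields and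
globalized by a partition of unity (`KForm.induction_on_support`), after the volume measure has been
identified with the chart volumes (`volume_restrict_source`). -/

noncomputable section

namespace KahlerGeometry

/-! ### Metric traces, orthonormal bases and compatible complex structures. -/

section LinearAlgebra

variable {V : Type*} [NormedAddCommGroup V] [NormedSpace ℝ V]

/-- A map of two variables that is `ℝ`-linear in each of them. -/
structure IsBilin {F : Type*} [AddCommGroup F] [Module ℝ F] (φ : V → V → F) : Prop where
  add_left : ∀ u u' v, φ (u + u') v = φ u v + φ u' v
  smul_left : ∀ (c : ℝ) u v, φ (c • u) v = c • φ u v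
  add_right : ∀ u v v', φ u (v + v') = φ u v + φ u v'
  smul_right : ∀ (c : ℝ) u v, φ u (c • v) = c • φ u v

/-- The linear map of two variables given by a bilinear function. -/
def IsBilin.toLinearMap {F : Type*} [AddCommGroup F] [Module ℝ F] {φ : V → V → F}
    (h : IsBilin φ) : V →ₗ[ℝ] V →ₗ[ℝ] F :=
  LinearMap.mk₂ ℝ φ h.add_left h.smul_left h.add_right h.smul_right

theorem IsBilin.swap {F : Type*} [AddCommGroup F] [Module ℝ F] {φ : V → V → F}
    (h : IsBilin φ) : IsBilin fun u v => φ v u :=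
  ⟨fun u u' v => h.add_right v u u', fun c u v => h.smul_right c v u,
    fun u v v' => h.add_left v v' u, fun c u v => h.smul_left c v u⟩

theorem IsBilin.sum_sum {F : Type*} [AddCommGroup F] [Module ℝ F] {φ : V → V → F}
    (h : IsBilin φ) {ι κ : Type*} [Fintype ι] [Fintype κ] (a : ι → ℝ) (u : ι → V) (b : κ → ℝ)
    (v : κ → V) :
    φ (∑ i, a i • u i) (∑ j, b j • v j) = ∑ i, ∑ j, (a i * b j) • φ (u i) (v j) := by
  change h.toLinearMap _ _ = ∑ i, ∑ j, (a i * b j) • h.toLinearMap (u i) (v j)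
  simp only [map_sum, LinearMap.sum_apply, map_smul, LinearMap.smul_apply, Finset.smul_sum,
    smul_smul]
  rw [Finset.sum_comm]
  simp only [mul_comm]

/-- The basis `e` is orthonormal for `g`. -/
def IsONB {ι : Type*} [DecidableEq ι] (g : V →L[ℝ] V →L[ℝ] ℝ) (e : Module.Basis ι ℝ V) : Prop :=
  ∀ i j, g (e i) (e j) = if i = j then 1 else 0

theorem IsONB.repr_eq {ι : Type*} [DecidableEq ι] [Fintype ι] {g : V →L[ℝ] V →L[ℝ] ℝ}
    {e : Module.Basis ι ℝ V} (he : IsONB g e) (v : V) (i : ι) : e.repr v i = g v (e i) := by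
  conv_rhs => rw [← e.sum_repr v]
  simp [-Module.Basis.sum_repr, he _ _]

theorem IsONB.sum_smul {ι : Type*} [DecidableEq ι] [Fintype ι] {g : V →L[ℝ] V →L[ℝ] ℝ}
    {e : Module.Basis ι ℝ V} (he : IsONB g e) (v : V) : ∑ i, g v (e i) • e i = v := by
  simp only [← he.repr_eq]
  exact e.sum_repr v

theorem exists_isONB [FiniteDimensional ℝ V] {g : V →L[ℝ] V →L[ℝ] ℝ}
    (hs : ∀ u v, g u v = g v u) (hp : ∀ v, v ≠ 0 → 0 < g v v) :
    ∃ e : Module.Basis (Fin (Module.finrank ℝ V)) ℝ V, IsONB g e := by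
  let B : LinearMap.BilinForm ℝ V := g.toLinearMap₁₂
  have hB : ∀ u v, B u v = g u v := fun u v => rfl
  obtain ⟨v, hv⟩ := LinearMap.BilinForm.exists_orthogonal_basis (B := B) ⟨fun u v => hs u v⟩
  have hpos : ∀ i, 0 < g (v i) (v i) := fun i => hp _ (v.ne_zero i)
  refine ⟨v.unitsSMul fun i => Units.mk0 ((√(g (v i) (v i)))⁻¹)
    (inv_ne_zero (Real.sqrt_ne_zero'.2 (hpos i))), fun i j => ?_⟩
  simp only [Module.Basis.unitsSMul_apply, Units.smul_mk0, map_smul, smul_apply,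
    smul_eq_mul]
  split_ifs with h
  · subst h
    have := Real.mul_self_sqrt (hpos i).le
    have h0 := Real.sqrt_ne_zero'.2 (hpos i)
    field_simp
    linarith
  · have : g (v i) (v j) = 0 := hv h
    simp [this]

theorem IsONB.gramInv {ι κ : Type*} [DecidableEq ι] [Fintype ι] [DecidableEq κ] [Fintype κ]
    {g : V →L[ℝ] V →L[ℝ] ℝ} {e : Module.Basis κ ℝ V} (he : IsONB g e) (b : Module.Basis ι ℝ V)
    (i j : ι) : (gram g b)⁻¹ i j = ∑ m, b.repr (e m) i * b.repr (e m) j := by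
  have hR : b.toMatrix e * e.toMatrix b = 1 := by
    rw [Module.Basis.toMatrix_mul_toMatrix_flip]
  have hR' : e.toMatrix b * b.toMatrix e = 1 := by
    rw [Module.Basis.toMatrix_mul_toMatrix_flip]
  have hG : gram g b = (e.toMatrix b).transpose * e.toMatrix b := by
    ext i j
    rw [gram, Matrix.of_apply, Matrix.mul_apply]
    conv_lhs => rw [← e.sum_repr (b i), ← e.sum_repr (b j)]
    simp [-Module.Basis.sum_repr, he _ _, Module.Basis.toMatrix_apply, mul_comm]
  have : (gram g b)⁻¹ = b.toMatrix e * (b.toMatrix e).transpose := by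
    refine Matrix.inv_eq_left_inv ?_
    rw [hG, Matrix.mul_assoc, ← Matrix.mul_assoc (b.toMatrix e).transpose,
      ← Matrix.transpose_mul, hR', Matrix.transpose_one, Matrix.one_mul, hR]
  rw [this, Matrix.mul_apply]
  rfl

/-- The inverse Gram matrix is R Rᵀ, with R the matrix of the orthonormal basis in `b`. This passes
from the definitions, written in `Module.finBasis`, to orthonormal traces, in which all later
computations are done. -/
theorem IsONB.sum_gramInv {ι κ : Type*} [DecidableEq ι] [Fintype ι] [DecidableEq κ] [Fintype κ]
    {g : V →L[ℝ] V →L[ℝ] ℝ} {e : Module.Basis κ ℝ V} (he : IsONB g e) (b : Module.Basis ι ℝ V)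
    {F : Type*} [AddCommGroup F] [Module ℝ F] {φ : V → V → F} (h : IsBilin φ) :
    ∑ i, ∑ j, (gram g b)⁻¹ i j • φ (b i) (b j) = ∑ m, φ (e m) (e m) := by
  have : ∀ m, φ (e m) (e m) =
      ∑ i, ∑ j, (b.repr (e m) i * b.repr (e m) j) • φ (b i) (b j) := by
    intro m
    rw [← h.sum_sum, b.sum_repr]
  simp only [he.gramInv b, Finset.sum_smul, this]
  rw [Finset.sum_comm' (t' := Finset.univ) (s' := fun _ => Finset.univ) (by simp)]
  conv_rhs => rw [Finset.sum_comm]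
  rw [Finset.sum_comm]
  refine Finset.sum_congr rfl fun i _ => ?_
  conv_rhs => rw [Finset.sum_comm]

theorem IsONB.sum_eq {ι κ : Type*} [DecidableEq ι] [Fintype ι] [DecidableEq κ] [Fintype κ]
    {g : V →L[ℝ] V →L[ℝ] ℝ} {e : Module.Basis κ ℝ V} (he : IsONB g e) {e' : Module.Basis ι ℝ V}
    (he' : IsONB g e')
    {F : Type*} [AddCommGroup F] [Module ℝ F] {φ : V → V → F} (h : IsBilin φ) :
    ∑ m, φ (e' m) (e' m) = ∑ m, φ (e m) (e m) := by
  rw [← he.sum_gramInv e' h, ← he'.sum_gramInv e' h]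

/-- A complex structure compatible with a bilinear form. -/
structure IsCompatible (g : V →L[ℝ] V →L[ℝ] ℝ) (J : V →L[ℝ] V) : Prop where
  sq : ∀ v, J (J v) = -v
  isometry : ∀ u v, g (J u) (J v) = g u v

/-- A complex structure as a linear equivalence. -/
def IsCompatible.equiv {g : V →L[ℝ] V →L[ℝ] ℝ} {J : V →L[ℝ] V} (h : IsCompatible g J) :
    V ≃ₗ[ℝ] V :=
  LinearEquiv.ofLinearMap J.toLinearMap (-J.toLinearMap) (by ext; simp [h.sq]) (by ext; simp [h.sq])

theorem IsONB.sum_complexStructure {κ : Type*} [DecidableEq κ] [Fintype κ]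
    {g : V →L[ℝ] V →L[ℝ] ℝ} {e : Module.Basis κ ℝ V} (he : IsONB g e) {J : V →L[ℝ] V}
    (hJ : IsCompatible g J)
    {F : Type*} [AddCommGroup F] [Module ℝ F] {φ : V → V → F} (h : IsBilin φ) :
    ∑ m, φ (J (e m)) (J (e m)) = ∑ m, φ (e m) (e m) := by
  have he' : IsONB g (e.map hJ.equiv) := fun i j =>
    (hJ.isometry (e i) (e j)).trans (he i j)
  exact he.sum_eq he' h

/-- J carries an orthonormal basis to an orthonormal basis and squares to -1, so replacing e by Je
in the trace of φ(u, Jv) moves J to the other slot with a sign. -/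
theorem IsONB.sum_complexStructure_left {κ : Type*} [DecidableEq κ] [Fintype κ]
    {g : V →L[ℝ] V →L[ℝ] ℝ} {e : Module.Basis κ ℝ V} (he : IsONB g e) {J : V →L[ℝ] V}
    (hJ : IsCompatible g J)
    {F : Type*} [AddCommGroup F] [Module ℝ F] {φ : V → V → F} (h : IsBilin φ) :
    ∑ m, φ (J (e m)) (e m) = -∑ m, φ (e m) (J (e m)) := by
  have h' : IsBilin fun u v => φ u (J v) := by
    constructor <;> intros <;> simp [h.add_left, h.smul_left, h.add_right, h.smul_right]
  rw [← he.sum_complexStructure hJ h', ← Finset.sum_neg_distrib]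
  refine Finset.sum_congr rfl fun m _ => ?_
  have : φ (J (e m)) (-e m) = -φ (J (e m)) (e m) := by
    simpa using h.smul_right (-1) (J (e m)) (e m)
  rw [hJ.sq, this, neg_neg]

/-! ### The inner product of forms -/

variable {k : ℕ}

theorem curryLeft_curryLeft_swap (α : V [⋀^Fin (k + 2)]→L[ℝ] ℂ) (u v : V) :
    (α.curryLeft u).curryLeft v = -(α.curryLeft v).curryLeft u := by
  have h := α.curryLeft_same (u + v)
  simp only [map_add, ContinuousAlternatingMap.curryLeft_add, add_apply,
    ContinuousAlternatingMap.curryLeft_same, zero_add, add_zero] at h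
  exact eq_neg_of_add_eq_zero_left (by rw [← h]; abel)

theorem curryLeft_alternatizeUncurryFin_zero (T : V →L[ℝ] V [⋀^Fin 0]→L[ℝ] ℂ) (v : V) :
    (ContinuousAlternatingMap.alternatizeUncurryFin T).curryLeft v = T v := by
  ext w
  simp [ContinuousAlternatingMap.alternatizeUncurryFin_apply]

/-- Contraction with a vector, as a continuous linear map. -/
def contraction (v : V) : V [⋀^Fin (k + 1)]→L[ℝ] ℂ →L[ℝ] V [⋀^Fin k]→L[ℝ] ℂ :=
  (ContinuousLinearMap.apply ℝ _ v).comp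
    (ContinuousAlternatingMap.curryLeftLI (𝕜 := ℝ) (E := V) (F := ℂ) (n := k)).toContinuousLinearMap

@[simp]
theorem contraction_apply (v : V) (α : V [⋀^Fin (k + 1)]→L[ℝ] ℂ) :
    contraction v α = α.curryLeft v := rfl

/-- Here `alternatizeUncurryFin T` is ∑ eⁱ ∧ T(e_i), and this is the antiderivation rule for
contraction. Applied to T = Dα it governs the contractions of dα. -/
theorem curryLeft_alternatizeUncurryFin_succ (T : V →L[ℝ] V [⋀^Fin (k + 1)]→L[ℝ] ℂ) (v : V) :
    (ContinuousAlternatingMap.alternatizeUncurryFin T).curryLeft v =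
      T v - ContinuousAlternatingMap.alternatizeUncurryFin ((contraction v).comp T) := by
  ext w
  simp only [ContinuousAlternatingMap.curryLeft_apply_apply,
    ContinuousAlternatingMap.alternatizeUncurryFin_apply, ContinuousAlternatingMap.sub_apply]
  rw [Fin.sum_univ_succ]
  simp only [Fin.val_zero, pow_zero, one_smul, Matrix.cons_val_zero, Fin.val_succ,
    Matrix.cons_val_succ, ContinuousLinearMap.comp_apply, contraction_apply,
    ContinuousAlternatingMap.curryLeft_apply_apply, sub_eq_add_neg, ← Finset.sum_neg_distrib]
  congr 1
  refine Finset.sum_congr rfl fun i _ => ?_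
  rw [pow_succ, mul_neg, mul_one, neg_smul]
  congr 3
  funext j
  refine Fin.cases ?_ (fun j => ?_) j <;> simp [Fin.removeNth]

variable [FiniteDimensional ℝ V] {g : V →L[ℝ] V →L[ℝ] ℝ}

theorem formInner_zero_degree (g : V →L[ℝ] V →L[ℝ] ℝ) (α β : V [⋀^Fin 0]→L[ℝ] ℂ) :
    formInner g α β = α 0 * conj (β 0) := by
  simp only [formInner, Nat.factorial_zero, Finset.univ_unique, Finset.sum_singleton,
    Finset.univ_eq_empty, Finset.prod_empty]
  rw [Subsingleton.elim (fun a : Fin 0 => _) (0 : Fin 0 → V)]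
  simp

/-- Splitting off the first index of each multi-index leaves 1/(k+1) of the factorial. This
recursion in the degree lets the properties of the inner product be proved by induction through
contractions. -/
theorem formInner_succ_gram (g : V →L[ℝ] V →L[ℝ] ℝ) (α β : V [⋀^Fin (k + 1)]→L[ℝ] ℂ) :
    formInner g α β = ((k : ℝ) + 1)⁻¹ • ∑ i, ∑ j, (gram g (Module.finBasis ℝ V))⁻¹ i j •
      formInner g (α.curryLeft (Module.finBasis ℝ V i)) (β.curryLeft (Module.finBasis ℝ V j)) := by
  set b := Module.finBasis ℝ V with hb
  have hcons : ∀ (γ : V [⋀^Fin (k + 1)]→L[ℝ] ℂ) i (I : Fin k → Fin (Module.finrank ℝ V)),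
      γ (fun a => b (Fin.cons (α := fun _ => Fin (Module.finrank ℝ V)) i I a)) =
        γ.curryLeft (b i) fun a => b (I a) := by
    intro γ i I
    rw [ContinuousAlternatingMap.curryLeft_apply_apply]
    congr 1
    funext a
    refine Fin.cases ?_ (fun a => ?_) a <;> simp
  have h0 : ((k.factorial : ℕ) : ℂ) ≠ 0 := by exact_mod_cast k.factorial_ne_zero
  have h1 : (k : ℂ) + 1 ≠ 0 := by exact_mod_cast k.succ_ne_zero
  simp only [formInner, ← hb, Complex.real_smul, Finset.mul_sum]
  rw [← Equiv.sum_comp (Fin.consEquiv fun _ => Fin (Module.finrank ℝ V)), Fintype.sum_prod_type]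
  refine Finset.sum_congr rfl fun i _ => ?_
  conv_rhs => rw [Finset.sum_comm]
  refine Finset.sum_congr rfl fun I _ => ?_
  rw [← Equiv.sum_comp (Fin.consEquiv fun _ => Fin (Module.finrank ℝ V)), Fintype.sum_prod_type]
  refine Finset.sum_congr rfl fun j _ => Finset.sum_congr rfl fun J _ => ?_
  simp only [Fin.consEquiv, Equiv.coe_fn_mk]
  rw [hcons, hcons, Fin.prod_univ_succ, Nat.factorial_succ]
  simp only [Fin.cons_zero, Fin.cons_succ]
  push_cast
  field_simp

theorem formInner_add_left (α α' β : V [⋀^Fin k]→L[ℝ] ℂ) :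
    formInner g (α + α') β = formInner g α β + formInner g α' β := by
  simp only [formInner, ContinuousAlternatingMap.add_apply, add_mul, mul_add,
    Finset.sum_add_distrib]

theorem formInner_add_right (α β β' : V [⋀^Fin k]→L[ℝ] ℂ) :
    formInner g α (β + β') = formInner g α β + formInner g α β' := by
  simp only [formInner, ContinuousAlternatingMap.add_apply, map_add, mul_add,
    Finset.sum_add_distrib]

theorem formInner_smul_left (c : ℂ) (α β : V [⋀^Fin k]→L[ℝ] ℂ) :
    formInner g (c • α) β = c * formInner g α β := by
  simp only [formInner, ContinuousAlternatingMap.smul_apply, Finset.mul_sum, smul_eq_mul]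
  refine Finset.sum_congr rfl fun _ _ => Finset.sum_congr rfl fun _ _ => ?_
  ring

theorem formInner_smul_right (c : ℂ) (α β : V [⋀^Fin k]→L[ℝ] ℂ) :
    formInner g α (c • β) = conj c * formInner g α β := by
  simp only [formInner, ContinuousAlternatingMap.smul_apply, Finset.mul_sum, smul_eq_mul, map_mul]
  refine Finset.sum_congr rfl fun _ _ => Finset.sum_congr rfl fun _ _ => ?_
  ring

theorem formInner_rsmul_left (c : ℝ) (α β : V [⋀^Fin k]→L[ℝ] ℂ) :
    formInner g (c • α) β = c • formInner g α β := by
  rw [show c • α = (c : ℂ) • α by ext; simp, formInner_smul_left, Complex.real_smul]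

theorem formInner_rsmul_right (c : ℝ) (α β : V [⋀^Fin k]→L[ℝ] ℂ) :
    formInner g α (c • β) = c • formInner g α β := by
  rw [show c • β = (c : ℂ) • β by ext; simp, formInner_smul_right, Complex.conj_ofReal,
    Complex.real_smul]

/-- The inner product of forms as a bilinear map over the reals. -/
def formInnerₗ (g : V →L[ℝ] V →L[ℝ] ℝ) (k : ℕ) :
    V [⋀^Fin k]→L[ℝ] ℂ →ₗ[ℝ] V [⋀^Fin k]→L[ℝ] ℂ →ₗ[ℝ] ℂ :=
  LinearMap.mk₂ ℝ (formInner g) formInner_add_left formInner_rsmul_left formInner_add_right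
    formInner_rsmul_right

theorem formInnerₗ_apply (α β : V [⋀^Fin k]→L[ℝ] ℂ) : formInnerₗ g k α β = formInner g α β := rfl

theorem formInner_sum_left {ι : Type*} (s : Finset ι) (α : ι → V [⋀^Fin k]→L[ℝ] ℂ)
    (β : V [⋀^Fin k]→L[ℝ] ℂ) :
    formInner g (∑ i ∈ s, α i) β = ∑ i ∈ s, formInner g (α i) β := by
  simp only [← formInnerₗ_apply, map_sum, LinearMap.sum_apply]

theorem formInner_neg_left (α β : V [⋀^Fin k]→L[ℝ] ℂ) :
    formInner g (-α) β = -formInner g α β := by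
  simp only [← formInnerₗ_apply, map_neg, LinearMap.neg_apply]

theorem formInner_neg_right (α β : V [⋀^Fin k]→L[ℝ] ℂ) :
    formInner g α (-β) = -formInner g α β := by
  simp only [← formInnerₗ_apply, map_neg]

theorem formInner_sub_left (α α' β : V [⋀^Fin k]→L[ℝ] ℂ) :
    formInner g (α - α') β = formInner g α β - formInner g α' β := by
  simp only [← formInnerₗ_apply, map_sub, LinearMap.sub_apply]

theorem formInner_sub_right (α β β' : V [⋀^Fin k]→L[ℝ] ℂ) :
    formInner g α (β - β') = formInner g α β - formInner g α β' := by
  simp only [← formInnerₗ_apply, map_sub]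

theorem formInner_zero_left (β : V [⋀^Fin k]→L[ℝ] ℂ) : formInner g 0 β = 0 := by
  simp only [← formInnerₗ_apply, map_zero, LinearMap.zero_apply]

theorem formInner_zero_right (α : V [⋀^Fin k]→L[ℝ] ℂ) : formInner g α 0 = 0 := by
  simp only [← formInnerₗ_apply, map_zero]

theorem isBilin_formInner_curryLeft (g : V →L[ℝ] V →L[ℝ] ℝ) (α β : V [⋀^Fin (k + 1)]→L[ℝ] ℂ) :
    IsBilin fun u v => formInner g (α.curryLeft u) (β.curryLeft v) := by
  constructor <;> intros <;> simp [formInner_add_left, formInner_add_right,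
    formInner_rsmul_left, formInner_rsmul_right]

section ONB

open scoped ComplexOrder

variable {κ : Type*} [DecidableEq κ] [Fintype κ] {e : Module.Basis κ ℝ V}

theorem IsONB.formInner_succ (he : IsONB g e) (α β : V [⋀^Fin (k + 1)]→L[ℝ] ℂ) :
    formInner g α β =
      ((k : ℝ) + 1)⁻¹ • ∑ m, formInner g (α.curryLeft (e m)) (β.curryLeft (e m)) := by
  rw [formInner_succ_gram, he.sum_gramInv _ (isBilin_formInner_curryLeft g α β)]

theorem IsONB.sum_formInner (he : IsONB g e) (α β : V [⋀^Fin (k + 1)]→L[ℝ] ℂ) :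
    ∑ m, formInner g (α.curryLeft (e m)) (β.curryLeft (e m)) =
      ((k : ℝ) + 1) • formInner g α β := by
  rw [he.formInner_succ, smul_smul, mul_inv_cancel₀ (by positivity), one_smul]

theorem IsONB.conj_formInner (he : IsONB g e) (α β : V [⋀^Fin k]→L[ℝ] ℂ) :
    conj (formInner g α β) = formInner g β α := by
  induction k with
  | zero => simp [formInner_zero_degree, mul_comm]
  | succ k ih => simp [he.formInner_succ, ih]

theorem IsONB.formInner_self_nonneg (he : IsONB g e) (α : V [⋀^Fin k]→L[ℝ] ℂ) :
    0 ≤ formInner g α α := by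
  induction k with
  | zero => rw [formInner_zero_degree, Complex.mul_conj]; exact_mod_cast Complex.normSq_nonneg _
  | succ k ih =>
    rw [he.formInner_succ, Complex.real_smul]
    exact mul_nonneg (by exact_mod_cast (by positivity)) (Finset.sum_nonneg fun m _ => ih _)

theorem IsONB.formInner_self_eq_zero (he : IsONB g e) {α : V [⋀^Fin k]→L[ℝ] ℂ}
    (h : formInner g α α = 0) : α = 0 := by
  induction k with
  | zero =>
    rw [formInner_zero_degree, Complex.mul_conj] at h
    ext v
    rw [Subsingleton.elim v 0]
    simpa using h
  | succ k ih =>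
    have hs := he.sum_formInner α α
    rw [h, smul_zero, Finset.sum_eq_zero_iff_of_nonneg
      fun m _ => he.formInner_self_nonneg _] at hs
    have : α.curryLeft = 0 := ContinuousLinearMap.coe_injective
      (e.ext fun m => ih (hs m (Finset.mem_univ _)))
    ext v
    rw [← Fin.cons_self_tail v]
    exact congrArg (fun T : V →L[ℝ] V [⋀^Fin k]→L[ℝ] ℂ => T (v 0) (Fin.tail v)) this

theorem IsONB.ext_formInner (he : IsONB g e) {α β : V [⋀^Fin k]→L[ℝ] ℂ}
    (h : ∀ γ, formInner g γ α = formInner g γ β) : α = β := by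
  rw [← sub_eq_zero]
  exact he.formInner_self_eq_zero (by rw [formInner_sub_right, h, sub_self])

/-- The adjoint of e^m ∧ · is contraction with e_m. The induction on the degree combines the
recursion for the inner product with the antiderivation rule. -/
theorem IsONB.formInner_alternatizeUncurryFin_left (he : IsONB g e)
    (T : V →L[ℝ] V [⋀^Fin k]→L[ℝ] ℂ) (β : V [⋀^Fin (k + 1)]→L[ℝ] ℂ) :
    formInner g (ContinuousAlternatingMap.alternatizeUncurryFin T) β =
      ∑ m, formInner g (T (e m)) (β.curryLeft (e m)) := by
  induction k with
  | zero => simp [he.formInner_succ, curryLeft_alternatizeUncurryFin_zero]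
  | succ k ih =>
    have h : ∀ m, formInner g
        (ContinuousAlternatingMap.alternatizeUncurryFin ((contraction (e m)).comp T))
        (β.curryLeft (e m)) = -∑ p, formInner g ((T (e p)).curryLeft (e m))
          ((β.curryLeft (e p)).curryLeft (e m)) := by
      intro m
      rw [ih, ← Finset.sum_neg_distrib]
      refine Finset.sum_congr rfl fun p _ => ?_
      rw [curryLeft_curryLeft_swap β, formInner_neg_right]
      rfl
    rw [he.formInner_succ]
    simp only [curryLeft_alternatizeUncurryFin_succ, formInner_sub_left, h, sub_neg_eq_add,
      Finset.sum_add_distrib]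
    rw [Finset.sum_comm]
    simp only [he.sum_formInner, ← Finset.smul_sum]
    rw [smul_add, smul_smul, ← add_smul]
    have : ((k + 1 : ℕ) + 1 : ℝ) ≠ 0 := by positivity
    -- The term T(e_m) contributes with weight 1/(k+2), the inductive term with weight (k+1)/(k+2).
    rw [show (((k + 1 : ℕ) : ℝ) + 1)⁻¹ + (((k + 1 : ℕ) : ℝ) + 1)⁻¹ * ((k : ℝ) + 1) = 1 by
      push_cast at *; field_simp; ring, one_smul]

theorem IsONB.formInner_alternatizeUncurryFin_right (he : IsONB g e)
    (T : V →L[ℝ] V [⋀^Fin k]→L[ℝ] ℂ) (β : V [⋀^Fin (k + 1)]→L[ℝ] ℂ) :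
    formInner g β (ContinuousAlternatingMap.alternatizeUncurryFin T) =
      ∑ m, formInner g (β.curryLeft (e m)) (T (e m)) := by
  rw [← he.conj_formInner, he.formInner_alternatizeUncurryFin_left, map_sum]
  simp only [he.conj_formInner]

end ONB

end LinearAlgebra

/-! ### The operator Λ as a metric trace of double contractions. -/

section Lambda

variable {V : Type*} [NormedAddCommGroup V] [NormedSpace ℝ V] {k : ℕ}

theorem isBilin_curryLeft_curryLeft (α : V [⋀^Fin (k + 2)]→L[ℝ] ℂ) (J : V →L[ℝ] V) :
    IsBilin fun u v => (α.curryLeft u).curryLeft (J v) := by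
  constructor <;> intros <;> simp

theorem curryLeft_sub (α β : V [⋀^Fin (k + 1)]→L[ℝ] ℂ) :
    (α - β).curryLeft = α.curryLeft - β.curryLeft :=
  (ContinuousAlternatingMap.curryLeftLI (𝕜 := ℝ) (E := V) (F := ℂ) (n := k)).toLinearMap.map_sub α β

theorem curryLeft_sum_smul {ι : Type*} (s : Finset ι) (c : ι → ℝ) (v : ι → V)
    (α : V [⋀^Fin (k + 1)]→L[ℝ] ℂ) :
    α.curryLeft (∑ i ∈ s, c i • v i) = ∑ i ∈ s, c i • α.curryLeft (v i) := by
  simp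

theorem form_eq_zero_of_finrank_lt [FiniteDimensional ℝ V] (h : Module.finrank ℝ V < k)
    (α : V [⋀^Fin k]→L[ℝ] ℂ) : α = 0 := by
  ext v
  refine α.toAlternatingMap.map_linearDependent v fun hv => ?_
  have := hv.fintype_card_le_finrank
  simp at this
  omega

variable [FiniteDimensional ℝ V] {g : V →L[ℝ] V →L[ℝ] ℝ}

/-- `dualLefschetz` is only a chosen adjoint. This explicit adjoint, together with nondegeneracy of
the inner product, identifies it with `lambdaForm`. -/
theorem formInner_lefschetz_gram (g : V →L[ℝ] V →L[ℝ] ℝ) (w : V [⋀^Fin 2]→L[ℝ] ℂ)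
    (α : V [⋀^Fin k]→L[ℝ] ℂ) (β : V [⋀^Fin (k + 2)]→L[ℝ] ℂ) :
    formInner g (lefschetz w α) β = formInner g α ((2 : ℂ)⁻¹ •
      ∑ I : Fin 2 → Fin (Module.finrank ℝ V), ∑ J : Fin 2 → Fin (Module.finrank ℝ V),
      (((∏ a, (gram g (Module.finBasis ℝ V))⁻¹ (I a) (J a) : ℝ) : ℂ) *
        conj (w (fun a => Module.finBasis ℝ V (I a)))) •
        (β.curryLeft (Module.finBasis ℝ V (J 0))).curryLeft (Module.finBasis ℝ V (J 1))) := by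
  set b := Module.finBasis ℝ V with hb
  set H := (gram g b)⁻¹ with hH
  have hβ : ∀ (J₁ : Fin 2 → Fin (Module.finrank ℝ V)) (J₂ : Fin k → Fin (Module.finrank ℝ V)),
      (reindex (Nat.add_comm 2 k).symm β)
        (fun a => b (Fin.append J₁ J₂ a)) =
      (β.curryLeft (b (J₁ 0))).curryLeft (b (J₁ 1)) (fun a => b (J₂ a)) := by
    intro J₁ J₂
    rw [ContinuousAlternatingMap.curryLeft_apply_apply,
      ContinuousAlternatingMap.curryLeft_apply_apply]
    change β _ = β _
    congr 1
    funext a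
    refine Fin.cases ?_ (fun a => Fin.cases ?_ (fun a => ?_) a) a
    · change b (Fin.append J₁ J₂ (Fin.castAdd k 0)) = _
      simp
    · change b (Fin.append J₁ J₂ (Fin.castAdd k 1)) = _
      simp
    · have : (Fin.cast (Nat.add_comm 2 k).symm a.succ.succ) = Fin.natAdd 2 a := by
        ext; simp; omega
      change b (Fin.append J₁ J₂ (Fin.cast (Nat.add_comm 2 k).symm a.succ.succ)) = _
      rw [this]
      simp
  rw [lefschetz, formInner_congr, wedge, formInner_alternatization, formInner]
  simp only [← hb, ← hH]
  rw [← Equiv.sum_comp (Fin.appendEquiv 2 k), Fintype.sum_prod_type, Finset.sum_comm]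
  rw [Finset.mul_sum, Finset.mul_sum]
  refine Finset.sum_congr rfl fun I₂ _ => ?_
  have h1 : ∀ I₁ : Fin 2 → Fin (Module.finrank ℝ V),
      ∑ J : Fin (2 + k) → Fin (Module.finrank ℝ V),
        ((∏ a, H (Fin.append I₁ I₂ a) (J a) : ℝ) : ℂ) *
          (tensor w α (fun a => b (Fin.append I₁ I₂ a)) *
            conj ((reindex (Nat.add_comm 2 k).symm β)
              (fun a => b (J a)))) =
      ∑ J₂ : Fin k → Fin (Module.finrank ℝ V), ∑ J₁ : Fin 2 → Fin (Module.finrank ℝ V),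
        ((∏ a, H (I₂ a) (J₂ a) : ℝ) : ℂ) * (α (fun a => b (I₂ a)) *
          (((∏ a, H (I₁ a) (J₁ a) : ℝ) : ℂ) * w (fun a => b (I₁ a)) *
            conj ((β.curryLeft (b (J₁ 0))).curryLeft (b (J₁ 1)) (fun a => b (J₂ a))))) := by
    intro I₁
    rw [← Equiv.sum_comp (Fin.appendEquiv 2 k), Fintype.sum_prod_type, Finset.sum_comm]
    refine Finset.sum_congr rfl fun J₂ _ => Finset.sum_congr rfl fun J₁ _ => ?_
    simp only [Fin.appendEquiv, Equiv.coe_fn_mk]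
    rw [hβ, tensor_apply, Fin.prod_univ_add]
    simp only [Fin.append_left, Fin.append_right]
    push_cast
    ring
  simp only [Fin.appendEquiv, Equiv.coe_fn_mk]
  rw [Finset.sum_congr rfl (fun I₁ _ => h1 I₁), Finset.sum_comm, Finset.mul_sum, Finset.mul_sum]
  refine Finset.sum_congr rfl fun J₂ _ => ?_
  simp only [ContinuousAlternatingMap.smul_apply, ContinuousAlternatingMap.sum_apply,
    smul_eq_mul, map_mul, map_sum, Complex.conj_conj, map_inv₀, Complex.conj_ofReal, map_ofNat,
    Finset.mul_sum]
  refine Finset.sum_congr rfl fun I₁ _ => Finset.sum_congr rfl fun J₁ _ => ?_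
  have : (k.factorial : ℂ) ≠ 0 := by exact_mod_cast k.factorial_ne_zero
  simp only [Nat.factorial_two]
  push_cast
  field_simp

/-- The operator `Λ` of the Hermitian metric `g` with complex structure `J`:
`Λ α = 1/2 ∑ g^{ij} α(b_i, J b_j, ⋯)`. -/
def lambdaForm (g : V →L[ℝ] V →L[ℝ] ℝ) (J : V →L[ℝ] V) :
    V [⋀^Fin (k + 2)]→L[ℝ] ℂ →L[ℝ] V [⋀^Fin k]→L[ℝ] ℂ :=
  (2 : ℝ)⁻¹ • ∑ i, ∑ j, (gram g (Module.finBasis ℝ V))⁻¹ i j •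
    (contraction (J (Module.finBasis ℝ V j))).comp (contraction (Module.finBasis ℝ V i))

theorem lambdaForm_apply (g : V →L[ℝ] V →L[ℝ] ℝ) (J : V →L[ℝ] V)
    (α : V [⋀^Fin (k + 2)]→L[ℝ] ℂ) :
    lambdaForm g J α = (2 : ℝ)⁻¹ • ∑ i, ∑ j, (gram g (Module.finBasis ℝ V))⁻¹ i j •
      (α.curryLeft (Module.finBasis ℝ V i)).curryLeft (J (Module.finBasis ℝ V j)) := by
  simp [lambdaForm]

section ONB

variable {κ : Type*} [DecidableEq κ] [Fintype κ] {e : Module.Basis κ ℝ V}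

theorem IsONB.lambdaForm_eq (he : IsONB g e) (J : V →L[ℝ] V) (α : V [⋀^Fin (k + 2)]→L[ℝ] ℂ) :
    lambdaForm g J α = (2 : ℝ)⁻¹ • ∑ m, (α.curryLeft (e m)).curryLeft (J (e m)) := by
  rw [lambdaForm_apply, he.sum_gramInv _ (isBilin_curryLeft_curryLeft α J)]

theorem IsONB.dualLefschetz_eq (he : IsONB g e) (J : V →L[ℝ] V)
    (hJ : ∀ v, (g.comp J) v v = 0) (α : V [⋀^Fin (k + 2)]→L[ℝ] ℂ) :
    dualLefschetz g (twoForm (g.comp J) hJ) α = lambdaForm g J α := by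
  refine he.ext_formInner fun γ => ?_
  rw [← formInner_lefschetz, formInner_lefschetz_gram, lambdaForm_apply]
  congr 1
  rw [show ((2 : ℂ)⁻¹) = (((2 : ℝ)⁻¹ : ℝ) : ℂ) by simp]
  set b := Module.finBasis ℝ V
  -- One of the two inverse Gram matrices is absorbed: raising the index of g(J b_i, ·) returns the
  -- vector J b_i.
  have h1 : ∀ i j, ∑ p, ∑ q, (gram g b)⁻¹ p q • (g (J (b i)) (b p) •
      (α.curryLeft (b j)).curryLeft (b q)) = (α.curryLeft (b j)).curryLeft (J (b i)) := by
    intro i j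
    have hbil : IsBilin fun u v : V => g (J (b i)) u • (α.curryLeft (b j)).curryLeft v := by
      constructor <;> intros <;> simp [add_smul, smul_smul, mul_comm]
    rw [he.sum_gramInv b hbil, ← curryLeft_sum_smul, he.sum_smul]
  rw [Complex.coe_smul]
  congr 1
  -- The trace of a bilinear map is unchanged when its arguments are swapped; going through the
  -- orthonormal basis exchanges the roles of i and j so that the sums match.
  rw [he.sum_gramInv b (isBilin_curryLeft_curryLeft α J),
    ← he.sum_gramInv b (isBilin_curryLeft_curryLeft α J).swap,
    ← Equiv.sum_comp (finTwoArrowEquiv _).symm, Fintype.sum_prod_type]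
  refine Finset.sum_congr rfl fun i _ => ?_
  simp only [← h1, Finset.smul_sum]
  simp only [← Equiv.sum_comp (finTwoArrowEquiv (Fin (Module.finrank ℝ V))).symm,
    Fintype.sum_prod_type]
  rw [Finset.sum_comm]
  refine Finset.sum_congr rfl fun j _ => Finset.sum_congr rfl fun p _ =>
    Finset.sum_congr rfl fun q _ => ?_
  have htw : twoForm (g.comp J) hJ (fun a => b ((finTwoArrowEquiv _).symm (i, p) a)) =
    (g (J (b i)) (b p) : ℂ) := rfl
  rw [htw]
  ext v
  simp [Fin.prod_univ_two]
  ring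

theorem IsONB.lambdaForm_alternatizeUncurryFin_zero (he : IsONB g e) {J : V →L[ℝ] V}
    (hJ : IsCompatible g J) (T : V →L[ℝ] V [⋀^Fin 1]→L[ℝ] ℂ) :
    lambdaForm g J (ContinuousAlternatingMap.alternatizeUncurryFin T) =
      ∑ m, (T (e m)).curryLeft (J (e m)) := by
  have hbil : IsBilin fun u v => (T u).curryLeft v := by
    constructor <;> intros <;> simp [ContinuousAlternatingMap.curryLeft_add,
      ContinuousAlternatingMap.curryLeft_smul]
  have h := he.sum_complexStructure_left hJ hbil
  rw [he.lambdaForm_eq]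
  simp only [curryLeft_alternatizeUncurryFin_succ,     curryLeft_sub, sub_apply, Finset.sum_sub_distrib,
    curryLeft_alternatizeUncurryFin_zero, ContinuousLinearMap.comp_apply, contraction_apply]
  rw [h, sub_neg_eq_add, ← two_smul ℝ, smul_smul]
  norm_num

/-- This is the symbol of [Λ, d]. The antiderivation rule used twice gives ι_{Je} T(e) - ι_e T(Je)
plus a term in which both contractions fall on T. By `IsONB.sum_complexStructure_left` the first two
have equal sums, which cancels the factor 1/2 in Λ. -/
theorem IsONB.lambdaForm_alternatizeUncurryFin_succ (he : IsONB g e) {J : V →L[ℝ] V}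
    (hJ : IsCompatible g J) (T : V →L[ℝ] V [⋀^Fin (k + 2)]→L[ℝ] ℂ) :
    lambdaForm g J (ContinuousAlternatingMap.alternatizeUncurryFin T) =
      ∑ m, (T (e m)).curryLeft (J (e m)) +
        ContinuousAlternatingMap.alternatizeUncurryFin ((lambdaForm g J).comp T) := by
  have hbil : IsBilin fun u v => (T u).curryLeft v := by
    constructor <;> intros <;> simp [ContinuousAlternatingMap.curryLeft_add,
      ContinuousAlternatingMap.curryLeft_smul]
  have h := he.sum_complexStructure_left hJ hbil
  have h2 : ContinuousAlternatingMap.alternatizeUncurryFin ((lambdaForm g J).comp T) =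
      (2 : ℝ)⁻¹ • ∑ m, ContinuousAlternatingMap.alternatizeUncurryFin
        ((contraction (J (e m))).comp ((contraction (e m)).comp T)) := by
    have : (lambdaForm g J).comp T =
        (2 : ℝ)⁻¹ • ∑ m, (contraction (J (e m))).comp ((contraction (e m)).comp T) := by
      ext1 v
      simp [he.lambdaForm_eq]
    rw [this, ContinuousAlternatingMap.alternatizeUncurryFin_smul,
      ← ContinuousAlternatingMap.alternatizeUncurryFinCLM_apply, map_sum]
    rfl
  rw [he.lambdaForm_eq, h2]
  simp only [curryLeft_alternatizeUncurryFin_succ,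
    curryLeft_sub, sub_apply, Finset.sum_sub_distrib,
    ContinuousLinearMap.comp_apply, contraction_apply]
  rw [h, smul_sub, smul_sub]
  module

end ONB

/-! ### Naturality -/

variable {A : V ≃L[ℝ] V}

theorem IsONB.map {κ : Type*} [DecidableEq κ] {e : Module.Basis κ ℝ V}
    (he : IsONB (g.bilinearComp (A : V →L[ℝ] V) (A : V →L[ℝ] V)) e) :
    IsONB g (e.map A.toLinearEquiv) := fun i j => he i j

theorem formInner_compContinuousLinearMap (hs : ∀ u v, g u v = g v u)
    (hp : ∀ v, v ≠ 0 → 0 < g v v) (A : V ≃L[ℝ] V) (α β : V [⋀^Fin k]→L[ℝ] ℂ) :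
    formInner (g.bilinearComp (A : V →L[ℝ] V) (A : V →L[ℝ] V))
      (α.compContinuousLinearMap (A : V →L[ℝ] V)) (β.compContinuousLinearMap (A : V →L[ℝ] V)) =
        formInner g α β := by
  obtain ⟨e, he⟩ := exists_isONB (g := g.bilinearComp (A : V →L[ℝ] V) (A : V →L[ℝ] V))
    (fun u v => hs _ _) (fun v hv => hp _ (by simpa using hv))
  induction k with
  | zero =>
    simp only [formInner_zero_degree, ContinuousAlternatingMap.compContinuousLinearMap_apply]
    rw [Subsingleton.elim ((A : V →L[ℝ] V) ∘ (0 : Fin 0 → V)) 0]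
  | succ k ih =>
    rw [he.formInner_succ, he.map.formInner_succ]
    simp only [ContinuousAlternatingMap.curryLeft_compContinuousLinearMap, ih]
    rfl

/-- An orthonormal basis of the pulled-back metric is sent by A to one of g, and A commutes with J.
Complex linearity of the derivatives of charts enters here. -/
theorem lambdaForm_compContinuousLinearMap (hs : ∀ u v, g u v = g v u)
    (hp : ∀ v, v ≠ 0 → 0 < g v v) (A : V ≃L[ℝ] V) {J : V →L[ℝ] V} (hJ : ∀ v, A (J v) = J (A v))
    (α : V [⋀^Fin (k + 2)]→L[ℝ] ℂ) :
    lambdaForm (g.bilinearComp (A : V →L[ℝ] V) (A : V →L[ℝ] V)) J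
      (α.compContinuousLinearMap (A : V →L[ℝ] V)) =
        (lambdaForm g J α).compContinuousLinearMap (A : V →L[ℝ] V) := by
  obtain ⟨e, he⟩ := exists_isONB (g := g.bilinearComp (A : V →L[ℝ] V) (A : V →L[ℝ] V))
    (fun u v => hs _ _) (fun v hv => hp _ (by simpa using hv))
  rw [he.lambdaForm_eq, he.map.lambdaForm_eq]
  ext v
  simp [ContinuousAlternatingMap.curryLeft_compContinuousLinearMap, hJ]

/-! ### The algebraic part of the Kähler identity -/

/-- The trilinear form `C(v; u, w) = (∂_v g)(u, w)` of the first derivatives of a Kähler metric. -/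
structure IsKahlerJet (J : V →L[ℝ] V) (C : V →L[ℝ] V →L[ℝ] V →L[ℝ] ℝ) : Prop where
  symm : ∀ u v w, C u v w = C u w v
  isometry : ∀ u v w, C u (J v) (J w) = C u v w
  cyclic : ∀ u v w, C u (J v) w + C v (J w) u + C w (J u) v = 0

variable {J : V →L[ℝ] V} {C : V →L[ℝ] V →L[ℝ] V →L[ℝ] ℝ}

/-- Closedness evaluated at (j, Ju, v), with J² = -1 and the J-invariance of C. -/
theorem IsKahlerJet.eq_add (h : IsKahlerJet J C) (hJ : ∀ v, J (J v) = -v) (j u v : V) :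
    C j u v = C (J u) (J v) j + C v u j := by
  have h1 := h.cyclic j (J u) v
  rw [hJ, h.isometry] at h1
  simp only [map_neg, neg_apply] at h1
  rw [h.symm v u j]
  linarith

theorem IsKahlerJet.eq_sub (h : IsKahlerJet J C) (hJ : ∀ v, J (J v) = -v) (j u v : V) :
    C j (J u) v = C (J u) v j - C (J v) u j := by
  have h1 := h.eq_add hJ j u (J v)
  have h2 := h.isometry j u (J v)
  rw [hJ] at h1 h2
  simp only [map_neg, neg_apply] at h1 h2
  linarith

variable {κ : Type*} [DecidableEq κ] [Fintype κ] {e : Module.Basis κ ℝ V}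

/-- Tracing `IsKahlerJet.eq_add`, the term C(Je_j; Jv, e_j) becomes -C(e_j; v, e_j) after moving J,
so the left side occurs twice. In effect ∑ ∂_j g_{vj} = ∂_v log √(det g) at the point, which removes
the derivatives of the volume density. -/
theorem IsKahlerJet.trace_eq (h : IsKahlerJet J C) (hJ : IsCompatible g J) (he : IsONB g e)
    (v : V) : 2 * ∑ j, C (e j) v (e j) = ∑ j, C v (e j) (e j) := by
  have h1 : ∀ j, C (e j) (e j) v = C (J (e j)) (J v) (e j) + C v (e j) (e j) := fun j =>
    h.eq_add hJ.sq _ _ _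
  have hbil : IsBilin fun u w => C u (J v) w := by
    constructor <;> intros <;> simp
  have h2 := he.sum_complexStructure_left hJ hbil
  have h3 : ∑ j, C (e j) v (e j) = ∑ j, C (J (e j)) (J v) (e j) + ∑ j, C v (e j) (e j) := by
    rw [← Finset.sum_add_distrib]
    exact Finset.sum_congr rfl fun j _ => by rw [h.symm, h1]
  rw [h2] at h3
  simp only [h.isometry] at h3
  linarith

/-- The left side is, up to sign, the contribution of the metric to the derivative of Λ in the
direction q. Closedness moves the differentiation from q to a contracted index, the form in which it
occurs in the derivative of the inner product. By antisymmetry of the double contraction the two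
terms of `IsKahlerJet.eq_sub` contribute equally, which absorbs the 1/2. -/
theorem IsKahlerJet.sum_curryLeft_curryLeft (h : IsKahlerJet J C) (hJ : IsCompatible g J)
    (he : IsONB g e) (α : V [⋀^Fin (k + 2)]→L[ℝ] ℂ) (q : V) :
    (2 : ℝ)⁻¹ • ∑ i, ∑ j, C q (e i) (e j) • (α.curryLeft (e i)).curryLeft (J (e j)) =
      -∑ i, ∑ p, C (e i) (e p) q • (α.curryLeft (J (e i))).curryLeft (e p) := by
  have h1 : ∀ i, ∑ j, C q (e i) (e j) • (α.curryLeft (e i)).curryLeft (J (e j)) =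
      -∑ j, (C (J (e j)) (e i) q - C (J (e i)) (e j) q) •
        (α.curryLeft (e i)).curryLeft (e j) := by
    intro i
    have hbil : IsBilin fun u v => C q (e i) u • (α.curryLeft (e i)).curryLeft v := by
      constructor <;> intros <;> simp [add_smul, smul_smul, mul_comm]
    have := he.sum_complexStructure_left hJ hbil
    rw [← neg_eq_iff_eq_neg, ← this]
    refine Finset.sum_congr rfl fun j _ => ?_
    rw [h.symm, h.eq_sub hJ.sq]
  have h2 : ∑ i, ∑ j, C (J (e j)) (e i) q • (α.curryLeft (e i)).curryLeft (e j) =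
      -∑ i, ∑ j, C (J (e i)) (e j) q • (α.curryLeft (e i)).curryLeft (e j) := by
    rw [Finset.sum_comm, ← Finset.sum_neg_distrib]
    refine Finset.sum_congr rfl fun i _ => ?_
    rw [← Finset.sum_neg_distrib]
    refine Finset.sum_congr rfl fun j _ => ?_
    rw [curryLeft_curryLeft_swap, smul_neg]
  have h3 : ∑ i, ∑ j, C (J (e i)) (e j) q • (α.curryLeft (e i)).curryLeft (e j) =
      -∑ i, ∑ j, C (e i) (e j) q • (α.curryLeft (J (e i))).curryLeft (e j) := by
    rw [Finset.sum_comm]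
    conv_rhs => rw [Finset.sum_comm, ← Finset.sum_neg_distrib]
    refine Finset.sum_congr rfl fun j _ => ?_
    have hbil : IsBilin fun u v : V => C u (e j) q • (α.curryLeft v).curryLeft (e j) := by
      constructor <;> intros <;> simp [add_smul, smul_smul, mul_comm,
        ContinuousAlternatingMap.curryLeft_add, ContinuousAlternatingMap.curryLeft_smul]
    exact he.sum_complexStructure_left hJ hbil
  simp only [h1, sub_smul, Finset.sum_sub_distrib, Finset.sum_neg_distrib]
  rw [h2, h3]
  module

end Lambda

/-! ### Smoothness and derivatives of determinants and inverse matrices. -/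

section MatrixCalculus

variable {W : Type*} [NormedAddCommGroup W] [NormedSpace ℝ W] {ι : Type*} [Fintype ι]
  [DecidableEq ι] {N : ℕ∞ω} {s : Set W} {x : W} {M : W → Matrix ι ι ℝ}

theorem contDiffWithinAt_det (h : ∀ i j, ContDiffWithinAt ℝ N (fun y => M y i j) s x) :
    ContDiffWithinAt ℝ N (fun y => (M y).det) s x := by
  simp only [Matrix.det_apply']
  exact ContDiffWithinAt.sum fun σ _ => contDiffWithinAt_const.mul
    (contDiffWithinAt_prod fun i _ => h _ _)

theorem contDiffWithinAt_matrix_inv (h : ∀ i j, ContDiffWithinAt ℝ N (fun y => M y i j) s x)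
    (hx : (M x).det ≠ 0) (i j : ι) : ContDiffWithinAt ℝ N (fun y => (M y)⁻¹ i j) s x := by
  simp only [Matrix.inv_def, Ring.inverse_eq_inv', Matrix.smul_apply, Matrix.adjugate_apply,
    smul_eq_mul]
  refine ((contDiffWithinAt_det h).inv hx).mul (contDiffWithinAt_det fun p q => ?_)
  simp only [Matrix.updateRow_apply]
  split_ifs
  · exact contDiffWithinAt_const
  · exact h _ _

theorem hasDerivAt_det_of_eq_one {M : ℝ → Matrix ι ι ℝ} {M' : Matrix ι ι ℝ}
    (h : ∀ i j, HasDerivAt (fun t => M t i j) (M' i j) 0) (h1 : M 0 = 1) :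
    HasDerivAt (fun t => (M t).det) M'.trace 0 := by
  simp only [Matrix.det_apply']
  have key : ∀ σ : Equiv.Perm ι, HasDerivAt (fun t => ((Equiv.Perm.sign σ : ℤ) : ℝ) *
      ∏ i, M t (σ i) i) (if σ = 1 then M'.trace else 0) 0 := by
    intro σ
    have := (HasDerivAt.fun_finsetProd (u := Finset.univ)
      (fun i _ => h (σ i) i)).const_mul ((Equiv.Perm.sign σ : ℤ) : ℝ)
    refine this.congr_deriv ?_
    split_ifs with hσ
    · subst hσ
      simp [h1, Matrix.trace, Finset.prod_eq_one]
    · rw [Finset.sum_eq_zero, mul_zero]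
      intro i _
      -- A nontrivial permutation moves at least two indices, so after the factor i has been
      -- differentiated an off-diagonal entry of the identity matrix remains and kills the product.
      obtain ⟨j, hj, hji⟩ : ∃ j, σ j ≠ j ∧ j ≠ i := by
        by_contra! hc
        refine hσ (Equiv.ext fun j => ?_)
        by_contra hj
        have h2 := hc j hj
        have h3 := hc (σ j) (fun h => hj (σ.injective h))
        exact hj (h3.trans h2.symm)
      rw [Finset.prod_eq_zero (Finset.mem_erase.2 ⟨hji, Finset.mem_univ j⟩), zero_smul]
      simp [h1, hj]
  refine (HasDerivAt.fun_sum fun σ _ => key σ).congr_deriv ?_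
  simp

/-- Differentiability comes from the adjugate formula; the value then follows by differentiating M⁻¹
M = 1, valid near 0. -/
theorem hasDerivAt_inv_of_eq_one {M : ℝ → Matrix ι ι ℝ}
    (h : ∀ i j, ContDiffAt ℝ 1 (fun t => M t i j) 0) (h1 : M 0 = 1) (i j : ι) :
    HasDerivAt (fun t => (M t)⁻¹ i j) (-deriv (fun t => M t i j) 0) 0 := by
  have hdet : (M 0).det ≠ 0 := by simp [h1]
  have hH : ∀ i j, DifferentiableAt ℝ (fun t => (M t)⁻¹ i j) 0 := fun i j =>
    ContDiffAt.differentiableAt (n := 1) (contDiffWithinAt_univ.1 (contDiffWithinAt_matrix_inv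
      (fun i j => contDiffWithinAt_univ.2 (h i j)) hdet i j)) one_ne_zero
  have hM : ∀ i j, DifferentiableAt ℝ (fun t => M t i j) 0 := fun i j =>
    (h i j).differentiableAt one_ne_zero
  have hcont : ContinuousAt (fun t => (M t).det) 0 :=
    ContDiffAt.continuousAt (n := 1) (contDiffWithinAt_univ.1
      (contDiffWithinAt_det fun i j => contDiffWithinAt_univ.2 (h i j)))
  have h2 : (fun t => ∑ k, (M t)⁻¹ i k * M t k j) =ᶠ[nhds 0]
      fun _ => (1 : Matrix ι ι ℝ) i j := by
    filter_upwards [hcont.eventually_ne hdet] with t ht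
    rw [← Matrix.mul_apply, Matrix.nonsing_inv_mul _ (isUnit_iff_ne_zero.2 ht)]
  have h3 := (HasDerivAt.fun_sum (u := Finset.univ) fun k _ =>
    (hH i k).hasDerivAt.mul (hM k j).hasDerivAt).unique
      ((hasDerivAt_const _ _).congr_of_eventuallyEq h2)
  simp only [h1, inv_one, Finset.sum_add_distrib, Matrix.one_apply, mul_ite, mul_one, mul_zero,
    ite_mul, one_mul, zero_mul, Finset.sum_ite_eq, Finset.sum_ite_eq', Finset.mem_univ,
    if_true] at h3
  refine (hH i j).hasDerivAt.congr_deriv ?_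
  linarith

end MatrixCalculus

/-! ### Gram matrices under change of basis, and metric traces in an arbitrary basis. -/

section FormCalculus

variable {V : Type*} [NormedAddCommGroup V] [NormedSpace ℝ V] {k : ℕ}

theorem gram_eq {ι κ : Type*} [Fintype κ] (g : V →L[ℝ] V →L[ℝ] ℝ) (b : Module.Basis ι ℝ V)
    (e : Module.Basis κ ℝ V) :
    gram g b = (e.toMatrix b).transpose * gram g e * e.toMatrix b := by
  ext i j
  simp only [gram, Matrix.of_apply, Matrix.mul_apply, Matrix.transpose_apply,
    Module.Basis.toMatrix_apply]
  conv_lhs => rw [← e.sum_repr (b i), ← e.sum_repr (b j)]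
  simp only [map_sum, map_smul, sum_apply, smul_apply, smul_eq_mul, Finset.sum_mul]
  refine Finset.sum_congr rfl fun n _ => ?_
  rw [Finset.mul_sum]
  exact Finset.sum_congr rfl fun m _ => by ring

theorem det_gram_eq {ι : Type*} [Fintype ι] [DecidableEq ι] (g : V →L[ℝ] V →L[ℝ] ℝ)
    (b e : Module.Basis ι ℝ V) :
    (gram g b).det = (e.toMatrix b).det ^ 2 * (gram g e).det := by
  rw [gram_eq g b e, Matrix.det_mul, Matrix.det_mul, Matrix.det_transpose]
  ring

theorem gram_inv_eq {ι κ : Type*} [Fintype ι] [DecidableEq ι] [Fintype κ] [DecidableEq κ]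
    (g : V →L[ℝ] V →L[ℝ] ℝ) (b : Module.Basis ι ℝ V) (e : Module.Basis κ ℝ V) (i j : ι) :
    (gram g b)⁻¹ i j =
      ∑ m, ∑ n, b.repr (e m) i * b.repr (e n) j * (gram g e)⁻¹ m n := by
  let f : ι ≃ κ := b.indexEquiv e
  let b' := b.reindex f
  have h1 : gram g b' = (gram g b).submatrix f.symm f.symm := by
    ext p q
    simp [gram, b']
  have hS : b'.toMatrix e * e.toMatrix b' = 1 := by
    rw [Module.Basis.toMatrix_mul_toMatrix_flip]
  have h2 : (gram g b')⁻¹ = b'.toMatrix e * (gram g e)⁻¹ * (b'.toMatrix e).transpose := by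
    rw [gram_eq g b' e, Matrix.mul_inv_rev, Matrix.mul_inv_rev, Matrix.inv_eq_left_inv hS,
      Matrix.inv_eq_left_inv
        (A := (e.toMatrix b').transpose) (B := (b'.toMatrix e).transpose) (by rw [← Matrix.transpose_mul, Module.Basis.toMatrix_mul_toMatrix_flip,
          Matrix.transpose_one]),
      Matrix.mul_assoc]
  have h3 : (gram g b)⁻¹ i j = (gram g b')⁻¹ (f i) (f j) := by
    rw [h1, Matrix.inv_submatrix_equiv]
    simp
  rw [h3, h2]
  simp only [Matrix.mul_apply, Matrix.transpose_apply, Module.Basis.toMatrix_apply, Finset.sum_mul]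
  rw [Finset.sum_comm]
  refine Finset.sum_congr rfl fun m _ => Finset.sum_congr rfl fun n _ => ?_
  simp [b']
  ring

variable {κ : Type*} [DecidableEq κ] [Fintype κ]

/-- Orthonormality is not assumed: when the metric varies along a line, a fixed basis is in general
orthonormal only at the base point, yet the trace must be written in it at nearby times too. -/
theorem sum_gramInv_basis {ι : Type*} [Fintype ι] [DecidableEq ι] (g : V →L[ℝ] V →L[ℝ] ℝ)
    (b : Module.Basis ι ℝ V) (e : Module.Basis κ ℝ V)
    {F : Type*} [AddCommGroup F] [Module ℝ F] {φ : V → V → F} (h : IsBilin φ) :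
    ∑ i, ∑ j, (gram g b)⁻¹ i j • φ (b i) (b j) =
      ∑ m, ∑ n, (gram g e)⁻¹ m n • φ (e m) (e n) := by
  have : ∀ m n, φ (e m) (e n) =
      ∑ i, ∑ j, (b.repr (e m) i * b.repr (e n) j) • φ (b i) (b j) := by
    intro m n
    rw [← h.sum_sum, b.sum_repr, b.sum_repr]
  simp only [gram_inv_eq g b e, this, Finset.sum_smul, Finset.smul_sum, smul_smul]
  simp only [← Fintype.sum_prod_type']
  let f : (ι × ι × κ × κ) ≃ (κ × κ × ι × ι) :=
    ⟨fun x => (x.2.2.1, x.2.2.2, x.1, x.2.1), fun x => (x.2.2.1, x.2.2.2, x.1, x.2.1),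
      fun _ => rfl, fun _ => rfl⟩
  refine Fintype.sum_equiv f _ _ fun x => ?_
  simp only [f, Equiv.coe_fn_mk]
  congr 1
  ring

variable [FiniteDimensional ℝ V]

theorem formInner_succ_basis (g : V →L[ℝ] V →L[ℝ] ℝ) (e : Module.Basis κ ℝ V)
    (α β : V [⋀^Fin (k + 1)]→L[ℝ] ℂ) :
    formInner g α β = ((k : ℝ) + 1)⁻¹ • ∑ m, ∑ n, (gram g e)⁻¹ m n •
      formInner g (α.curryLeft (e m)) (β.curryLeft (e n)) := by
  rw [formInner_succ_gram, sum_gramInv_basis g _ e (isBilin_formInner_curryLeft g α β)]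

theorem lambdaForm_apply_basis (g : V →L[ℝ] V →L[ℝ] ℝ) (J : V →L[ℝ] V) (e : Module.Basis κ ℝ V)
    (α : V [⋀^Fin (k + 2)]→L[ℝ] ℂ) :
    lambdaForm g J α = (2 : ℝ)⁻¹ • ∑ m, ∑ n, (gram g e)⁻¹ m n •
      (α.curryLeft (e m)).curryLeft (J (e n)) := by
  rw [lambdaForm_apply, sum_gramInv_basis g _ e (isBilin_curryLeft_curryLeft α J)]

/-! ### First variation -/

variable {g : ℝ → V →L[ℝ] V →L[ℝ] ℝ} {C : V →L[ℝ] V →L[ℝ] ℝ} {e : Module.Basis κ ℝ V}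

theorem IsONB.gram_eq_one {g : V →L[ℝ] V →L[ℝ] ℝ} (he : IsONB g e) : gram g e = 1 := by
  ext i j
  simp [gram, he i j, Matrix.one_apply]

theorem contDiffAt_gram {W : Type*} [NormedAddCommGroup W] [NormedSpace ℝ W] {N : ℕ∞ω} {s : Set W}
    {x : W} {g : W → V →L[ℝ] V →L[ℝ] ℝ} (hg : ContDiffWithinAt ℝ N g s x) {ι : Type*}
    (b : ι → V) (i j : ι) : ContDiffWithinAt ℝ N (fun y => gram (g y) b i j) s x :=
  (hg.clm_apply contDiffWithinAt_const).clm_apply contDiffWithinAt_const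

theorem hasDerivAt_gram (hC : HasDerivAt g C 0) (b : κ → V) (i j : κ) :
    HasDerivAt (fun t => gram (g t) b i j) (C (b i) (b j)) 0 := by
  have h := (hC.clm_apply (hasDerivAt_const 0 (b i))).clm_apply (hasDerivAt_const 0 (b j))
  exact h.congr_deriv (by simp)

theorem hasDerivAt_gram_inv (hg : ContDiffAt ℝ 1 g 0) (hC : HasDerivAt g C 0) (he : IsONB (g 0) e)
    (m n : κ) : HasDerivAt (fun t => (gram (g t) e)⁻¹ m n) (-C (e m) (e n)) 0 := by
  have := hasDerivAt_inv_of_eq_one (M := fun t => gram (g t) e)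
    (fun i j => contDiffWithinAt_univ.1 (contDiffAt_gram (contDiffWithinAt_univ.2 hg) e i j))
    he.gram_eq_one m n
  rwa [(hasDerivAt_gram hC e m n).deriv] at this

/-- Passing to the basis `e` changes the square root by a constant factor and makes the Gram matrix
the identity at time 0, where the derivative of the determinant is the trace. -/
theorem hasDerivAt_sqrt_det_gram (hC : HasDerivAt g C 0) (he : IsONB (g 0) e)
    (b : Module.Basis κ ℝ V) :
    HasDerivAt (fun t => √(gram (g t) b).det)
      (√(gram (g 0) b).det * (2⁻¹ * ∑ m, C (e m) (e m))) 0 := by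
  have h1 : HasDerivAt (fun t => (gram (g t) e).det) (∑ m, C (e m) (e m)) 0 :=
    hasDerivAt_det_of_eq_one (M := fun t => gram (g t) e)
      (M' := Matrix.of fun m n => C (e m) (e n)) (fun i j => hasDerivAt_gram hC e i j)
      he.gram_eq_one
  have h2 := (h1.sqrt (by simp [he.gram_eq_one])).const_mul |(e.toMatrix b).det|
  have h3 : ∀ t, √(gram (g t) b).det = |(e.toMatrix b).det| * √(gram (g t) e).det := by
    intro t
    rw [det_gram_eq _ b e, Real.sqrt_mul (sq_nonneg _), Real.sqrt_sq_eq_abs]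
  simp only [h3]
  refine h2.congr_deriv ?_
  simp only [he.gram_eq_one, Matrix.det_one, Real.sqrt_one]
  ring

/-- The derivative of the inner product of forms in the direction `C` of metrics, up to sign. -/
def formInnerVar (g C : V →L[ℝ] V →L[ℝ] ℝ) (e : Module.Basis κ ℝ V) :
    ∀ {k : ℕ}, V [⋀^Fin k]→L[ℝ] ℂ → V [⋀^Fin k]→L[ℝ] ℂ → ℂ
  | 0, _, _ => 0
  | _ + 1, α, β => ∑ m, ∑ n, C (e m) (e n) • formInner g (α.curryLeft (e m)) (β.curryLeft (e n))

/-- Contractions anticommute, and the two signs cancel between the arguments; the inner trace then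
counts the k remaining slots. It is the inductive input for differentiating the inner product. -/
theorem IsONB.sum_formInnerVar {g C : V →L[ℝ] V →L[ℝ] ℝ} (he : IsONB g e)
    (α β : V [⋀^Fin (k + 1)]→L[ℝ] ℂ) :
    ∑ m, formInnerVar g C e (α.curryLeft (e m)) (β.curryLeft (e m)) =
      (k : ℝ) • formInnerVar g C e α β := by
  cases k with
  | zero => simp [formInnerVar]
  | succ k =>
    simp only [formInnerVar]
    rw [Finset.sum_comm, Finset.smul_sum]
    refine Finset.sum_congr rfl fun p _ => ?_
    rw [Finset.sum_comm, Finset.smul_sum]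
    refine Finset.sum_congr rfl fun q _ => ?_
    rw [← Finset.smul_sum, smul_comm]
    congr 1
    push_cast
    rw [← he.sum_formInner]
    refine Finset.sum_congr rfl fun m _ => ?_
    rw [curryLeft_curryLeft_swap α, curryLeft_curryLeft_swap β, formInner_neg_left,
      formInner_neg_right, neg_neg]

/-- In the recursion on the degree, differentiating the explicit inverse Gram matrix yields one copy
of the variation and the induction hypothesis yields k copies, which cancels the prefactor 1/(k+1).
-/
theorem hasDerivAt_formInner (hg : ContDiffAt ℝ 1 g 0) (hC : HasDerivAt g C 0)
    (he : IsONB (g 0) e) {α β : ℝ → V [⋀^Fin k]→L[ℝ] ℂ} {α' β' : V [⋀^Fin k]→L[ℝ] ℂ}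
    (hα : HasDerivAt α α' 0) (hβ : HasDerivAt β β' 0) :
    HasDerivAt (fun t => formInner (g t) (α t) (β t))
      (formInner (g 0) α' (β 0) + formInner (g 0) (α 0) β' -
        formInnerVar (g 0) C e (α 0) (β 0)) 0 := by
  induction k with
  | zero =>
    simp only [formInner_zero_degree, formInnerVar, sub_zero]
    have hev : ∀ {γ : ℝ → V [⋀^Fin 0]→L[ℝ] ℂ} {γ'}, HasDerivAt γ γ' 0 →
        HasDerivAt (fun t => γ t 0) (γ' 0) 0 := fun h =>
      ((ContinuousAlternatingMap.constOfIsEmptyLIE ℝ V ℂ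
        (Fin 0)).symm.toContinuousLinearEquiv.toContinuousLinearMap.hasFDerivAt).comp_hasDerivAt 0 h
    refine ((hev hα).mul ((Complex.conjCLE.toContinuousLinearMap.hasFDerivAt).comp_hasDerivAt 0
      (hev hβ))).congr_deriv ?_
    simp
  | succ k ih =>
    have hcl : ∀ {γ : ℝ → V [⋀^Fin (k + 1)]→L[ℝ] ℂ} {γ'} (v : V), HasDerivAt γ γ' 0 →
        HasDerivAt (fun t => (γ t).curryLeft v) (γ'.curryLeft v) 0 := fun v h =>
      (contraction (k := k) v).hasFDerivAt.comp_hasDerivAt 0 h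
    simp only [fun t => formInner_succ_basis (g t) e (α t) (β t)]
    refine ((HasDerivAt.fun_sum fun m _ => HasDerivAt.fun_sum fun n _ =>
      (hasDerivAt_gram_inv hg hC he m n).smul
        (ih (hcl (e m) hα) (hcl (e n) hβ))).const_smul ((k : ℝ) + 1)⁻¹).congr_deriv ?_
    simp only [he.gram_eq_one, inv_one, Matrix.one_apply, ite_smul, one_smul, zero_smul,
      Finset.sum_add_distrib, Finset.sum_ite_eq, Finset.mem_univ, if_true, Finset.sum_sub_distrib,
      neg_smul, Finset.sum_neg_distrib, he.sum_formInner, he.sum_formInnerVar]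
    rw [show ∑ m, ∑ n, C (e m) (e n) • formInner (g 0) ((α 0).curryLeft (e m))
      ((β 0).curryLeft (e n)) = formInnerVar (g 0) C e (α 0) (β 0) from rfl]
    have h0 : (k : ℝ) + 1 ≠ 0 := by positivity
    rw [inv_smul_eq_iff₀ h0]
    module

end FormCalculus

theorem fderiv_clm_comp {V W X : Type*} [NormedAddCommGroup V] [NormedSpace ℝ V]
    [NormedAddCommGroup W] [NormedSpace ℝ W] [NormedAddCommGroup X] [NormedSpace ℝ X] {f : V → W}
    (P : W →L[ℝ] X) {y : V} (h : DifferentiableAt ℝ f y) :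
    fderiv ℝ (fun z => P (f z)) y = P.comp (fderiv ℝ f y) :=
  (HasFDerivAt.comp (g := P) y P.hasFDerivAt h.hasFDerivAt).fderiv

/-! ### The operators dᶜ and Δ on open subsets of a vector space. -/

section Flat

variable {V : Type*} [NormedAddCommGroup V] [NormedSpace ℝ V] {k : ℕ}

variable {F : Type*} [NormedAddCommGroup F] [NormedSpace ℝ F]

/-- The twisted exterior derivative `∑ (eⁱ ∘ J) ∧ ∂_i` on an open subset of a vector space. -/
def flatDc (J : V →L[ℝ] V) (α : V → V [⋀^Fin k]→L[ℝ] F) (y : V) : V [⋀^Fin (k + 1)]→L[ℝ] F :=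
  ContinuousAlternatingMap.alternatizeUncurryFin ((fderiv ℝ α y).comp J)

/-- The sum is the double alternation of D²α(u, Jv) + D²α(Ju, v), which is symmetric in u and v
because second derivatives commute; alternating it twice gives zero. -/
theorem extDeriv_flatDc_add {J : V →L[ℝ] V} {α : V → V [⋀^Fin k]→L[ℝ] F} {y : V}
    (hα : ContDiffAt ℝ 2 α y) :
    extDeriv (flatDc J α) y + flatDc J (extDeriv α) y = 0 := by
  have h1 : DifferentiableAt ℝ (fderiv ℝ α) y :=
    (hα.fderiv_right (m := 1) le_rfl).differentiableAt one_ne_zero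
  have hsymm : ∀ u v, fderiv ℝ (fderiv ℝ α) y u v = fderiv ℝ (fderiv ℝ α) y v u := fun u v =>
    (hα.isSymmSndFDerivAt (by simp)) u v
  let P : (V →L[ℝ] V [⋀^Fin k]→L[ℝ] F) →L[ℝ] V [⋀^Fin (k + 1)]→L[ℝ] F :=
    ContinuousAlternatingMap.alternatizeUncurryFinCLM ℝ V F
  let Q : (V →L[ℝ] V [⋀^Fin k]→L[ℝ] F) →L[ℝ] V →L[ℝ] V [⋀^Fin k]→L[ℝ] F :=
    (ContinuousLinearMap.compL ℝ V V (V [⋀^Fin k]→L[ℝ] F)).flip J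
  have h2 : fderiv ℝ (flatDc J α) y = P.comp (Q.comp (fderiv ℝ (fderiv ℝ α) y)) := by
    have : flatDc J α = fun z => (P.comp Q) (fderiv ℝ α z) := rfl
    rw [this]
    exact fderiv_clm_comp (W := V →L[ℝ] V [⋀^Fin k]→L[ℝ] F) (P.comp Q) h1
  have h3 : fderiv ℝ (extDeriv α) y = P.comp (fderiv ℝ (fderiv ℝ α) y) := by
    have : extDeriv α = fun z => P (fderiv ℝ α z) := rfl
    rw [this]
    exact fderiv_clm_comp (W := V →L[ℝ] V [⋀^Fin k]→L[ℝ] F) P h1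
  rw [extDeriv, flatDc, h2, h3, ← ContinuousAlternatingMap.alternatizeUncurryFin_add]
  have h4 := ContinuousAlternatingMap.alternatizeUncurryFin_alternatizeUncurryFinCLM_comp_of_symmetric
    (f := Q.comp (fderiv ℝ (fderiv ℝ α) y) + (fderiv ℝ (fderiv ℝ α) y).comp J) (fun u v => by
      simp only [add_apply, ContinuousLinearMap.comp_apply, Q, ContinuousLinearMap.flip_apply,
        ContinuousLinearMap.compL_apply]
      rw [hsymm u, hsymm (J u), add_comm])
  rw [← h4]
  congr 1
  ext1 u
  simp [P]

variable [FiniteDimensional ℝ V]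

/-- The operator `Δ = [Λ, d]` of a metric on an open subset of a vector space. -/
def flatDelta (G : V → V →L[ℝ] V →L[ℝ] ℝ) (J : V →L[ℝ] V) :
    ∀ {k : ℕ}, (V → V [⋀^Fin (k + 1)]→L[ℝ] ℂ) → V → V [⋀^Fin k]→L[ℝ] ℂ
  | 0, α, y => lambdaForm (G y) J (extDeriv α y)
  | _ + 1, α, y =>
    lambdaForm (G y) J (extDeriv α y) - extDeriv (fun z => lambdaForm (G z) J (α z)) y

section Smoothness

variable {N : ℕ∞ω} {s : Set V} {y : V} {G : V → V →L[ℝ] V →L[ℝ] ℝ} {κ : Type*} [DecidableEq κ]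
  [Fintype κ]

theorem contDiffWithinAt_gram_inv (hG : ContDiffWithinAt ℝ N G s y) (b : κ → V)
    (hy : (gram (G y) b).det ≠ 0) (i j : κ) :
    ContDiffWithinAt ℝ N (fun z => (gram (G z) b)⁻¹ i j) s y :=
  contDiffWithinAt_matrix_inv (fun i j => contDiffAt_gram hG b i j) hy i j

theorem contDiffWithinAt_sqrt_det_gram (hG : ContDiffWithinAt ℝ N G s y) (b : κ → V)
    (hy : (gram (G y) b).det ≠ 0) :
    ContDiffWithinAt ℝ N (fun z => √(gram (G z) b).det) s y :=
  (contDiffWithinAt_det (fun i j => contDiffAt_gram hG b i j)).sqrt hy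

theorem contDiffWithinAt_curryLeft {α : V → V [⋀^Fin (k + 1)]→L[ℝ] ℂ}
    (hα : ContDiffWithinAt ℝ N α s y) (v : V) :
    ContDiffWithinAt ℝ N (fun z => (α z).curryLeft v) s y :=
  (contraction (k := k) v).contDiff.comp_contDiffWithinAt hα

theorem contDiffWithinAt_lambdaForm (hG : ContDiffWithinAt ℝ N G s y) (J : V →L[ℝ] V)
    (hy : (gram (G y) (Module.finBasis ℝ V)).det ≠ 0) {α : V → V [⋀^Fin (k + 2)]→L[ℝ] ℂ}
    (hα : ContDiffWithinAt ℝ N α s y) :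
    ContDiffWithinAt ℝ N (fun z => lambdaForm (G z) J (α z)) s y := by
  simp only [lambdaForm_apply]
  exact ContDiffWithinAt.const_smul _ (ContDiffWithinAt.sum fun i _ => ContDiffWithinAt.sum fun j _ =>
    (contDiffWithinAt_gram_inv hG _ hy i j).smul
      (contDiffWithinAt_curryLeft (contDiffWithinAt_curryLeft hα _) _))

theorem contDiffWithinAt_formInner (hG : ContDiffWithinAt ℝ N G s y)
    (hy : (gram (G y) (Module.finBasis ℝ V)).det ≠ 0) {α β : V → V [⋀^Fin k]→L[ℝ] ℂ}
    (hα : ContDiffWithinAt ℝ N α s y) (hβ : ContDiffWithinAt ℝ N β s y) :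
    ContDiffWithinAt ℝ N (fun z => formInner (G z) (α z) (β z)) s y := by
  induction k with
  | zero =>
    simp only [formInner_zero_degree]
    have hev : ∀ {γ : V → V [⋀^Fin 0]→L[ℝ] ℂ}, ContDiffWithinAt ℝ N γ s y →
        ContDiffWithinAt ℝ N (fun t => γ t 0) s y := fun h =>
      ((ContinuousAlternatingMap.constOfIsEmptyLIE ℝ V ℂ
        (Fin 0)).symm.toContinuousLinearEquiv.toContinuousLinearMap.contDiff).comp_contDiffWithinAt h
    exact (hev hα).mul (Complex.conjCLE.contDiff.comp_contDiffWithinAt (hev hβ))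
  | succ k ih =>
    simp only [formInner_succ_gram]
    exact ContDiffWithinAt.const_smul _ (ContDiffWithinAt.sum fun i _ =>
      ContDiffWithinAt.sum fun j _ => (contDiffWithinAt_gram_inv hG _ hy i j).smul
        (ih (contDiffWithinAt_curryLeft hα _) (contDiffWithinAt_curryLeft hβ _)))

theorem IsONB.det_gram_ne_zero {ι : Type*} [Fintype ι] [DecidableEq ι] {g : V →L[ℝ] V →L[ℝ] ℝ}
    {e : Module.Basis κ ℝ V} (he : IsONB g e) (b : Module.Basis ι ℝ V) :
    (gram g b).det ≠ 0 := by
  let e' := e.reindex (e.indexEquiv b)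
  have he' : IsONB g e' := fun i j => by simp [e', he _ _]
  rw [det_gram_eq g b e', he'.gram_eq_one, Matrix.det_one, mul_one]
  have hS : b.toMatrix e' * e'.toMatrix b = 1 := by
    rw [Module.Basis.toMatrix_mul_toMatrix_flip]
  have := congrArg Matrix.det hS
  rw [Matrix.det_mul, Matrix.det_one] at this
  exact pow_ne_zero _ (right_ne_zero_of_mul_eq_one this)

end Smoothness

section Divergence

variable {y : V} {G : V → V →L[ℝ] V →L[ℝ] ℝ} {κ : Type*} [DecidableEq κ]
  [Fintype κ] {e : Module.Basis κ ℝ V} {J : V →L[ℝ] V}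

theorem contDiffAt_line {f : V → F}
    {N : ℕ∞ω} (hf : ContDiffAt ℝ N f y) (v : V) : ContDiffAt ℝ N (fun t : ℝ => f (y + t • v)) 0 := by
  have h : ContDiffAt ℝ N (fun t : ℝ => y + t • v) 0 := by fun_prop
  exact ContDiffAt.comp (g := f) 0 (by simpa using hf) h

theorem hasDerivAt_line {f : V → F}
    (hf : DifferentiableAt ℝ f y) (v : V) :
    HasDerivAt (fun t : ℝ => f (y + t • v)) (fderiv ℝ f y v) 0 :=
  hf.hasFDerivAt.hasLineDerivAt v

/-- The product rule for the trace written in the fixed basis `e`; the correction term is the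
derivative -C of the inverse Gram matrix. -/
theorem fderiv_lambdaForm (hG : ContDiffAt ℝ 1 G y) (he : IsONB (G y) e)
    {α : V → V [⋀^Fin (k + 2)]→L[ℝ] ℂ} (hα : ContDiffAt ℝ 1 α y) (v : V) :
    fderiv ℝ (fun z => lambdaForm (G z) J (α z)) y v = lambdaForm (G y) J (fderiv ℝ α y v) -
      (2 : ℝ)⁻¹ • ∑ m, ∑ n, fderiv ℝ G y v (e m) (e n) •
        ((α y).curryLeft (e m)).curryLeft (J (e n)) := by
  have h1 : DifferentiableAt ℝ (fun z => lambdaForm (G z) J (α z)) y :=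
    ContDiffAt.differentiableAt (n := 1) (contDiffWithinAt_univ.1 (contDiffWithinAt_lambdaForm
      (contDiffWithinAt_univ.2 hG) J (he.det_gram_ne_zero _) (contDiffWithinAt_univ.2 hα)))
      one_ne_zero
  refine (hasDerivAt_line h1 v).unique ?_
  simp only [fun t : ℝ => lambdaForm_apply_basis (G (y + t • v)) J e (α (y + t • v))]
  have hα' := hasDerivAt_line (hα.differentiableAt one_ne_zero) v
  have h2 : ∀ m n, HasDerivAt
      (fun t : ℝ => ((α (y + t • v)).curryLeft (e m)).curryLeft (J (e n)))
      (((fderiv ℝ α y v).curryLeft (e m)).curryLeft (J (e n))) 0 := fun m n =>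
    ((contraction (k := k) (J (e n))).comp
      (contraction (k := k + 1) (e m))).hasFDerivAt.comp_hasDerivAt 0 hα'
  have he0 : IsONB (G (y + (0 : ℝ) • v)) e := by simpa using he
  refine ((HasDerivAt.fun_sum fun m _ => HasDerivAt.fun_sum fun n _ =>
    (hasDerivAt_gram_inv (contDiffAt_line hG v)
      (hasDerivAt_line (hG.differentiableAt one_ne_zero) v) he0 m n).smul
        (h2 m n)).const_smul (2 : ℝ)⁻¹).congr_deriv ?_
  simp only [he.gram_eq_one, he.lambdaForm_eq, inv_one, Matrix.one_apply, ite_smul, one_smul, zero_smul,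
    Finset.sum_add_distrib, Finset.sum_ite_eq, Finset.mem_univ, if_true,
    neg_smul, Finset.sum_neg_distrib, add_zero]
  module

theorem isBilin_formInnerVar (g : V →L[ℝ] V →L[ℝ] ℝ) (C : V →L[ℝ] V →L[ℝ] V →L[ℝ] ℝ)
    (J : V →L[ℝ] V) (α : V [⋀^Fin (k + 1)]→L[ℝ] ℂ) (β : V [⋀^Fin k]→L[ℝ] ℂ) :
    IsBilin fun u v => formInnerVar g (C v) e (α.curryLeft (J u)) β := by
  cases k with
  | zero => constructor <;> intros <;> simp [formInnerVar]
  | succ k =>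
    constructor <;> intros <;> simp [formInnerVar, formInner_add_left, formInner_rsmul_left,
      ContinuousAlternatingMap.curryLeft_add, ContinuousAlternatingMap.curryLeft_smul,
      add_mul, Finset.sum_add_distrib, Finset.mul_sum, mul_left_comm, mul_assoc]

/-- The components of the vector field whose divergence is `⟨Δ α, β⟩ - ⟨α, dᶜ β⟩`. -/
def boundaryField (G : V → V →L[ℝ] V →L[ℝ] ℝ) (J : V →L[ℝ] V)
    (α : V → V [⋀^Fin (k + 1)]→L[ℝ] ℂ) (β : V → V [⋀^Fin k]→L[ℝ] ℂ)
    (j : Fin (Module.finrank ℝ V)) (y : V) : ℂ :=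
  √(gram (G y) (Module.finBasis ℝ V)).det • ∑ i, (gram (G y) (Module.finBasis ℝ V))⁻¹ i j •
    formInner (G y) ((α y).curryLeft (J (Module.finBasis ℝ V i))) (β y)

/-- Each summand on the right is the derivative along e_m of ⟨ι_{J e_m} α, β⟩ with the metric
varying and J e_m held constant. The principal part of [Λ, d] and the adjoint of dᶜ give the first
two terms; the derivative of Λ, rewritten by the Kähler condition, gives exactly the variation of
the inner product. -/
theorem formInner_flatDelta_sub (hG : ContDiffAt ℝ 1 G y) (he : IsONB (G y) e)
    (hJ : IsCompatible (G y) J) (hC : IsKahlerJet J (fderiv ℝ G y))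
    {α : V → V [⋀^Fin (k + 1)]→L[ℝ] ℂ} (hα : ContDiffAt ℝ 1 α y)
    (β : V → V [⋀^Fin k]→L[ℝ] ℂ) :
    formInner (G y) (flatDelta G J α y) (β y) - formInner (G y) (α y) (flatDc J β y) =
      ∑ m, (formInner (G y) ((fderiv ℝ α y (e m)).curryLeft (J (e m))) (β y) +
        formInner (G y) ((α y).curryLeft (J (e m))) (fderiv ℝ β y (e m)) -
          formInnerVar (G y) (fderiv ℝ G y (e m)) e ((α y).curryLeft (J (e m))) (β y)) := by
  have h1 : formInner (G y) (α y) (flatDc J β y) =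
      -∑ m, formInner (G y) ((α y).curryLeft (J (e m))) (fderiv ℝ β y (e m)) := by
    rw [flatDc, he.formInner_alternatizeUncurryFin_right]
    have hbil : IsBilin fun u v => formInner (G y) ((α y).curryLeft u) (fderiv ℝ β y v) := by
      constructor <;> intros <;> simp [formInner_add_left, formInner_add_right,
        formInner_rsmul_left, formInner_rsmul_right]
    rw [he.sum_complexStructure_left hJ hbil, neg_neg]
    rfl
  rw [h1, Finset.sum_sub_distrib, Finset.sum_add_distrib]
  cases k with
  | zero =>
    simp only [flatDelta, formInnerVar, Finset.sum_const_zero]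
    rw [extDeriv, he.lambdaForm_alternatizeUncurryFin_zero hJ, formInner_sum_left]
    ring
  | succ k =>
    have h2 : flatDelta G J α y = ∑ m, (fderiv ℝ α y (e m)).curryLeft (J (e m)) -
        ContinuousAlternatingMap.alternatizeUncurryFin
          (fderiv ℝ (fun z => lambdaForm (G z) J (α z)) y - (lambdaForm (G y) J).comp
            (fderiv ℝ α y)) := by
      rw [flatDelta, extDeriv, extDeriv, he.lambdaForm_alternatizeUncurryFin_succ hJ]
      simp only [← ContinuousAlternatingMap.alternatizeUncurryFinCLM_apply, map_sub]
      abel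
    have h3 : ∀ v, (fderiv ℝ (fun z => lambdaForm (G z) J (α z)) y - (lambdaForm (G y) J).comp
            (fderiv ℝ α y)) v = ∑ i, ∑ p, fderiv ℝ G y (e i) (e p) v •
              ((α y).curryLeft (J (e i))).curryLeft (e p) := by
      intro v
      rw [sub_apply, fderiv_lambdaForm hG he hα, hC.sum_curryLeft_curryLeft hJ he]
      simp
    rw [h2, formInner_sub_left, he.formInner_alternatizeUncurryFin_left, formInner_sum_left]
    simp only [h3, formInner_sum_left, formInner_rsmul_left, formInnerVar]
    have h4 : ∑ m, ∑ i, ∑ p, fderiv ℝ G y (e i) (e p) (e m) •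
        formInner (G y) (((α y).curryLeft (J (e i))).curryLeft (e p)) ((β y).curryLeft (e m)) =
        ∑ i, ∑ p, ∑ m, fderiv ℝ G y (e i) (e p) (e m) •
        formInner (G y) (((α y).curryLeft (J (e i))).curryLeft (e p)) ((β y).curryLeft (e m)) := by
      rw [Finset.sum_comm]
      exact Finset.sum_congr rfl fun i _ => Finset.sum_comm
    rw [h4]
    ring

end Divergence

end Flat

theorem IsBilin.add {V F : Type*} [NormedAddCommGroup V] [NormedSpace ℝ V] [AddCommGroup F]
    [Module ℝ F] {φ ψ : V → V → F} (h : IsBilin φ) (h' : IsBilin ψ) :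
    IsBilin fun u v => φ u v + ψ u v := by
  constructor <;> intros <;> simp only [h.add_left, h'.add_left, h.add_right, h'.add_right,
    h.smul_left, h'.smul_left, h.smul_right, h'.smul_right] <;> module

theorem IsBilin.sub {V F : Type*} [NormedAddCommGroup V] [NormedSpace ℝ V] [AddCommGroup F]
    [Module ℝ F] {φ ψ : V → V → F} (h : IsBilin φ) (h' : IsBilin ψ) :
    IsBilin fun u v => φ u v - ψ u v := by
  constructor <;> intros <;> simp only [h.add_left, h'.add_left, h.add_right, h'.add_right,
    h.smul_left, h'.smul_left, h.smul_right, h'.smul_right] <;> module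

theorem sum_comm_four {ι κ μ ν M : Type*} [Fintype ι] [Fintype κ] [Fintype μ] [Fintype ν]
    [AddCommMonoid M] (f : ι → κ → μ → ν → M) :
    ∑ j, ∑ i, ∑ m, ∑ n, f j i m n = ∑ m, ∑ n, ∑ i, ∑ j, f j i m n := by
  simp only [← Fintype.sum_prod_type']
  exact Fintype.sum_equiv ⟨fun x : ι × κ × μ × ν => ((x.2.2.1, x.2.2.2, x.2.1, x.1) : μ × ν × κ × ι),
    fun x => (x.2.2.2, x.2.2.1, x.1, x.2.1), fun _ => rfl, fun _ => rfl⟩ _ _ fun _ => rfl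

theorem sum_sum_neg_smul {ι κ M : Type*} [Fintype ι] [Fintype κ] [AddCommGroup M] [Module ℝ M]
    (R : κ → ι → ℝ) (c : ι → κ → κ → ℝ) (Y : ι → M) :
    ∑ j, ∑ i, (-∑ m, ∑ n, R m i * R n j * c j m n) • Y i =
      -∑ m, ∑ n, ∑ i, ∑ j, (R m i * R n j) • (c j m n • Y i) := by
  simp only [Finset.sum_smul, neg_smul, Finset.sum_neg_distrib, smul_smul]
  rw [sum_comm_four]

/-! ### The divergence computation. -/

section Flat

variable {V : Type*} [NormedAddCommGroup V] [NormedSpace ℝ V] {k : ℕ} [FiniteDimensional ℝ V]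

section Divergence

variable {y : V} {G : V → V →L[ℝ] V →L[ℝ] ℝ} {κ : Type*} [DecidableEq κ]
  [Fintype κ] {e : Module.Basis κ ℝ V} {J : V →L[ℝ] V}

theorem hasDerivAt_gram_inv_basis {ι : Type*} [Fintype ι] [DecidableEq ι]
    {g : ℝ → V →L[ℝ] V →L[ℝ] ℝ} {C : V →L[ℝ] V →L[ℝ] ℝ} (hg : ContDiffAt ℝ 1 g 0)
    (hC : HasDerivAt g C 0) (he : IsONB (g 0) e) (b : Module.Basis ι ℝ V) (i j : ι) :
    HasDerivAt (fun t => (gram (g t) b)⁻¹ i j)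
      (-∑ m, ∑ n, b.repr (e m) i * b.repr (e n) j * C (e m) (e n)) 0 := by
  simp only [fun t => gram_inv_eq (g t) b e]
  refine (HasDerivAt.fun_sum fun m _ => HasDerivAt.fun_sum fun n _ =>
    (hasDerivAt_gram_inv hg hC he m n).const_mul _).congr_deriv ?_
  simp only [mul_neg, Finset.sum_neg_distrib]

/-- The product rule has three contributions: from the density, from the inverse metric and from the
inner product. The last is the right side by `formInner_flatDelta_sub`; the others cancel on a
Kähler metric. -/
theorem sum_lineDeriv_boundaryField {e : Module.Basis (Fin (Module.finrank ℝ V)) ℝ V}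
    (hG : ContDiffAt ℝ 1 G y) (he : IsONB (G y) e)
    (hJ : IsCompatible (G y) J) (hC : IsKahlerJet J (fderiv ℝ G y))
    {α : V → V [⋀^Fin (k + 1)]→L[ℝ] ℂ} (hα : ContDiffAt ℝ 1 α y)
    {β : V → V [⋀^Fin k]→L[ℝ] ℂ} (hβ : ContDiffAt ℝ 1 β y) :
    ∑ j, lineDeriv ℝ (boundaryField G J α β j) y (Module.finBasis ℝ V j) =
      √(gram (G y) (Module.finBasis ℝ V)).det • (formInner (G y) (flatDelta G J α y) (β y) -
        formInner (G y) (α y) (flatDc J β y)) := by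
  rw [formInner_flatDelta_sub hG he hJ hC hα]
  set b := Module.finBasis ℝ V with hb
  set ρ := √(gram (G y) b).det with hρ
  set C := fderiv ℝ G y with hCdef
  have he0 : ∀ v : V, IsONB (G (y + (0 : ℝ) • v)) e := fun v => by simpa using he
  have hG' : ∀ v, HasDerivAt (fun t : ℝ => G (y + t • v)) (C v) 0 := fun v =>
    hasDerivAt_line (hG.differentiableAt one_ne_zero) v
  have hα' : ∀ v u, HasDerivAt (fun t : ℝ => (α (y + t • v)).curryLeft u)
      ((fderiv ℝ α y v).curryLeft u) 0 := fun v u =>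
    (contraction (k := k) u).hasFDerivAt.comp_hasDerivAt 0
      (hasDerivAt_line (hα.differentiableAt one_ne_zero) v)
  have hβ' : ∀ v, HasDerivAt (fun t : ℝ => β (y + t • v)) (fderiv ℝ β y v) 0 := fun v =>
    hasDerivAt_line (hβ.differentiableAt one_ne_zero) v
  set X : V → V → ℂ := fun u v => formInner (G y) ((fderiv ℝ α y v).curryLeft (J u)) (β y) +
    formInner (G y) ((α y).curryLeft (J u)) (fderiv ℝ β y v) -
      formInnerVar (G y) (C v) e ((α y).curryLeft (J u)) (β y) with hX
  set Y : V → ℂ := fun u => formInner (G y) ((α y).curryLeft (J u)) (β y) with hY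
  have hder : ∀ j, lineDeriv ℝ (boundaryField G J α β j) y (b j) =
      ρ • ((∑ i, (gram (G y) b)⁻¹ i j • (((2 : ℝ)⁻¹ * ∑ m, C (b j) (e m) (e m)) • Y (b i))) +
        ∑ i, ((-∑ m, ∑ n, b.repr (e m) i * b.repr (e n) j * C (b j) (e m) (e n)) • Y (b i)) +
        ∑ i, (gram (G y) b)⁻¹ i j • X (b i) (b j)) := by
    intro j
    refine HasLineDerivAt.lineDeriv (HasDerivAt.congr_deriv ((hasDerivAt_sqrt_det_gram (hG' (b j))
      (he0 (b j)) b).smul (HasDerivAt.fun_sum fun i _ => (hasDerivAt_gram_inv_basis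
        (contDiffAt_line hG (b j)) (hG' (b j)) (he0 (b j)) b i j).smul
        (hasDerivAt_formInner (contDiffAt_line hG (b j)) (hG' (b j)) (he0 (b j))
          (hα' (b j) (J (b i))) (hβ' (b j))))) ?_)
    simp only [zero_smul, add_zero]
    rw [← hρ]
    simp only [smul_comm _ ((2 : ℝ)⁻¹ * ∑ m, C (b j) (e m) (e m))]
    rw [Finset.sum_add_distrib, ← Finset.smul_sum]
    module
  have hYb : IsBilin fun u v : V => ((2 : ℝ)⁻¹ * ∑ m, C v (e m) (e m)) • Y u := by
    constructor <;> intros <;> simp [hY, formInner_add_left, formInner_rsmul_left,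
      Finset.sum_add_distrib, mul_add, add_mul,
      ← Finset.mul_sum]
    · ring
    · ring
  have hXb : IsBilin X := by
    refine (IsBilin.add ?_ ?_).sub (isBilin_formInnerVar (e := e) (G y) C J (α y) (β y)) <;>
    constructor <;> intros <;> simp [formInner_add_left, formInner_rsmul_left,
      formInner_add_right, formInner_rsmul_right, ContinuousAlternatingMap.curryLeft_add,
      ContinuousAlternatingMap.curryLeft_smul]
  have hS2 : ∑ j, ∑ i, ((-∑ m, ∑ n, b.repr (e m) i * b.repr (e n) j * C (b j) (e m) (e n)) •
      Y (b i)) = -∑ m, ∑ n, C (e n) (e m) (e n) • Y (e m) := by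
    have h1 : ∀ m n, C (e n) (e m) (e n) • Y (e m) =
        ∑ i, ∑ j, (b.repr (e m) i * b.repr (e n) j) • (C (b j) (e m) (e n) • Y (b i)) := by
      intro m n
      have hbil : IsBilin fun u v : V => C v (e m) (e n) • Y u := by
        constructor <;> intros <;> simp [hY, formInner_add_left, formInner_rsmul_left,
          add_mul, mul_left_comm, mul_assoc]
      rw [← hbil.sum_sum, b.sum_repr, b.sum_repr]
    simp only [h1]
    exact sum_sum_neg_smul (fun m i => b.repr (e m) i) (fun j m n => C (b j) (e m) (e n))
      fun i => Y (b i)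
  simp only [hder]
  have hS1 := he.sum_gramInv b hYb
  have hS3 := he.sum_gramInv b hXb
  rw [Finset.sum_comm] at hS1 hS3
  rw [← Finset.smul_sum, Finset.sum_add_distrib, Finset.sum_add_distrib, hS2, hS1, hS3]
  congr 1
  -- What remains is half the trace of C(e_m; ·, ·), from the density, against ∑ C(e_n; e_m, e_n),
  -- from the inverse metric: this is `IsKahlerJet.trace_eq`.
  rw [add_eq_right, ← sub_eq_add_neg, sub_eq_zero]
  refine Finset.sum_congr rfl fun m _ => ?_
  rw [← Finset.sum_smul, ← hC.trace_eq hJ he (e m)]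
  simp

end Divergence

end Flat

/-! ### Closed fundamental forms and the divergence theorem on a vector space. -/

section FlatIntegration

variable {V : Type*} [NormedAddCommGroup V] [NormedSpace ℝ V]

theorem isKahlerJet_fderiv {G : V → V →L[ℝ] V →L[ℝ] ℝ} {J : V →L[ℝ] V} {y : V}
    {w : V → V [⋀^Fin 2]→L[ℝ] ℂ} (hG : DifferentiableAt ℝ G y) (hw : DifferentiableAt ℝ w y)
    (hsymm : ∀ᶠ z in nhds y, ∀ u v, G z u v = G z v u)
    (hJ : ∀ᶠ z in nhds y, IsCompatible (G z) J)
    (hGw : ∀ᶠ z in nhds y, ∀ v, w z v = (G z (J (v 0)) (v 1) : ℂ))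
    (hclosed : extDeriv w y = 0) : IsKahlerJet J (fderiv ℝ G y) := by
  have hev : ∀ a b : V, HasFDerivAt (fun z => G z a b) (((fderiv ℝ G y).flip a).flip b) y := by
    intro a b
    exact ((hG.hasFDerivAt.clm_apply (hasFDerivAt_const a y)).clm_apply
      (hasFDerivAt_const b y)).congr_fderiv (by ext; simp)
  have hev' : ∀ a b u : V, fderiv ℝ (fun z => G z a b) y u = fderiv ℝ G y u a b := by
    intro a b u
    rw [(hev a b).fderiv]
    simp
  have hs : ∀ u v w, fderiv ℝ G y u v w = fderiv ℝ G y u w v := by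
    intro u v w
    rw [← hev', ← hev']
    have : (fun z => G z v w) =ᶠ[nhds y] fun z => G z w v := by
      filter_upwards [hsymm] with z hz using hz v w
    rw [this.fderiv_eq]
  have hi : ∀ u v w, fderiv ℝ G y u (J v) (J w) = fderiv ℝ G y u v w := by
    intro u v w
    rw [← hev', ← hev']
    have : (fun z => G z (J v) (J w)) =ᶠ[nhds y] fun z => G z v w := by
      filter_upwards [hJ] with z hz using hz.isometry v w
    rw [this.fderiv_eq]
  have hsq := hJ.self_of_nhds.sq
  have ha : ∀ u v w, fderiv ℝ G y u (J v) w = -fderiv ℝ G y u (J w) v := by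
    intro u v w
    rw [hs u (J w) v, ← hi u v (J w), hsq, map_neg, neg_neg]
  refine ⟨hs, hi, fun u v x => ?_⟩
  have h1 := congrArg (fun β => β ![u, v, x]) hclosed
  simp only [extDeriv_apply hw] at h1
  have h2 : ∀ a : Fin 2 → V, ∀ t, fderiv ℝ (fun z => w z a) y t =
      (fderiv ℝ G y t (J (a 0)) (a 1) : ℂ) := by
    intro a t
    have : (fun z => w z a) =ᶠ[nhds y] fun z => (G z (J (a 0)) (a 1) : ℂ) := by
      filter_upwards [hGw] with z hz using hz a
    rw [this.fderiv_eq]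
    have := (Complex.ofRealCLM.hasFDerivAt.comp y (hev (J (a 0)) (a 1))).fderiv
    rw [show (fun z => (G z (J (a 0)) (a 1) : ℂ)) = Complex.ofRealCLM ∘
      fun z => G z (J (a 0)) (a 1) from rfl, this]
    simp
  simp only [h2] at h1
  have h4 := (Fin.sum_univ_three _).symm.trans h1
  change (-1 : ℤ) ^ 0 • (fderiv ℝ G y u (J v) x : ℂ) + (-1 : ℤ) ^ 1 • (fderiv ℝ G y v (J u) x : ℂ) +
    (-1 : ℤ) ^ 2 • (fderiv ℝ G y x (J u) v : ℂ) = 0 at h4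
  simp only [pow_zero, one_smul, pow_one, neg_smul, even_two, Even.neg_pow, one_pow] at h4
  have h3 : fderiv ℝ G y u (J v) x - fderiv ℝ G y v (J u) x + fderiv ℝ G y x (J u) v = 0 := by
    exact_mod_cast (by linear_combination h4 : ((fderiv ℝ G y u (J v) x : ℝ) : ℂ) -
      (fderiv ℝ G y v (J u) x : ℝ) + (fderiv ℝ G y x (J u) v : ℝ) = 0)
  -- The differential of a 2-form is an alternating sum; skew-symmetry of C(v; J·, ·) flips the sign
  -- of its middle term and makes it cyclic.
  rw [ha v x u]
  linarith

theorem contDiff_indicator {F : Type*} [NormedAddCommGroup F] [NormedSpace ℝ F] {N : ℕ∞ω}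
    {U K : Set V} (hU : IsOpen U) (hK : IsCompact K)
    (hKU : K ⊆ U) {f : V → F} (hf : ContDiffOn ℝ N f U) (h0 : ∀ y ∈ U \ K, f y = 0) :
    ContDiff ℝ N (U.indicator f) := by
  rw [contDiff_iff_contDiffAt]
  intro y
  by_cases hy : y ∈ K
  · refine (hf.contDiffAt (hU.mem_nhds (hKU hy))).congr_of_eventuallyEq ?_
    filter_upwards [hU.mem_nhds (hKU hy)] with z hz using Set.indicator_of_mem hz f
  · refine (contDiffAt_const (c := (0 : F))).congr_of_eventuallyEq ?_
    filter_upwards [hK.isClosed.isOpen_compl.mem_nhds hy] with z hz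
    by_cases hzU : z ∈ U
    · rw [Set.indicator_of_mem hzU, h0 z ⟨hzU, hz⟩]
    · exact Set.indicator_of_notMem hzU f

variable [FiniteDimensional ℝ V]

theorem integral_lineDeriv_eq_zero [MeasurableSpace V] [BorelSpace V] (μ : Measure V)
    [μ.IsAddHaarMeasure] {f : V → ℂ} (hf : ContDiff ℝ 1 f) (hc : HasCompactSupport f) (v : V) :
    ∫ y, lineDeriv ℝ f y v ∂μ = 0 ∧ Integrable (fun y => lineDeriv ℝ f y v) μ := by
  have hd : ∀ y, HasLineDerivAt ℝ f (fderiv ℝ f y v) y v := fun y =>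
    (hf.differentiable one_ne_zero y).hasFDerivAt.hasLineDerivAt v
  have hl : (fun y => lineDeriv ℝ f y v) = fun y => fderiv ℝ f y v :=
    funext fun y => (hd y).lineDeriv
  have hfi : Integrable f μ := hf.continuous.integrable_of_hasCompactSupport hc
  have hi : Integrable (fun y => fderiv ℝ f y v) μ :=
    ((hf.continuous_fderiv one_ne_zero).clm_apply continuous_const).integrable_of_hasCompactSupport
      ((hc.fderiv ℝ).comp_left (g := fun L : V →L[ℝ] ℂ => L v) rfl)
  rw [hl]
  refine ⟨?_, hi⟩
  -- Integration by parts against the constant function 1.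
  have := integral_bilinear_hasLineDerivAt_right_eq_neg_left_of_integrable (μ := μ)
    (f := fun _ => (1 : ℝ)) (f' := fun _ => 0) (g := f) (g' := fun y => fderiv ℝ f y v) (v := v)
    (B := ContinuousLinearMap.lsmul ℝ ℝ) (by simp) (by simpa using hi) (by simpa using hfi)
    (fun x _ => by simpa using (hasFDerivAt_const (1 : ℝ) x).hasLineDerivAt v) (fun x _ => hd x)
  simpa using this

theorem contDiffOn_boundaryField {U : Set V} {G : V → V →L[ℝ] V →L[ℝ] ℝ} (J : V →L[ℝ] V) {k : ℕ}
    {N : ℕ∞ω} {α : V → V [⋀^Fin (k + 1)]→L[ℝ] ℂ} {β : V → V [⋀^Fin k]→L[ℝ] ℂ}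
    (hG : ContDiffOn ℝ N G U)
    (hdet : ∀ y ∈ U, (gram (G y) (Module.finBasis ℝ V)).det ≠ 0) (hα : ContDiffOn ℝ N α U)
    (hβ : ContDiffOn ℝ N β U) (j : Fin (Module.finrank ℝ V)) :
    ContDiffOn ℝ N (boundaryField G J α β j) U := fun y hy =>
  (contDiffWithinAt_sqrt_det_gram (hG y hy) _ (hdet y hy)).smul
    (ContDiffWithinAt.sum fun i _ => (contDiffWithinAt_gram_inv (hG y hy) _ (hdet y hy) i j).smul
      (contDiffWithinAt_formInner (hG y hy) (hdet y hy)
        (contDiffWithinAt_curryLeft (hα y hy) _) (hβ y hy)))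

/-- On an open subset of a vector space with a Kähler metric, `dᶜ` is the formal adjoint of
`Δ`. -/
theorem setIntegral_formInner_flatDelta_sub [MeasurableSpace V] [BorelSpace V] (μ : Measure V)
    [μ.IsAddHaarMeasure] {U K : Set V} (hU : IsOpen U) (hK : IsCompact K) (hKU : K ⊆ U)
    {G : V → V →L[ℝ] V →L[ℝ] ℝ} {J : V →L[ℝ] V} {k : ℕ}
    {α : V → V [⋀^Fin (k + 1)]→L[ℝ] ℂ} {β : V → V [⋀^Fin k]→L[ℝ] ℂ}
    (hG : ContDiffOn ℝ 1 G U) (hsymm : ∀ y ∈ U, ∀ u v, G y u v = G y v u)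
    (hpos : ∀ y ∈ U, ∀ v, v ≠ 0 → 0 < G y v v) (hJ : ∀ y ∈ U, IsCompatible (G y) J)
    (hC : ∀ y ∈ U, IsKahlerJet J (fderiv ℝ G y)) (hα : ContDiffOn ℝ 1 α U)
    (hβ : ContDiffOn ℝ 1 β U) (h0 : ∀ y ∈ U \ K, α y = 0 ∨ β y = 0) :
    ∫ y in U, √(gram (G y) (Module.finBasis ℝ V)).det •
      (formInner (G y) (flatDelta G J α y) (β y) - formInner (G y) (α y) (flatDc J β y)) ∂μ =
        0 := by
  have hdet : ∀ y ∈ U, (gram (G y) (Module.finBasis ℝ V)).det ≠ 0 := by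
    intro y hy
    obtain ⟨e, he⟩ := exists_isONB (hsymm y hy) (hpos y hy)
    exact he.det_gram_ne_zero _
  set b := Module.finBasis ℝ V
  have hB0 : ∀ j, ∀ y ∈ U \ K, boundaryField G J α β j y = 0 := by
    intro j y hy
    rcases h0 y hy with h | h <;>
    simp [boundaryField, h, formInner_zero_left, formInner_zero_right,
      ContinuousAlternatingMap.curryLeft_zero]
  -- The field vanishes on U outside K, so its extension by zero is C¹ with compact support on the
  -- whole space.
  set F : Fin (Module.finrank ℝ V) → V → ℂ := fun j => U.indicator (boundaryField G J α β j)
  have hF : ∀ j, ContDiff ℝ 1 (F j) := fun j =>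
    contDiff_indicator hU hK hKU (contDiffOn_boundaryField J hG hdet hα hβ j) (hB0 j)
  have hF0 : ∀ j, ∀ y ∉ K, F j y = 0 := by
    intro j y hy
    by_cases hyU : y ∈ U
    · exact (Set.indicator_of_mem hyU _).trans (hB0 j y ⟨hyU, hy⟩)
    · exact Set.indicator_of_notMem hyU _
  have hFc : ∀ j, HasCompactSupport (F j) := fun j => HasCompactSupport.intro hK (hF0 j)
  have hint := fun j => integral_lineDeriv_eq_zero μ (hF j) (hFc j) (b j)
  have hin : ∀ y ∈ U, √(gram (G y) b).det •
      (formInner (G y) (flatDelta G J α y) (β y) - formInner (G y) (α y) (flatDc J β y)) =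
      ∑ j, lineDeriv ℝ (F j) y (b j) := by
    intro y hy
    obtain ⟨e, he⟩ := exists_isONB (hsymm y hy) (hpos y hy)
    have hUy := hU.mem_nhds hy
    rw [← sum_lineDeriv_boundaryField (hG.contDiffAt hUy) he (hJ y hy) (hC y hy)
      (hα.contDiffAt hUy) (hβ.contDiffAt hUy)]
    refine Finset.sum_congr rfl fun j _ => (Filter.EventuallyEq.lineDeriv_eq ?_).symm
    filter_upwards [hUy] with z hz using Set.indicator_of_mem hz _
  rw [setIntegral_congr_fun hU.measurableSet hin, setIntegral_eq_integral_of_forall_compl_eq_zero,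
    integral_finsetSum _ fun j _ => (hint j).2]
  · simp only [(hint _).1, Finset.sum_const_zero]
  · intro y hy
    refine Finset.sum_eq_zero fun j _ => ?_
    have : F j =ᶠ[nhds y] fun _ => 0 := by
      filter_upwards [hK.isClosed.isOpen_compl.mem_nhds fun h => hy (hKU h)] with z hz
        using hF0 j z hz
    rw [this.lineDeriv_eq]
    simp [lineDeriv]

end FlatIntegration

/-! ### Transition maps and the metric in charts. -/

section Charts

variable {E : Type*} [NormedAddCommGroup E] [NormedSpace ℂ E]
  {X : Type*} [TopologicalSpace X] [ChartedSpace E X]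

variable (E) in
/-- The change of coordinates from the chart at `p` to the chart at `x`. -/
def transition (p x : X) : OpenPartialHomeomorph E E :=
  (chartAt E p).symm.trans (chartAt E x)

theorem transition_apply (p x : X) (y : E) :
    transition E p x y = chartAt E x ((chartAt E p).symm y) := rfl

theorem mem_transition_source {p x : X} {y : E} : y ∈ (transition E p x).source ↔
    y ∈ (chartAt E p).target ∧ (chartAt E p).symm y ∈ (chartAt E x).source := by
  simp [transition]

theorem transition_symm (p x : X) : (transition E p x).symm = transition E x p := by
  simp [transition, OpenPartialHomeomorph.trans_symm_eq_symm_trans_symm]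

theorem transition_source_mem_nhds {p x : X} {y : E} (hy : y ∈ (transition E p x).source) :
    (transition E p x).source ∈ nhds y :=
  (transition E p x).open_source.mem_nhds hy

theorem symm_transition {p x : X} {y : E} (hy : y ∈ (transition E p x).source) :
    (chartAt E x).symm (transition E p x y) = (chartAt E p).symm y := by
  rw [transition_apply, (chartAt E x).left_inv (mem_transition_source.1 hy).2]

theorem mem_transition_source_self {p : X} {y : E} (hy : y ∈ (chartAt E p).target) :
    y ∈ (transition E p ((chartAt E p).symm y)).source :=
  mem_transition_source.2 ⟨hy, mem_chart_source E _⟩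

variable [IsManifold 𝓘(ℂ, E) ω X]

theorem contDiffOn_transition_complex (p x : X) :
    ContDiffOn ℂ ω (transition E p x) (transition E p x).source := by
  have h := (contDiffGroupoid ω 𝓘(ℂ, E)).compatible (chart_mem_atlas E p) (chart_mem_atlas E x)
  rw [contDiffGroupoid, mem_groupoid_of_pregroupoid] at h
  simpa [contDiffPregroupoid, transition] using h.1

theorem contDiffAt_transition {p x : X} {y : E} (hy : y ∈ (transition E p x).source) :
    ContDiffAt ℝ ∞ (transition E p x) y :=
  (((contDiffOn_transition_complex p x).contDiffAt (transition_source_mem_nhds hy)).restrict_scalars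
    ℝ).of_le le_top

theorem fderiv_transition_smul {p x : X} {y : E} (hy : y ∈ (transition E p x).source) (c : ℂ)
    (v : E) : fderiv ℝ (transition E p x) y (c • v) = c • fderiv ℝ (transition E p x) y v := by
  have h : DifferentiableAt ℂ (transition E p x) y :=
    ((contDiffOn_transition_complex p x).contDiffAt
      (transition_source_mem_nhds hy)).differentiableAt (by simp)
  rw [h.fderiv_restrictScalars ℝ]
  simp

theorem contMDiffOn_chart_symm_real (p : X) :
    ContMDiffOn 𝓘(ℝ, E) 𝓘(ℝ, E) ∞ (chartAt E p).symm (chartAt E p).target :=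
  contMDiffOn_chart_symm

theorem mdifferentiableAt_chart_symm {p : X} {y : E} (hy : y ∈ (chartAt E p).target) :
    MDifferentiableAt 𝓘(ℝ, E) 𝓘(ℝ, E) (chartAt E p).symm y :=
  ((contMDiffOn_chart_symm_real p).contMDiffAt
    ((chartAt E p).open_target.mem_nhds hy)).mdifferentiableAt (by simp)

/-- The tangent space at a point is read in the preferred chart of that point, so the derivative of
an inverse chart is that of the transition to the chart preferred at the image point, which itself
varies with y. -/
theorem chartSymmDeriv_eq {p : X} {y : E} (hy : y ∈ (chartAt E p).target) :
    chartSymmDeriv p y = fderiv ℝ (transition E p ((chartAt E p).symm y)) y := by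
  rw [chartSymmDeriv, (mdifferentiableAt_chart_symm hy).mfderiv]
  simp [writtenInExtChartAt, extChartAt, transition, Function.comp_def]
  rfl

theorem fderiv_transition_comp {p x z : X} {y : E} (hy : y ∈ (transition E p x).source)
    (hz : y ∈ (transition E p z).source) :
    fderiv ℝ (transition E p z) y =
      (fderiv ℝ (transition E x z) (transition E p x y)).comp (fderiv ℝ (transition E p x) y) := by
  have hxz : transition E p x y ∈ (transition E x z).source := by
    rw [mem_transition_source, symm_transition hy]
    exact ⟨(chartAt E x).map_source (mem_transition_source.1 hy).2, (mem_transition_source.1 hz).2⟩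
  have h : transition E p z =ᶠ[nhds y] transition E x z ∘ transition E p x := by
    filter_upwards [transition_source_mem_nhds hy] with w hw
    rw [Function.comp_apply, transition_apply x z, symm_transition hw, transition_apply]
  rw [h.fderiv_eq, fderiv_comp]
  · exact (contDiffAt_transition hxz).differentiableAt (by simp)
  · exact (contDiffAt_transition hy).differentiableAt (by simp)

theorem chartSymmDeriv_eq_comp {p x : X} {y : E} (hy : y ∈ (transition E p x).source) :
    chartSymmDeriv p y =
      (chartSymmDeriv x (transition E p x y)).comp (fderiv ℝ (transition E p x) y) := by
  have h1 := (mem_transition_source.1 hy).1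
  have h2 : transition E p x y ∈ (chartAt E x).target :=
    (chartAt E x).map_source (mem_transition_source.1 hy).2
  rw [chartSymmDeriv_eq h1, chartSymmDeriv_eq h2, symm_transition hy]
  exact fderiv_transition_comp hy (mem_transition_source_self h1)

theorem fderiv_transition_self {p : X} {y : E} (hy : y ∈ (chartAt E p).target) :
    fderiv ℝ (transition E p p) y = ContinuousLinearMap.id ℝ E := by
  have : transition E p p =ᶠ[nhds y] id := by
    filter_upwards [(chartAt E p).open_target.mem_nhds hy] with w hw
    rw [transition_apply, (chartAt E p).right_inv hw, id]
  rw [this.fderiv_eq, fderiv_id]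

theorem chartSymmDeriv_self (x : X) :
    chartSymmDeriv x (chartAt E x x) = ContinuousLinearMap.id ℝ E := by
  have h := mem_chart_target E x
  rw [chartSymmDeriv_eq h, (chartAt E x).left_inv (mem_chart_source E x), fderiv_transition_self h]

/-- The derivative of a change of coordinates as a linear equivalence. -/
def transitionDeriv (p x : X) {y : E} (hy : y ∈ (transition E p x).source) : E ≃L[ℝ] E :=
  ContinuousLinearEquiv.equivOfInverse (fderiv ℝ (transition E p x) y)
    (fderiv ℝ (transition E x p) (transition E p x y))
    (fun v => by
      have h1 := (mem_transition_source.1 hy).1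
      have := fderiv_transition_comp (z := p) hy
        (mem_transition_source.2 ⟨h1, (chartAt E p).map_target h1⟩)
      rw [fderiv_transition_self h1] at this
      exact (DFunLike.congr_fun this v).symm)
    (fun v => by
      have h2 : transition E p x y ∈ (chartAt E x).target :=
        (chartAt E x).map_source (mem_transition_source.1 hy).2
      have h3 : transition E p x y ∈ (transition E x p).source := by
        rw [← transition_symm]
        exact (transition E p x).map_source hy
      have := fderiv_transition_comp (z := x) h3
        (mem_transition_source.2 ⟨h2, (chartAt E x).map_target h2⟩)
      have h4 : transition E x p (transition E p x y) = y := by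
        rw [← transition_symm, (transition E p x).left_inv hy]
      rw [fderiv_transition_self h2, h4] at this
      exact (DFunLike.congr_fun this v).symm)

/-- The derivative of an inverse chart as a linear equivalence. -/
def chartSymmEquiv (p : X) {y : E} (hy : y ∈ (chartAt E p).target) : E ≃L[ℝ] E :=
  transitionDeriv p ((chartAt E p).symm y) (mem_transition_source_self hy)

theorem coe_chartSymmEquiv (p : X) {y : E} (hy : y ∈ (chartAt E p).target) :
    (chartSymmEquiv p hy : E →L[ℝ] E) = chartSymmDeriv p y :=
  (chartSymmDeriv_eq hy).symm

theorem chartSymmDeriv_smul {p : X} {y : E} (hy : y ∈ (chartAt E p).target) (c : ℂ) (v : E) :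
    chartSymmDeriv p y (c • v) = c • chartSymmDeriv p y v := by
  rw [chartSymmDeriv_eq hy, fderiv_transition_smul (mem_transition_source_self hy)]

namespace HermitianMetric

variable [FiniteDimensional ℂ E] (g : HermitianMetric E X)

theorem inChart_apply (p : X) (y u v : E) : g.inChart p y u v =
    g.metricAt ((chartAt E p).symm y) (chartSymmDeriv p y u) (chartSymmDeriv p y v) := rfl

theorem metricAt_symm (x : X) (u v : E) : g.metricAt x u v = g.metricAt x v u := g.symm x u v

theorem metricAt_pos (x : X) (v : E) (hv : v ≠ 0) : 0 < g.metricAt x v v := g.pos x v hv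

theorem inChart_symm (p : X) (y u v : E) : g.inChart p y u v = g.inChart p y v u :=
  g.metricAt_symm _ _ _

theorem inChart_pos {p : X} {y : E} (hy : y ∈ (chartAt E p).target) (v : E) (hv : v ≠ 0) :
    0 < g.inChart p y v v := by
  refine g.metricAt_pos _ _ ?_
  rw [← coe_chartSymmEquiv p hy]
  simpa using hv

/-- `chartSymmDeriv p y` need not vary continuously in y as a map into E, because the preferred
chart changes with the point. Smoothness is therefore proved in the tangent bundle: the metric
section is applied to the images of constant vector fields. -/
theorem contDiffOn_inChart_apply {p : X} (u v : E) :
    ContDiffOn ℝ ∞ (fun y => g.inChart p y u v) (chartAt E p).target := by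
  have ht : UniqueMDiffOn 𝓘(ℝ, E) (chartAt E p).target := (chartAt E p).open_target.uniqueMDiffOn
  have hs := contMDiffOn_chart_symm_real (E := E) p
  have hT := hs.contMDiffOn_tangentMapWithin (m := ∞) (by simp) ht
  have hv : ∀ v : E, ContMDiffOn 𝓘(ℝ, E) 𝓘(ℝ, E).tangent ∞
      (fun y => (Bundle.TotalSpace.mk' E ((chartAt E p).symm y) (chartSymmDeriv p y v) :
        TangentBundle 𝓘(ℝ, E) X)) (chartAt E p).target := by
    intro v
    have hc : ContMDiff 𝓘(ℝ, E) 𝓘(ℝ, E).tangent ∞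
        (fun y : E => (Bundle.TotalSpace.mk' E y v : TangentBundle 𝓘(ℝ, E) E)) := by
      exact contMDiff_vectorSpace_iff_contDiff.2 contDiff_const
    refine (hT.comp hc.contMDiffOn fun y hy => hy).congr fun y hy => ?_
    simp only [Function.comp_apply, tangentMapWithin, chartSymmDeriv]
    rw [mfderivWithin_of_isOpen (chartAt E p).open_target hy]
    rfl
  have hg : ContMDiffOn 𝓘(ℝ, E) (𝓘(ℝ, E).prod 𝓘(ℝ, E →L[ℝ] E →L[ℝ] ℝ)) ∞
      (fun y => Bundle.TotalSpace.mk' (E →L[ℝ] E →L[ℝ] ℝ)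
        (E := fun x : X => TangentSpace 𝓘(ℝ, E) x →L[ℝ] TangentSpace 𝓘(ℝ, E) x →L[ℝ] ℝ)
        ((chartAt E p).symm y) (g.inner ((chartAt E p).symm y))) (chartAt E p).target :=
    g.contMDiff.comp_contMDiffOn hs
  intro y hy
  have := ContMDiffWithinAt.clm_bundle_apply₂ (F₁ := E) (F₂ := E) (F₃ := ℝ)
    (E₃ := Bundle.Trivial X ℝ) (hg y hy) (hv u y hy) (hv v y hy)
  rw [Bundle.contMDiffWithinAt_totalSpace] at this
  exact this.2.contDiffWithinAt

end HermitianMetric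
end Charts

section TwoForm

variable {V : Type*} [NormedAddCommGroup V] [NormedSpace ℝ V]

/-- Exhibits the 2-form as the image of B under a fixed continuous linear map, so that smoothness of
the fundamental form follows from that of the metric. Alternation counts a skew form twice, whence
the 1/2. -/
theorem twoForm_eq_alternatizeUncurryFin (B : V →L[ℝ] V →L[ℝ] ℝ) (hB : ∀ v, B v v = 0) :
    twoForm B hB = (2 : ℝ)⁻¹ • ContinuousAlternatingMap.alternatizeUncurryFinCLM ℝ V ℂ
      (((ContinuousAlternatingMap.ofSubsingletonLIE (0 : Fin 1)).toContinuousLinearEquiv.toContinuousLinearMap.comp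
        (ContinuousLinearMap.compL ℝ V ℝ ℂ Complex.ofRealCLM)).comp B) := by
  have hanti : ∀ u v, B v u = -B u v := by
    intro u v
    have := hB (u + v)
    simp only [map_add, add_apply, hB, zero_add, add_zero] at this
    linarith
  ext v
  change (B (v 0) (v 1) : ℂ) = _
  rw [ContinuousAlternatingMap.smul_apply, ContinuousAlternatingMap.alternatizeUncurryFinCLM_apply,
    ContinuousAlternatingMap.alternatizeUncurryFin_apply, Fin.sum_univ_two]
  simp [Fin.removeNth_apply, hanti (v 0), show Fin.tail v 0 = v 1 from rfl]
  ring

end TwoForm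

/-! ### Differential forms and the operators d, dᶜ, Λ, Δ in charts. -/

section FormsInCharts

variable {E : Type*} [NormedAddCommGroup E] [NormedSpace ℂ E]
  {X : Type*} [TopologicalSpace X] [ChartedSpace E X] {k : ℕ}

variable (E) in
/-- Multiplication by `i` as a real linear map. -/
def complexJ : E →L[ℝ] E := Complex.I • ContinuousLinearMap.id ℝ E

theorem complexJ_apply (v : E) : complexJ E v = Complex.I • v := rfl

theorem complexJ_complexJ (v : E) : complexJ E (complexJ E v) = -v := by
  rw [complexJ_apply, complexJ_apply, smul_smul, Complex.I_mul_I, neg_one_smul]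

theorem two_le_smooth : minSmoothness ℝ 2 ≤ ∞ := by
  rw [minSmoothness_of_isRCLikeNormedField]
  exact WithTop.coe_le_coe.2 (le_top : (2 : ℕ∞) ≤ ⊤)

namespace KForm

theorem inChart_add (α β : KForm E X k) (p : X) : (α + β).inChart p = α.inChart p + β.inChart p :=
  rfl

theorem inChart_sub (α β : KForm E X k) (p : X) : (α - β).inChart p = α.inChart p - β.inChart p :=
  rfl

/-- A form of degree `k` is smooth if it is smooth in all the charts `chartAt E p`. -/
def IsSmooth (α : KForm E X k) : Prop :=
  ∀ p : X, ContDiffOn ℝ ∞ (α.inChart p) (chartAt E p).target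

theorem isSmooth_zero : (0 : KForm E X k).IsSmooth := fun _ => contDiffOn_const (c := 0)

theorem IsSmooth.add {α β : KForm E X k} (hα : α.IsSmooth) (hβ : β.IsSmooth) :
    (α + β).IsSmooth := fun p => (hα p).add (hβ p)

theorem IsSmooth.sub {α β : KForm E X k} (hα : α.IsSmooth) (hβ : β.IsSmooth) :
    (α - β).IsSmooth := fun p => (hα p).sub (hβ p)

theorem IsSmooth.contDiffAt {α : KForm E X k} (hα : α.IsSmooth) {p : X} {y : E}
    (hy : y ∈ (chartAt E p).target) : ContDiffAt ℝ ∞ (α.inChart p) y :=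
  (hα p).contDiffAt ((chartAt E p).open_target.mem_nhds hy)

/-- The pullback of a form by the real linear map `v ↦ s v` on every tangent space. -/
def rotate (s : ℂ) (α : KForm E X k) : KForm E X k := fun x =>
  (α x).compContinuousLinearMap (s • ContinuousLinearMap.id ℝ E)

theorem rotate_rotate (s t : ℂ) (α : KForm E X k) :
    (α.rotate s).rotate t = α.rotate (s * t) := by
  funext x
  ext v
  simp [rotate, Function.comp_def, smul_smul]

theorem rotate_one (α : KForm E X k) : α.rotate 1 = α := by
  funext x
  ext v
  simp [rotate]

end KForm

variable [IsManifold 𝓘(ℂ, E) ω X]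

namespace KForm

theorem inChart_self (α : KForm E X k) (x : X) : α.inChart x (chartAt E x x) = α x := by
  rw [inChart, chartSymmDeriv_self, (chartAt E x).left_inv (mem_chart_source E x)]
  rfl

theorem inChart_eq_transition (α : KForm E X k) {p x : X} {y : E}
    (hy : y ∈ (transition E p x).source) :
    α.inChart p y = (α.inChart x (transition E p x y)).compContinuousLinearMap
      (fderiv ℝ (transition E p x) y) := by
  rw [inChart, inChart, symm_transition hy, chartSymmDeriv_eq_comp hy]
  rfl

theorem inChart_rotate (s : ℂ) (α : KForm E X k) {p : X} {y : E}
    (hy : y ∈ (chartAt E p).target) : (α.rotate s).inChart p y =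
      (α.inChart p y).compContinuousLinearMap (s • ContinuousLinearMap.id ℝ E) := by
  ext v
  simp [inChart, rotate, Function.comp_def, chartSymmDeriv_smul hy]

theorem IsSmooth.rotate {α : KForm E X k} (hα : α.IsSmooth) (s : ℂ) : (α.rotate s).IsSmooth :=
  fun p => (((ContinuousAlternatingMap.compContinuousLinearMapCLM (ι := Fin k) (F := ℂ)
    (s • ContinuousLinearMap.id ℝ E)).contDiff (n := ∞)).comp_contDiffOn (hα p)).congr
      fun _ hy => (α.inChart_rotate s hy).trans rfl

/-- `KForm.d` uses a different chart at each point; naturality of d under the transition maps shows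
that it is the exterior derivative in any one chart. -/
theorem IsSmooth.inChart_d {α : KForm E X k} (hα : α.IsSmooth) {p : X} {y : E}
    (hy : y ∈ (chartAt E p).target) : α.d.inChart p y = extDeriv (α.inChart p) y := by
  set x := (chartAt E p).symm y with hx
  have hys := mem_transition_source_self hy
  have h1 : α.inChart p =ᶠ[nhds y] fun z => (α.inChart x (transition E p x z)).compContinuousLinearMap
      (fderiv ℝ (transition E p x) z) := by
    filter_upwards [transition_source_mem_nhds hys] with z hz using α.inChart_eq_transition hz
  have ht : transition E p x y ∈ (chartAt E x).target :=
    (chartAt E x).map_source (mem_transition_source.1 hys).2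
  rw [h1.extDeriv_eq, extDeriv_pullback ((hα.contDiffAt ht).differentiableAt (by simp))
    (contDiffAt_transition hys) two_le_smooth, inChart, chartSymmDeriv_eq hy]
  rfl

theorem IsSmooth.d {α : KForm E X k} (hα : α.IsSmooth) : α.d.IsSmooth := by
  intro p
  refine ContDiffOn.congr ?_ fun y hy => hα.inChart_d hy
  have h := (hα p).fderiv_of_isOpen (m := ∞) (chartAt E p).open_target (by simp)
  exact (ContinuousAlternatingMap.alternatizeUncurryFinCLM ℝ E ℂ).contDiff.comp_contDiffOn h

/-- The twisted exterior derivative `dᶜ = J d J⁻¹`. -/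
def dc (α : KForm E X k) : KForm E X (k + 1) := (α.rotate (-Complex.I)).d.rotate Complex.I

theorem IsSmooth.dc {α : KForm E X k} (hα : α.IsSmooth) : α.dc.IsSmooth :=
  (hα.rotate _).d.rotate _

/-- The two rotations cancel in every slot of α and leave J only in the slot of the derivative. -/
theorem IsSmooth.inChart_dc {α : KForm E X k} (hα : α.IsSmooth) {p : X} {y : E}
    (hy : y ∈ (chartAt E p).target) :
    α.dc.inChart p y = flatDc (complexJ E) (α.inChart p) y := by
  rw [KForm.dc, inChart_rotate _ _ hy, (hα.rotate _).inChart_d hy, flatDc]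
  have h1 : (α.rotate (-Complex.I)).inChart p =ᶠ[nhds y] fun z =>
      ContinuousAlternatingMap.compContinuousLinearMapCLM
        ((-Complex.I) • ContinuousLinearMap.id ℝ E) (α.inChart p z) := by
    filter_upwards [(chartAt E p).open_target.mem_nhds hy] with z hz
      using α.inChart_rotate _ hz
  have h2 : fderiv ℝ ((α.rotate (-Complex.I)).inChart p) y =
      (ContinuousAlternatingMap.compContinuousLinearMapCLM
        ((-Complex.I) • ContinuousLinearMap.id ℝ E)).comp (fderiv ℝ (α.inChart p) y) := by
    rw [h1.fderiv_eq]
    exact fderiv_clm_comp (W := E [⋀^Fin k]→L[ℝ] ℂ) _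
      ((hα.contDiffAt hy).differentiableAt (by simp))
  ext v
  rw [extDeriv, h2]
  simp only [ContinuousAlternatingMap.compContinuousLinearMap_apply,
    ContinuousAlternatingMap.alternatizeUncurryFin_apply]
  refine Finset.sum_congr rfl fun i _ => ?_
  congr 1
  simp [Function.comp_def, Fin.removeNth_apply, smul_smul, complexJ_apply]
  rfl

end KForm

namespace HermitianMetric

variable (g : HermitianMetric E X)

variable [FiniteDimensional ℂ E]

theorem contDiffOn_inChart (p : X) : ContDiffOn ℝ ∞ (g.inChart p) (chartAt E p).target :=
  contDiffOn_clm_apply.2 fun u => contDiffOn_clm_apply.2 fun v => g.contDiffOn_inChart_apply u v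

theorem contDiffAt_inChart {p : X} {y : E} (hy : y ∈ (chartAt E p).target) :
    ContDiffAt ℝ ∞ (g.inChart p) y :=
  (g.contDiffOn_inChart p).contDiffAt ((chartAt E p).open_target.mem_nhds hy)

theorem isCompatible_metricAt (x : X) : IsCompatible (g.metricAt x) (complexJ E) :=
  ⟨complexJ_complexJ, fun u v => g.hermitian x u v⟩

theorem isCompatible_inChart {p : X} {y : E} (hy : y ∈ (chartAt E p).target) :
    IsCompatible (g.inChart p y) (complexJ E) := by
  refine ⟨complexJ_complexJ, fun u v => ?_⟩
  simp only [inChart_apply, complexJ_apply, chartSymmDeriv_smul hy]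
  exact (g.isCompatible_metricAt _).isometry _ _

theorem exists_isONB_metricAt (x : X) : ∃ e : Module.Basis (Fin (Module.finrank ℝ E)) ℝ E,
    IsONB (g.metricAt x) e := exists_isONB (g.metricAt_symm x) (g.metricAt_pos x)

theorem exists_isONB_inChart {p : X} {y : E} (hy : y ∈ (chartAt E p).target) :
    ∃ e : Module.Basis (Fin (Module.finrank ℝ E)) ℝ E, IsONB (g.inChart p y) e :=
  exists_isONB (g.inChart_symm p y) (g.inChart_pos hy)

theorem det_gram_inChart_ne_zero {p : X} {y : E} (hy : y ∈ (chartAt E p).target) :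
    (gram (g.inChart p y) (Module.finBasis ℝ E)).det ≠ 0 := by
  obtain ⟨e, he⟩ := g.exists_isONB_inChart hy
  exact he.det_gram_ne_zero _

theorem inChart_eq_bilinearComp {p : X} {y : E} (hy : y ∈ (chartAt E p).target) :
    g.inChart p y = (g.metricAt ((chartAt E p).symm y)).bilinearComp
      (chartSymmEquiv p hy : E →L[ℝ] E) (chartSymmEquiv p hy : E →L[ℝ] E) := by
  rw [coe_chartSymmEquiv]
  rfl

theorem formInner_inChart {p : X} {y : E} (hy : y ∈ (chartAt E p).target) (α β : KForm E X k) :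
    formInner (g.inChart p y) (α.inChart p y) (β.inChart p y) =
      formInner (g.metricAt ((chartAt E p).symm y)) (α ((chartAt E p).symm y))
        (β ((chartAt E p).symm y)) := by
  rw [g.inChart_eq_bilinearComp hy, KForm.inChart, KForm.inChart, ← coe_chartSymmEquiv p hy,
    formInner_compContinuousLinearMap (g.metricAt_symm _) (g.metricAt_pos _)]

/-- The operator `Λ` on forms of degree `k + 2`. -/
def lambdaK (α : KForm E X (k + 2)) : KForm E X k :=
  fun x => dualLefschetz (g.metricAt x) (g.fundamentalForm x) (α x)

theorem lambdaK_apply (α : KForm E X (k + 2)) (x : X) :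
    g.lambdaK α x = lambdaForm (g.metricAt x) (complexJ E) (α x) := by
  obtain ⟨e, he⟩ := g.exists_isONB_metricAt x
  exact he.dualLefschetz_eq (complexJ E) _ (α x)

theorem inChart_lambdaK (α : KForm E X (k + 2)) {p : X} {y : E} (hy : y ∈ (chartAt E p).target) :
    (g.lambdaK α).inChart p y = lambdaForm (g.inChart p y) (complexJ E) (α.inChart p y) := by
  rw [KForm.inChart, KForm.inChart, g.lambdaK_apply, g.inChart_eq_bilinearComp hy,
    ← coe_chartSymmEquiv p hy, lambdaForm_compContinuousLinearMap (g.metricAt_symm _)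
      (g.metricAt_pos _)]
  intro v
  have := chartSymmDeriv_smul hy Complex.I v
  rw [← coe_chartSymmEquiv p hy] at this
  exact this

theorem isSmooth_lambdaK {α : KForm E X (k + 2)} (hα : α.IsSmooth) : (g.lambdaK α).IsSmooth := by
  intro p
  refine ContDiffOn.congr (fun y hy => ?_) fun y hy => g.inChart_lambdaK α hy
  exact contDiffWithinAt_lambdaForm (g.contDiffOn_inChart p y hy) _
    (g.det_gram_inChart_ne_zero hy) (hα p y hy)

/-- The operator `Δ` on forms of degree `k + 1`. -/
def deltaK : ∀ {k : ℕ}, KForm E X (k + 1) → KForm E X k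
  | 0, α => g.lambdaK α.d
  | _ + 1, α => g.lambdaK α.d - (g.lambdaK α).d

theorem isSmooth_deltaK {α : KForm E X (k + 1)} (hα : α.IsSmooth) : (g.deltaK α).IsSmooth := by
  cases k with
  | zero => exact g.isSmooth_lambdaK hα.d
  | succ k => exact (g.isSmooth_lambdaK hα.d).sub (g.isSmooth_lambdaK hα).d

theorem inChart_deltaK {α : KForm E X (k + 1)} (hα : α.IsSmooth) {p : X} {y : E}
    (hy : y ∈ (chartAt E p).target) :
    (g.deltaK α).inChart p y = flatDelta (g.inChart p) (complexJ E) (α.inChart p) y := by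
  have h1 : (g.lambdaK α.d).inChart p y =
      lambdaForm (g.inChart p y) (complexJ E) (extDeriv (α.inChart p) y) := by
    rw [g.inChart_lambdaK _ hy, hα.inChart_d hy]
  cases k with
  | zero => exact h1
  | succ k =>
    rw [deltaK, KForm.inChart_sub, Pi.sub_apply, h1, flatDelta,
      (g.isSmooth_lambdaK hα).inChart_d hy]
    congr 1
    refine Filter.EventuallyEq.extDeriv_eq ?_
    filter_upwards [(chartAt E p).open_target.mem_nhds hy] with z hz using g.inChart_lambdaK α hz

/-- In degree 0 the term dΛ is zero by definition of the mixed-degree d, which is why `deltaK` omits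
it there. -/
theorem Δ_apply (α : DiffForm E X) (k : ℕ) : g.Δ α k = g.deltaK (α (k + 1)) := by
  cases k with
  | zero =>
    change g.lambdaK (α 1).d - 0 = _
    rw [sub_zero]
    rfl
  | succ k => rfl

theorem inChart_fundamentalForm_apply {p : X} {y : E} (hy : y ∈ (chartAt E p).target)
    (v : Fin 2 → E) : g.fundamentalForm.inChart p y v =
      (g.inChart p y (complexJ E (v 0)) (v 1) : ℂ) := by
  rw [inChart_apply, complexJ_apply, chartSymmDeriv_smul hy]
  rfl

theorem isSmooth_fundamentalForm : g.fundamentalForm.IsSmooth := by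
  intro p
  have hJ : ContDiffOn ℝ ∞ (fun y => (g.inChart p y).comp (complexJ E)) (chartAt E p).target :=
    (g.contDiffOn_inChart p).clm_comp contDiffOn_const
  have h0 : ∀ y ∈ (chartAt E p).target, ∀ v, (g.inChart p y).comp (complexJ E) v v = 0 := by
    intro y hy v
    have hJ := g.isCompatible_inChart hy
    have h1 := hJ.isometry (complexJ E v) v
    rw [hJ.sq, map_neg, neg_apply, g.inChart_symm p y v] at h1
    change g.inChart p y (complexJ E v) v = 0
    linarith
  let P : (E →L[ℝ] E →L[ℝ] ℝ) →L[ℝ] E [⋀^Fin 2]→L[ℝ] ℂ :=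
    (ContinuousAlternatingMap.alternatizeUncurryFinCLM ℝ E ℂ).comp (ContinuousLinearMap.compL ℝ E _ _
      ((ContinuousAlternatingMap.ofSubsingletonLIE (0 : Fin 1)).toContinuousLinearEquiv.toContinuousLinearMap.comp
        (ContinuousLinearMap.compL ℝ E ℝ ℂ Complex.ofRealCLM)))
  refine ((P.contDiff.comp_contDiffOn hJ).const_smul (2 : ℝ)⁻¹).congr fun y hy => ?_
  refine Eq.trans ?_ (twoForm_eq_alternatizeUncurryFin _ (h0 y hy))
  ext v
  exact g.inChart_fundamentalForm_apply hy v

end HermitianMetric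

theorem KahlerMetric.isKahlerJet_inChart [FiniteDimensional ℂ E] (g : KahlerMetric E X) {p : X}
    {y : E} (hy : y ∈ (chartAt E p).target) :
    IsKahlerJet (complexJ E) (fderiv ℝ (g.inChart p) y) := by
  have ht := (chartAt E p).open_target.mem_nhds hy
  refine isKahlerJet_fderiv (w := g.fundamentalForm.inChart p)
    ((g.contDiffAt_inChart hy).differentiableAt (by simp))
    ((g.isSmooth_fundamentalForm.contDiffAt hy).differentiableAt (by simp))
    (Filter.Eventually.of_forall fun z => g.inChart_symm p z) ?_ ?_ ?_
  · filter_upwards [ht] with z hz using g.isCompatible_inChart hz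
  · filter_upwards [ht] with z hz v using g.inChart_fundamentalForm_apply hz v
  · rw [← g.isSmooth_fundamentalForm.inChart_d hy, g.closed]
    rfl

end FormsInCharts

/-! ### The Riemannian volume measure. -/

theorem det_gram_bilinearComp {V ι : Type*} [NormedAddCommGroup V] [NormedSpace ℝ V]
    [FiniteDimensional ℝ V] [Fintype ι] [DecidableEq ι] (g : V →L[ℝ] V →L[ℝ] ℝ) (A : V →L[ℝ] V)
    (b : Module.Basis ι ℝ V) :
    (gram (g.bilinearComp A A) b).det = A.det ^ 2 * (gram g b).det := by
  have h : gram (g.bilinearComp A A) b = (LinearMap.toMatrix b b (A : V →ₗ[ℝ] V)).transpose *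
      gram g b * LinearMap.toMatrix b b (A : V →ₗ[ℝ] V) := by
    ext i j
    have hA : ∀ i, A (b i) = ∑ m, LinearMap.toMatrix b b (A : V →ₗ[ℝ] V) m i • b m := by
      intro i
      simp only [LinearMap.toMatrix_apply]
      exact (b.sum_repr _).symm
    simp only [gram, Matrix.of_apply, Matrix.mul_apply, Matrix.transpose_apply]
    change g (A (b i)) (A (b j)) = _
    rw [hA i, hA j]
    simp only [map_sum, map_smul, sum_apply, smul_apply, smul_eq_mul, Finset.sum_mul,
      Finset.mul_sum]
    refine Finset.sum_congr rfl fun m _ => Finset.sum_congr rfl fun n _ => ?_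
    ring
  rw [h, Matrix.det_mul, Matrix.det_mul, Matrix.det_transpose, LinearMap.det_toMatrix,
    ContinuousLinearMap.det]
  ring

namespace HermitianMetric

variable {E : Type*} [NormedAddCommGroup E] [NormedSpace ℂ E]
  {X : Type*} [TopologicalSpace X] [ChartedSpace E X] [IsManifold 𝓘(ℂ, E) ω X]
  [FiniteDimensional ℂ E] (g : HermitianMetric E X)

/-- The density of the Riemannian volume in the chart at `p`. -/
def density (p : X) (y : E) : ℝ := √(gram (g.inChart p y) (Module.finBasis ℝ E)).det

theorem density_nonneg (p : X) (y : E) : 0 ≤ g.density p y := Real.sqrt_nonneg _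

theorem contDiffOn_density (p : X) : ContDiffOn ℝ ∞ (g.density p) (chartAt E p).target :=
  fun y hy => contDiffWithinAt_sqrt_det_gram (g.contDiffOn_inChart p y hy) _
    (g.det_gram_inChart_ne_zero hy)

theorem density_pos {p : X} {y : E} (hy : y ∈ (chartAt E p).target) : 0 < g.density p y := by
  obtain ⟨e, he⟩ := g.exists_isONB_inChart hy
  refine Real.sqrt_pos.2 (lt_of_le_of_ne ?_ (g.det_gram_inChart_ne_zero hy).symm)
  rw [det_gram_eq _ _ e, he.gram_eq_one, Matrix.det_one, mul_one]
  positivity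

theorem density_eq_transition {p x : X} {y : E} (hy : y ∈ (transition E p x).source) :
    g.density p y =
      |(fderiv ℝ (transition E p x) y).det| * g.density x (transition E p x y) := by
  have h : g.inChart p y = (g.inChart x (transition E p x y)).bilinearComp
      (fderiv ℝ (transition E p x) y) (fderiv ℝ (transition E p x) y) := by
    ext u v
    rw [ContinuousLinearMap.bilinearComp_apply, inChart_apply, inChart_apply, symm_transition hy,
      chartSymmDeriv_eq_comp hy]
    rfl
  rw [density, density, h, det_gram_bilinearComp, Real.sqrt_mul (sq_nonneg _), Real.sqrt_sq_eq_abs]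

variable [MeasurableSpace E] [BorelSpace E] [MeasurableSpace X] [BorelSpace X]

theorem aemeasurable_chart_symm (p : X) (μ : Measure E) :
    AEMeasurable (chartAt E p).symm (μ.restrict (chartAt E p).target) :=
  (chartAt E p).symm.continuousOn.aemeasurable (chartAt E p).open_target.measurableSet

theorem aemeasurable_density (p : X) (μ : Measure E) :
    AEMeasurable (g.density p) (μ.restrict (chartAt E p).target) :=
  (g.contDiffOn_density p).continuousOn.aemeasurable (chartAt E p).open_target.measurableSet

theorem aemeasurable_chart_symm_withDensity (p : X) :
    AEMeasurable (chartAt E p).symm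
      (((Module.finBasis ℝ E).addHaar.restrict (chartAt E p).target).withDensity fun y =>
        ENNReal.ofReal (g.density p y)) :=
  (aemeasurable_chart_symm p _).mono_ac (withDensity_absolutelyContinuous _ _)

theorem lintegral_chartVolume (p : X) {f : X → ENNReal} (hf : Measurable f) :
    ∫⁻ x, f x ∂g.chartVolume p = ∫⁻ y in (chartAt E p).target,
      ENNReal.ofReal (g.density p y) * f ((chartAt E p).symm y) ∂(Module.finBasis ℝ E).addHaar := by
  rw [chartVolume]
  change ∫⁻ x, f x ∂(Measure.map _ (Measure.withDensity _
    fun y => ENNReal.ofReal (g.density p y))) = _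
  rw [lintegral_map' hf.aemeasurable (g.aemeasurable_chart_symm_withDensity p),
    lintegral_withDensity_eq_lintegral_mul₀ (g.aemeasurable_density p _).ennreal_ofReal
      (g := fun y => f ((chartAt E p).symm y)) (hf.comp_aemeasurable (aemeasurable_chart_symm p _))]
  rfl

theorem integral_chartVolume (p : X) {f : X → ℂ} (hf : AEStronglyMeasurable f (g.chartVolume p)) :
    ∫ x, f x ∂g.chartVolume p = ∫ y in (chartAt E p).target,
      g.density p y • f ((chartAt E p).symm y) ∂(Module.finBasis ℝ E).addHaar := by
  rw [chartVolume] at hf ⊢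
  change AEStronglyMeasurable f (Measure.map _ (Measure.withDensity _
    fun y => ENNReal.ofReal (g.density p y))) at hf
  change ∫ x, f x ∂(Measure.map _ (Measure.withDensity _
    fun y => ENNReal.ofReal (g.density p y))) = _
  rw [integral_map (g.aemeasurable_chart_symm_withDensity p) hf,
    integral_withDensity_eq_integral_toReal_smul₀ (g.aemeasurable_density p _).ennreal_ofReal
      (by simp)]
  simp only [ENNReal.toReal_ofReal (g.density_nonneg p _)]

theorem chartVolume_apply (p : X) {S : Set X} (hS : MeasurableSet S) :
    g.chartVolume p S = ∫⁻ y in (chartAt E p).target, ENNReal.ofReal (g.density p y) *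
      S.indicator 1 ((chartAt E p).symm y) ∂(Module.finBasis ℝ E).addHaar := by
  rw [← lintegral_chartVolume g p (measurable_one.indicator hS), lintegral_indicator_one hS]

theorem chartVolume_compl_source (p : X) : g.chartVolume p (chartAt E p).sourceᶜ = 0 := by
  rw [g.chartVolume_apply p (chartAt E p).open_source.measurableSet.compl]
  refine setLIntegral_eq_zero (chartAt E p).open_target.measurableSet fun y hy => ?_
  simp [(chartAt E p).map_target hy]

theorem chartVolume_restrict_source (p : X) :
    (g.chartVolume p).restrict (chartAt E p).source = g.chartVolume p :=
  Measure.restrict_eq_self_of_ae_mem (measure_eq_zero_iff_ae_notMem.1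
    (g.chartVolume_compl_source p) |>.mono fun _ => not_not.1)

/-- Both sides become integrals over the overlap in coordinates. The densities differ by the
absolute Jacobian of the transition map, so the change of variables formula applies. -/
theorem chartVolume_eq_of_subset {p x : X} {S : Set X} (hS : MeasurableSet S)
    (hp : S ⊆ (chartAt E p).source) (hx : S ⊆ (chartAt E x).source) :
    g.chartVolume p S = g.chartVolume x S := by
  set μ := (Module.finBasis ℝ E).addHaar
  have key : ∀ p x : X, S ⊆ (chartAt E x).source → g.chartVolume p S =
      ∫⁻ y in (transition E p x).source, ENNReal.ofReal (g.density p y) *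
        S.indicator 1 ((chartAt E p).symm y) ∂μ := by
    intro p x hx
    rw [g.chartVolume_apply p hS]
    rw [← lintegral_indicator (chartAt E p).open_target.measurableSet,
      ← lintegral_indicator (transition E p x).open_source.measurableSet]
    congr 1
    funext y
    by_cases h1 : y ∈ (transition E p x).source
    · rw [Set.indicator_of_mem h1, Set.indicator_of_mem (mem_transition_source.1 h1).1]
    · rw [Set.indicator_of_notMem h1]
      by_cases h2 : y ∈ (chartAt E p).target
      · rw [Set.indicator_of_mem h2, Set.indicator_of_notMem (s := S), mul_zero]
        exact fun h => h1 (mem_transition_source.2 ⟨h2, hx h⟩)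
      · rw [Set.indicator_of_notMem h2]
  rw [key p x hx, key x p hp, ← transition_symm p x]
  have himage : (transition E p x).symm.source = transition E p x '' (transition E p x).source :=
    (transition E p x).image_source_eq_target.symm
  rw [himage, lintegral_image_eq_lintegral_abs_det_fderiv_mul μ
    (transition E p x).open_source.measurableSet (fun y hy =>
      ((contDiffAt_transition hy).differentiableAt (by simp)).hasFDerivAt.hasFDerivWithinAt)
    (transition E p x).injOn]
  refine setLIntegral_congr_fun (transition E p x).open_source.measurableSet fun y hy => ?_
  rw [symm_transition hy, g.density_eq_transition hy, ENNReal.ofReal_mul (abs_nonneg _), mul_assoc]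

theorem chartVolume_le_volume (p : X) : g.chartVolume p ≤ g.volume := le_iSup g.chartVolume p

theorem volume_restrict_source (p : X) :
    g.volume.restrict (chartAt E p).source = g.chartVolume p := by
  set s := (chartAt E p).source
  have hs : MeasurableSet s := (chartAt E p).open_source.measurableSet
  -- The supremum is bounded by bounding each chart volume: on the domain of the chart at p it is at
  -- most `chartVolume p`, elsewhere at most the full volume.
  have hle : g.volume ≤ g.chartVolume p + g.volume.restrict sᶜ := by
    refine iSup_le fun x => ?_
    have h1 : (g.chartVolume x).restrict s ≤ g.chartVolume p := by
      rw [Measure.le_iff]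
      intro S hS
      rw [Measure.restrict_apply hS, ← g.chartVolume_restrict_source x,
        Measure.restrict_apply (hS.inter hs), g.chartVolume_eq_of_subset (p := x) (x := p)
          ((hS.inter hs).inter (chartAt E x).open_source.measurableSet)
          Set.inter_subset_right (Set.inter_subset_left.trans Set.inter_subset_right)]
      exact measure_mono (Set.inter_subset_left.trans Set.inter_subset_left)
    rw [← Measure.restrict_add_restrict_compl (μ := g.chartVolume x) hs]
    exact add_le_add h1 (Measure.restrict_mono subset_rfl (g.chartVolume_le_volume x))
  refine le_antisymm ?_ ?_
  · refine (Measure.restrict_mono subset_rfl hle).trans ?_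
    rw [Measure.restrict_add, Measure.restrict_restrict hs, Set.inter_compl_self,
      Measure.restrict_empty, add_zero]
    exact Measure.restrict_le_self
  · rw [← g.chartVolume_restrict_source p]
    exact Measure.restrict_mono subset_rfl (g.chartVolume_le_volume p)

theorem integral_volume_eq [SecondCountableTopology X] (p : X) {f : X → ℂ}
    (hf : ContinuousOn f (chartAt E p).source) (h0 : ∀ x ∉ (chartAt E p).source, f x = 0) :
    ∫ x, f x ∂g.volume = ∫ y in (chartAt E p).target,
      g.density p y • f ((chartAt E p).symm y) ∂(Module.finBasis ℝ E).addHaar := by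
  rw [← setIntegral_eq_integral_of_forall_compl_eq_zero h0, g.volume_restrict_source p,
    g.integral_chartVolume p]
  rw [← g.volume_restrict_source p]
  exact hf.aestronglyMeasurable (chartAt E p).open_source.measurableSet

theorem volume_apply_of_subset {p : X} {S : Set X} (hS : MeasurableSet S)
    (hp : S ⊆ (chartAt E p).source) : g.volume S = ∫⁻ y in (chartAt E p).target,
      ENNReal.ofReal (g.density p y) *
        S.indicator 1 ((chartAt E p).symm y) ∂(Module.finBasis ℝ E).addHaar := by
  rw [← g.chartVolume_apply p hS, ← g.volume_restrict_source p,
    Measure.restrict_eq_self _ hp]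

instance isLocallyFiniteMeasure_volume : IsLocallyFiniteMeasure g.volume := by
  refine ⟨fun p => ?_⟩
  set y₀ := chartAt E p p
  have hT := (chartAt E p).open_target.mem_nhds (mem_chart_target E p)
  obtain ⟨r, hr, hrT⟩ := Metric.nhds_basis_closedBall.mem_iff.1 hT
  have hK : IsCompact (Metric.closedBall y₀ r) := isCompact_closedBall y₀ r
  obtain ⟨C, hC⟩ := (hK.image_of_continuousOn
    ((g.contDiffOn_density p).continuousOn.mono hrT)).bddAbove
  have hU : IsOpen ((chartAt E p).source ∩ chartAt E p ⁻¹' Metric.ball y₀ r) :=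
    (chartAt E p).isOpen_inter_preimage Metric.isOpen_ball
  refine ⟨_, hU.mem_nhds ⟨mem_chart_source E p, Metric.mem_ball_self hr⟩, ?_⟩
  rw [g.volume_apply_of_subset hU.measurableSet Set.inter_subset_left,
    ← lintegral_indicator (chartAt E p).open_target.measurableSet]
  refine lt_of_le_of_lt (lintegral_mono (g := (Metric.closedBall y₀ r).indicator
    fun _ => ENNReal.ofReal C) fun y => ?_) ?_
  · by_cases hyT : y ∈ (chartAt E p).target
    · rw [Set.indicator_of_mem hyT]
      by_cases hy : (chartAt E p).symm y ∈
        (chartAt E p).source ∩ chartAt E p ⁻¹' Metric.ball y₀ r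
      · have hyr : y ∈ Metric.closedBall y₀ r := by
          have := hy.2
          rw [Set.mem_preimage, (chartAt E p).right_inv hyT] at this
          exact Metric.ball_subset_closedBall this
        rw [Set.indicator_of_mem hy, Set.indicator_of_mem hyr, Pi.one_apply, mul_one]
        exact ENNReal.ofReal_le_ofReal (hC ⟨y, hyr, rfl⟩)
      · rw [Set.indicator_of_notMem hy, mul_zero]
        exact zero_le
    · rw [Set.indicator_of_notMem hyT]
      exact zero_le
  · rw [lintegral_indicator_const Metric.isClosed_closedBall.measurableSet]
    exact ENNReal.mul_lt_top ENNReal.ofReal_lt_top hK.measure_lt_top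

instance isOpenPosMeasure_volume : g.volume.IsOpenPosMeasure := by
  refine ⟨fun U hU ⟨p, hp⟩ h0 => ?_⟩
  have h1 : g.chartVolume p U = 0 :=
    le_antisymm ((g.chartVolume_le_volume p U).trans_eq h0) zero_le
  have hT : MeasurableSet (chartAt E p).target := (chartAt E p).open_target.measurableSet
  rw [g.chartVolume_apply p hU.measurableSet, setLIntegral_eq_zero_iff' hT
    (f := fun y => ENNReal.ofReal (g.density p y) * U.indicator 1 ((chartAt E p).symm y))
    ((g.aemeasurable_density p _).ennreal_ofReal.mul
      ((measurable_one.indicator hU.measurableSet).comp_aemeasurable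
        (aemeasurable_chart_symm p _)))] at h1
  have hW : IsOpen ((chartAt E p).target ∩ (chartAt E p).symm ⁻¹' U) :=
    (chartAt E p).symm.isOpen_inter_preimage hU
  refine hW.measure_ne_zero (Module.finBasis ℝ E).addHaar
    ⟨chartAt E p p, mem_chart_target E p, ?_⟩ (measure_mono_null ?_ (ae_iff.1 h1))
  · rwa [Set.mem_preimage, (chartAt E p).left_inv (mem_chart_source E p)]
  · rintro y ⟨hy, hyU⟩ h
    have := h hy
    rw [Set.indicator_of_mem (s := U) hyU, Pi.one_apply, mul_one, ENNReal.ofReal_eq_zero] at this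
    exact (g.density_pos hy).not_ge this

end HermitianMetric

/-! ### Locality and additivity of d and dᶜ. -/

variable {E : Type*} [NormedAddCommGroup E] [NormedSpace ℂ E]
  {X : Type*} [TopologicalSpace X] [ChartedSpace E X] [IsManifold 𝓘(ℂ, E) ω X] {k : ℕ}

namespace KForm

theorem IsSmooth.smul {α : KForm E X k} (hα : α.IsSmooth) {χ : X → ℝ}
    (hχ : ContMDiff 𝓘(ℝ, E) 𝓘(ℝ) ∞ χ) : KForm.IsSmooth (fun x => χ x • α x) := by
  intro p
  have h : ContDiffOn ℝ ∞ (fun y => χ ((chartAt E p).symm y)) (chartAt E p).target :=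
    (hχ.comp_contMDiffOn (contMDiffOn_chart_symm_real p)).contDiffOn
  exact (h.smul (hα p)).congr fun y _ => by ext v; simp [inChart]

theorem inChart_eventuallyEq_zero {α : KForm E X k} {x : X} (h : α =ᶠ[nhds x] 0) :
    α.inChart x =ᶠ[nhds (chartAt E x x)] 0 := by
  have hc : ContinuousAt (chartAt E x).symm (chartAt E x x) :=
    (chartAt E x).continuousAt_symm (mem_chart_target E x)
  have h' := hc.eventually (p := fun z => α z = 0)
    (by rwa [(chartAt E x).left_inv (mem_chart_source E x)])
  filter_upwards [h'] with y hy
  rw [inChart, hy]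
  rfl

theorem d_eventuallyEq_zero {α : KForm E X k} {x : X} (h : α =ᶠ[nhds x] 0) :
    α.d =ᶠ[nhds x] 0 := by
  filter_upwards [h.eventuallyEq_nhds] with z hz
  rw [d, (inChart_eventuallyEq_zero hz).extDeriv_eq]
  simp only [extDeriv, fderiv_zero, Pi.zero_apply]
  exact map_zero (ContinuousAlternatingMap.alternatizeUncurryFinCLM ℝ E ℂ)

theorem rotate_eventuallyEq_zero {α : KForm E X k} {x : X} (h : α =ᶠ[nhds x] 0) (s : ℂ) :
    α.rotate s =ᶠ[nhds x] 0 := by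
  filter_upwards [h] with z hz
  rw [rotate, hz]
  rfl

theorem dc_eventuallyEq_zero {α : KForm E X k} {x : X} (h : α =ᶠ[nhds x] 0) :
    α.dc =ᶠ[nhds x] 0 :=
  rotate_eventuallyEq_zero (d_eventuallyEq_zero (rotate_eventuallyEq_zero h _)) _

theorem tsupport_dc_subset (α : KForm E X k) : tsupport α.dc ⊆ tsupport α := fun _ hx => by
  contrapose! hx
  exact notMem_tsupport_iff_eventuallyEq.2
    (dc_eventuallyEq_zero (notMem_tsupport_iff_eventuallyEq.1 hx))

theorem IsSmooth.d_add {α β : KForm E X k} (hα : α.IsSmooth) (hβ : β.IsSmooth) :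
    (α + β).d = α.d + β.d := by
  funext x
  rw [Pi.add_apply, KForm.d, KForm.d, KForm.d, inChart_add, extDeriv_add
    ((hα.contDiffAt (mem_chart_target E x)).differentiableAt (by simp))
    ((hβ.contDiffAt (mem_chart_target E x)).differentiableAt (by simp))]

theorem rotate_add (α β : KForm E X k) (s : ℂ) : (α + β).rotate s = α.rotate s + β.rotate s := rfl

theorem IsSmooth.dc_add {α β : KForm E X k} (hα : α.IsSmooth) (hβ : β.IsSmooth) :
    (α + β).dc = α.dc + β.dc := by
  rw [KForm.dc, KForm.dc, KForm.dc, rotate_add, (hα.rotate _).d_add (hβ.rotate _), rotate_add]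

end KForm

theorem locallyCompactSpace_of_chartedSpace (E X : Type*) [NormedAddCommGroup E] [NormedSpace ℂ E]
    [FiniteDimensional ℂ E] [TopologicalSpace X] [ChartedSpace E X] : LocallyCompactSpace X :=
  haveI : LocallyCompactSpace E := inferInstance
  ChartedSpace.locallyCompactSpace E X

theorem sigmaCompactSpace_of_chartedSpace (E X : Type*) [NormedAddCommGroup E] [NormedSpace ℂ E]
    [FiniteDimensional ℂ E] [TopologicalSpace X] [SecondCountableTopology X] [ChartedSpace E X] :
    SigmaCompactSpace X :=
  have := locallyCompactSpace_of_chartedSpace E X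
  inferInstance

/-! ### Partitions of unity and bump functions. -/

section Decomposition

variable [FiniteDimensional ℂ E] [T2Space X] [SecondCountableTopology X]

/-- A property of compactly supported smooth forms holds if it is additive and holds for forms
supported in the domain of a chart. -/
theorem KForm.induction_on_support {P : KForm E X k → Prop} (h0 : P 0)
    (hadd : ∀ α β : KForm E X k, α.IsSmooth → HasCompactSupport α → β.IsSmooth →
      HasCompactSupport β → P α → P β → P (α + β))
    (hchart : ∀ (α : KForm E X k) (p : X), α.IsSmooth → HasCompactSupport α →
      tsupport α ⊆ (chartAt E p).source → P α)
    {α : KForm E X k} (hα : α.IsSmooth) (hc : HasCompactSupport α) : P α := by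
  have := sigmaCompactSpace_of_chartedSpace E X
  obtain ⟨f, hf⟩ := SmoothPartitionOfUnity.exists_isSubordinate 𝓘(ℝ, E) (isClosed_tsupport α)
    (fun p : X => (chartAt E p).source) (fun p => (chartAt E p).open_source)
    (fun x _ => Set.mem_iUnion.2 ⟨x, mem_chart_source E x⟩)
  -- Compactness of the support makes the partition of unity finite there, so the form is a finite
  -- sum of forms supported in charts.
  have hfin := f.locallyFinite.finite_nonempty_inter_compact hc
  have hsm : ∀ p, KForm.IsSmooth (fun x => f p x • α x) := fun p => hα.smul (f p).contMDiff
  have hsub : ∀ p, tsupport (fun x => f p x • α x) ⊆ tsupport α := fun p =>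
    tsupport_smul_subset_right (f p) α
  have hcs : ∀ p, HasCompactSupport (fun x => f p x • α x) := fun p =>
    hc.of_isClosed_subset (isClosed_tsupport _) (hsub p)
  have hP : ∀ p, P (fun x => f p x • α x) := fun p => hchart _ p (hsm p) (hcs p)
    ((tsupport_smul_subset_left (f p) α).trans (hf p))
  have hsum : ∀ s : Finset X, KForm.IsSmooth (∑ p ∈ s, fun x => f p x • α x) ∧
      HasCompactSupport (∑ p ∈ s, fun x => f p x • α x) ∧ P (∑ p ∈ s, fun x => f p x • α x) := by
    intro s
    induction s using Finset.cons_induction with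
    | empty => exact ⟨KForm.isSmooth_zero, HasCompactSupport.zero, h0⟩
    | cons p s hp ih =>
      rw [Finset.sum_cons]
      exact ⟨(hsm p).add ih.1, (hcs p).add ih.2.1, hadd _ _ (hsm p) (hcs p) ih.1 ih.2.1 (hP p) ih.2.2⟩
  have heq : α = ∑ p ∈ hfin.toFinset, fun x => f p x • α x := by
    funext x
    rw [Finset.sum_apply, ← Finset.sum_smul]
    by_cases hx : x ∈ tsupport α
    · have h1 := f.sum_eq_one hx
      rw [finsum_eq_sum_of_support_subset] at h1
      · rw [h1, one_smul]
      · intro p hp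
        simp only [Set.Finite.coe_toFinset, Set.mem_ofPred_eq]
        exact ⟨x, hp, hx⟩
    · rw [image_eq_zero_of_notMem_tsupport hx, smul_zero]
  rw [heq]
  exact (hsum _).2.2

variable (E) in
theorem exists_bump (x : X) : ∃ χ : X → ℝ, ContMDiff 𝓘(ℝ, E) 𝓘(ℝ) ∞ χ ∧ HasCompactSupport χ ∧
    (∀ z, 0 ≤ χ z) ∧ χ x ≠ 0 := by
  have := locallyCompactSpace_of_chartedSpace E X
  have := sigmaCompactSpace_of_chartedSpace E X
  obtain ⟨K, hK, hx⟩ := exists_compact_mem_nhds x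
  obtain ⟨χ, hs, hχ, h0⟩ := isOpen_interior.exists_contMDiff_support_eq (n := ⊤) 𝓘(ℝ, E) (s := interior K)
  refine ⟨χ, hχ, HasCompactSupport.intro hK fun z hz => ?_, h0, ?_⟩
  · by_contra h
    exact hz (interior_subset (hs ▸ h))
  · have : x ∈ Function.support χ := hs ▸ mem_interior_iff_mem_nhds.2 hx
    exact this

end Decomposition

/-! ### Continuity of the inner product; locality and additivity of Λ and Δ. -/

namespace HermitianMetric

variable [FiniteDimensional ℂ E] (g : HermitianMetric E X)

/-- The pointwise inner product of two forms of degree `k`. -/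
def innerK (α β : KForm E X k) (x : X) : ℂ := formInner (g.metricAt x) (α x) (β x)

theorem innerK_zero_left (β : KForm E X k) : g.innerK 0 β = 0 :=
  funext fun _ => formInner_zero_left _

theorem innerK_eq_zero_of_left {α β : KForm E X k} {x : X} (h : α x = 0) : g.innerK α β x = 0 := by
  rw [innerK, h, formInner_zero_left]

theorem innerK_eq_zero_of_right {α β : KForm E X k} {x : X} (h : β x = 0) :
    g.innerK α β x = 0 := by
  rw [innerK, h, formInner_zero_right]

theorem innerK_add_left (α α' β : KForm E X k) :
    g.innerK (α + α') β = g.innerK α β + g.innerK α' β :=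
  funext fun _ => formInner_add_left _ _ _

theorem innerK_add_right (α β β' : KForm E X k) :
    g.innerK α (β + β') = g.innerK α β + g.innerK α β' :=
  funext fun _ => formInner_add_right _ _ _

theorem conj_innerK (α β : KForm E X k) (x : X) : conj (g.innerK α β x) = g.innerK β α x := by
  obtain ⟨e, he⟩ := g.exists_isONB_metricAt x
  exact he.conj_formInner _ _

theorem continuous_innerK {α β : KForm E X k} (hα : α.IsSmooth) (hβ : β.IsSmooth) :
    Continuous (g.innerK α β) := by
  rw [continuous_iff_continuousAt]
  intro p
  have h1 : ContinuousAt (fun y => formInner (g.inChart p y) (α.inChart p y) (β.inChart p y))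
      (chartAt E p p) := by
    have hp := mem_chart_target E p
    exact (contDiffWithinAt_univ.1 (contDiffWithinAt_formInner
      (contDiffWithinAt_univ.2 (g.contDiffAt_inChart hp)) (g.det_gram_inChart_ne_zero hp)
      (contDiffWithinAt_univ.2 (hα.contDiffAt hp))
      (contDiffWithinAt_univ.2 (hβ.contDiffAt hp)))).continuousAt
  refine (ContinuousAt.comp h1 ((chartAt E p).continuousAt (mem_chart_source E p))).congr ?_
  filter_upwards [chart_source_mem_nhds E p] with x hx
  rw [Function.comp_apply, g.formInner_inChart ((chartAt E p).map_source hx),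
    (chartAt E p).left_inv hx, innerK]

theorem lambdaK_eventuallyEq_zero {α : KForm E X (k + 2)} {x : X} (h : α =ᶠ[nhds x] 0) :
    g.lambdaK α =ᶠ[nhds x] 0 := by
  filter_upwards [h] with z hz
  rw [lambdaK_apply, hz]
  exact map_zero _

theorem deltaK_eventuallyEq_zero {α : KForm E X (k + 1)} {x : X} (h : α =ᶠ[nhds x] 0) :
    g.deltaK α =ᶠ[nhds x] 0 := by
  have h1 := g.lambdaK_eventuallyEq_zero (KForm.d_eventuallyEq_zero h)
  cases k with
  | zero => exact h1
  | succ k =>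
    have := h1.sub (KForm.d_eventuallyEq_zero (g.lambdaK_eventuallyEq_zero h))
    rwa [sub_zero] at this

theorem deltaK_zero : g.deltaK (0 : KForm E X (k + 1)) = 0 :=
  funext fun x => (g.deltaK_eventuallyEq_zero (x := x) (Filter.EventuallyEq.refl _ _)).self_of_nhds

theorem tsupport_deltaK_subset (α : KForm E X (k + 1)) :
    tsupport (g.deltaK α) ⊆ tsupport α := fun _ hx => by
  contrapose! hx
  exact notMem_tsupport_iff_eventuallyEq.2
    (g.deltaK_eventuallyEq_zero (notMem_tsupport_iff_eventuallyEq.1 hx))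

theorem lambdaK_add (α β : KForm E X (k + 2)) :
    g.lambdaK (α + β) = g.lambdaK α + g.lambdaK β := by
  funext x
  rw [lambdaK_apply, Pi.add_apply, Pi.add_apply, map_add, lambdaK_apply, lambdaK_apply]

theorem deltaK_add {α β : KForm E X (k + 1)} (hα : α.IsSmooth) (hβ : β.IsSmooth) :
    g.deltaK (α + β) = g.deltaK α + g.deltaK β := by
  cases k with
  | zero => simp only [deltaK, hα.d_add hβ, lambdaK_add]
  | succ k =>
    simp only [deltaK, hα.d_add hβ, lambdaK_add,
      (g.isSmooth_lambdaK hα).d_add (g.isSmooth_lambdaK hβ)]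
    abel

end HermitianMetric

variable {E : Type*} [NormedAddCommGroup E] [NormedSpace ℂ E]
  {X : Type*} [TopologicalSpace X] [ChartedSpace E X] [IsManifold 𝓘(ℂ, E) ω X] {k : ℕ}

/-! ### Global adjointness of Δ and dᶜ. -/

section Adjoint

variable [FiniteDimensional ℂ E] [MeasurableSpace E] [BorelSpace E] [MeasurableSpace X]
  [BorelSpace X]

namespace HermitianMetric

variable (g : HermitianMetric E X)

theorem hasCompactSupport_innerK_left {α : KForm E X k} (hα : HasCompactSupport α)
    (β : KForm E X k) : HasCompactSupport (g.innerK α β) :=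
  hα.mono fun _ hx h => hx (g.innerK_eq_zero_of_left h)

theorem hasCompactSupport_innerK_right (α : KForm E X k) {β : KForm E X k}
    (hβ : HasCompactSupport β) : HasCompactSupport (g.innerK α β) :=
  hβ.mono fun _ hx h => hx (g.innerK_eq_zero_of_right h)

theorem integrable_innerK {α β : KForm E X k} (hα : α.IsSmooth) (hβ : β.IsSmooth)
    (hc : HasCompactSupport α ∨ HasCompactSupport β) : Integrable (g.innerK α β) g.volume :=
  (g.continuous_innerK hα hβ).integrable_of_hasCompactSupport
    (hc.elim (fun h => g.hasCompactSupport_innerK_left h β) (g.hasCompactSupport_innerK_right α))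

end HermitianMetric

theorem hasCompactSupport_deltaK (g : HermitianMetric E X) {α : KForm E X (k + 1)}
    (hα : HasCompactSupport α) : HasCompactSupport (g.deltaK α) :=
  hα.of_isClosed_subset (isClosed_tsupport _) (g.tsupport_deltaK_subset α)

theorem KForm.hasCompactSupport_dc {α : KForm E X k} (hα : HasCompactSupport α) :
    HasCompactSupport α.dc :=
  hα.of_isClosed_subset (isClosed_tsupport _) α.tsupport_dc_subset

namespace KahlerMetric

variable (g : KahlerMetric E X)

/-- Near every point outside K one of the two forms vanishes. All the operators are local, so the
integrand vanishes outside the chart and the integral is the one on the chart target. -/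
theorem integral_innerK_sub_of_subset_source [SecondCountableTopology X] [T2Space X]
    {α : KForm E X (k + 1)} {β : KForm E X k} (hα : α.IsSmooth) (hβ : β.IsSmooth) {K : Set X}
    (hK : IsCompact K) {p : X} (hp : K ⊆ (chartAt E p).source)
    (h : tsupport α ⊆ K ∨ tsupport β ⊆ K) :
    ∫ x, (g.innerK (g.deltaK α) β x - g.innerK α β.dc x) ∂g.volume = 0 := by
  have h0 : ∀ x ∉ K, (α =ᶠ[nhds x] 0) ∨ (β =ᶠ[nhds x] 0) := fun x hx => h.imp
    (fun h => notMem_tsupport_iff_eventuallyEq.1 fun hx' => hx (h hx'))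
    (fun h => notMem_tsupport_iff_eventuallyEq.1 fun hx' => hx (h hx'))
  have hzero : ∀ x ∉ (chartAt E p).source,
      g.innerK (g.deltaK α) β x - g.innerK α β.dc x = 0 := by
    intro x hx
    rcases h0 x (fun h => hx (hp h)) with h | h
    · rw [g.innerK_eq_zero_of_left h.self_of_nhds,
        g.innerK_eq_zero_of_left (g.deltaK_eventuallyEq_zero h).self_of_nhds, sub_zero]
    · rw [g.innerK_eq_zero_of_right h.self_of_nhds,
        g.innerK_eq_zero_of_right (KForm.dc_eventuallyEq_zero h).self_of_nhds, sub_zero]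
  rw [g.integral_volume_eq (f := fun x => g.innerK (g.deltaK α) β x - g.innerK α β.dc x) p
    ((g.continuous_innerK (g.isSmooth_deltaK hα) hβ).sub
    (g.continuous_innerK hα hβ.dc)).continuousOn hzero]
  have hT := (chartAt E p).open_target
  rw [← setIntegral_formInner_flatDelta_sub (Module.finBasis ℝ E).addHaar hT
    (hK.image_of_continuousOn ((chartAt E p).continuousOn.mono hp))
    (by rintro _ ⟨x, hx, rfl⟩; exact (chartAt E p).map_source (hp hx))
    ((g.contDiffOn_inChart p).of_le (by simp)) (fun y _ => g.inChart_symm p y)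
    (fun y hy => g.inChart_pos hy) (fun y hy => g.isCompatible_inChart hy)
    (fun y hy => g.isKahlerJet_inChart hy) ((hα p).of_le (by simp)) ((hβ p).of_le (by simp))]
  · refine setIntegral_congr_fun hT.measurableSet fun y hy => ?_
    rw [HermitianMetric.density, ← g.inChart_deltaK hα hy, ← hβ.inChart_dc hy,
      g.formInner_inChart hy, g.formInner_inChart hy]
    rfl
  · rintro y ⟨hy, hyK⟩
    have hx : (chartAt E p).symm y ∉ K := fun h => hyK ⟨_, h, (chartAt E p).right_inv hy⟩
    refine (h0 _ hx).imp (fun h => ?_) (fun h => ?_) <;>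
    · rw [KForm.inChart, h.self_of_nhds]
      rfl

variable [SecondCountableTopology X] [T2Space X]

/-- On a Kähler manifold `dᶜ` is the formal adjoint of `Δ`. -/
theorem integral_innerK_deltaK {α : KForm E X (k + 1)} {β : KForm E X k} (hα : α.IsSmooth)
    (hβ : β.IsSmooth) (hc : HasCompactSupport α ∨ HasCompactSupport β) :
    ∫ x, g.innerK (g.deltaK α) β x ∂g.volume = ∫ x, g.innerK α β.dc x ∂g.volume := by
  have hint1 : ∀ {α : KForm E X (k + 1)} {β : KForm E X k}, α.IsSmooth → β.IsSmooth →
      (HasCompactSupport α ∨ HasCompactSupport β) →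
      Integrable (g.innerK (g.deltaK α) β) g.volume := fun hα hβ hc =>
    g.integrable_innerK (g.isSmooth_deltaK hα) hβ (hc.imp_left (hasCompactSupport_deltaK _))
  have hint2 : ∀ {α : KForm E X (k + 1)} {β : KForm E X k}, α.IsSmooth → β.IsSmooth →
      (HasCompactSupport α ∨ HasCompactSupport β) →
      Integrable (g.innerK α β.dc) g.volume := fun hα hβ hc =>
    g.integrable_innerK hα hβ.dc (hc.imp_right KForm.hasCompactSupport_dc)
  have hchart : ∀ {α : KForm E X (k + 1)} {β : KForm E X k} {K : Set X} {p : X}, α.IsSmooth →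
      β.IsSmooth → IsCompact K → K ⊆ (chartAt E p).source → (tsupport α ⊆ K ∨ tsupport β ⊆ K) →
      ∫ x, g.innerK (g.deltaK α) β x ∂g.volume = ∫ x, g.innerK α β.dc x ∂g.volume := by
    intro α β K p hα hβ hK hp h
    have hc : HasCompactSupport α ∨ HasCompactSupport β :=
      h.imp (fun h => hK.of_isClosed_subset (isClosed_tsupport _) h)
        (fun h => hK.of_isClosed_subset (isClosed_tsupport _) h)
    rw [← sub_eq_zero, ← integral_sub (hint1 hα hβ hc) (hint2 hα hβ hc)]
    exact g.integral_innerK_sub_of_subset_source hα hβ hK hp h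
  -- The partition of unity is applied to whichever form has compact support. Both cases are needed:
  -- the second gives the adjoint relation with Δ and dᶜ interchanged.
  rcases hc with hc | hc
  · refine KForm.induction_on_support (P := fun α => ∫ x, g.innerK (g.deltaK α) β x ∂g.volume =
      ∫ x, g.innerK α β.dc x ∂g.volume) ?_ ?_ ?_ hα hc
    · rw [g.deltaK_zero, g.innerK_zero_left, g.innerK_zero_left]
    · intro α α' hα hcα hα' hcα' h h'
      rw [g.deltaK_add hα hα', g.innerK_add_left, g.innerK_add_left]
      simp only [Pi.add_apply]
      rw [integral_add (hint1 hα hβ (.inl hcα)) (hint1 hα' hβ (.inl hcα')),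
        integral_add (hint2 hα hβ (.inl hcα)) (hint2 hα' hβ (.inl hcα')), h, h']
    · exact fun α p hα hcα hp => hchart hα hβ hcα hp (.inl subset_rfl)
  · refine KForm.induction_on_support (P := fun β => ∫ x, g.innerK (g.deltaK α) β x ∂g.volume =
      ∫ x, g.innerK α β.dc x ∂g.volume) ?_ ?_ ?_ hβ hc
    · have h1 : (0 : KForm E X k).dc = 0 := funext fun x =>
        (KForm.dc_eventuallyEq_zero (x := x) (Filter.EventuallyEq.refl _ _)).self_of_nhds
      rw [h1]
      simp only [HermitianMetric.innerK, Pi.zero_apply, formInner_zero_right]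
    · intro β β' hβ hcβ hβ' hcβ' h h'
      rw [hβ.dc_add hβ', g.innerK_add_right, g.innerK_add_right]
      simp only [Pi.add_apply]
      rw [integral_add (hint1 hα hβ (.inr hcβ)) (hint1 hα hβ' (.inr hcβ')),
        integral_add (hint2 hα hβ (.inr hcβ)) (hint2 hα hβ' (.inr hcβ')), h, h']
    · exact fun β p hβ hcβ hp => hchart hα hβ hcβ hp (.inr subset_rfl)

end KahlerMetric

end Adjoint

/-! ### Forms of mixed degree -/

namespace DiffForm

theorem IsCompactlySupported.hasCompactSupport {α : DiffForm E X} (hα : α.IsCompactlySupported)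
    (k : ℕ) : HasCompactSupport (α k) :=
  hα.of_isClosed_subset (isClosed_tsupport _) (closure_mono fun _ hx => ⟨k, hx⟩)

/-- The twisted exterior derivative `dᶜ = J d J⁻¹`. -/
def dc (α : DiffForm E X) : DiffForm E X
  | 0 => 0
  | k + 1 => (α k).dc

/-- The pullback of a form by `v ↦ s v`. -/
def rotate (s : ℂ) (α : DiffForm E X) : DiffForm E X := fun k => (α k).rotate s

theorem IsSmooth.apply {α : DiffForm E X} (hα : α.IsSmooth) (k : ℕ) : (α k).IsSmooth := hα k

theorem IsSmooth.d {α : DiffForm E X} (hα : α.IsSmooth) : α.d.IsSmooth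
  | 0 => KForm.isSmooth_zero
  | k + 1 => (hα.apply k).d

theorem IsSmooth.dc {α : DiffForm E X} (hα : α.IsSmooth) : α.dc.IsSmooth
  | 0 => KForm.isSmooth_zero
  | k + 1 => (hα.apply k).dc

theorem IsSmooth.rotate {α : DiffForm E X} (hα : α.IsSmooth) (s : ℂ) : (α.rotate s).IsSmooth :=
  fun k => (hα.apply k).rotate s

theorem IsSmooth.add {α β : DiffForm E X} (hα : α.IsSmooth) (hβ : β.IsSmooth) :
    (α + β).IsSmooth := fun k => (hα.apply k).add (hβ.apply k)

theorem IsSmooth.sub {α β : DiffForm E X} (hα : α.IsSmooth) (hβ : β.IsSmooth) :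
    (α - β).IsSmooth := fun k => (hα.apply k).sub (hβ.apply k)

theorem isCompactlySupported_of_subset {α β : DiffForm E X} (hα : α.IsCompactlySupported)
    (h : ∀ x, (∀ᶠ z in nhds x, ∀ k, α k z = 0) → ∀ k, β k x = 0) : β.IsCompactlySupported := by
  refine hα.of_isClosed_subset isClosed_closure (closure_minimal (fun x hx => ?_) isClosed_closure)
  by_contra hx'
  obtain ⟨k, hk⟩ := hx
  refine hk (h x ?_ k)
  filter_upwards [isClosed_closure.isOpen_compl.mem_nhds hx'] with z hz k
  by_contra h'
  exact hz (subset_closure ⟨k, h'⟩)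

theorem IsCompactlySupported.d {α : DiffForm E X} (hα : α.IsCompactlySupported) :
    α.d.IsCompactlySupported :=
  isCompactlySupported_of_subset hα fun x hx k => by
    cases k with
    | zero => rfl
    | succ k => exact (KForm.d_eventuallyEq_zero (hx.mono fun z hz => hz k)).self_of_nhds

theorem IsCompactlySupported.dc {α : DiffForm E X} (hα : α.IsCompactlySupported) :
    α.dc.IsCompactlySupported :=
  isCompactlySupported_of_subset hα fun x hx k => by
    cases k with
    | zero => rfl
    | succ k => exact (KForm.dc_eventuallyEq_zero (hx.mono fun z hz => hz k)).self_of_nhds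

theorem IsCompactlySupported.rotate {α : DiffForm E X} (hα : α.IsCompactlySupported) (s : ℂ) :
    (α.rotate s).IsCompactlySupported :=
  isCompactlySupported_of_subset hα fun x hx k =>
    (KForm.rotate_eventuallyEq_zero (hx.mono fun z hz => hz k) s).self_of_nhds

theorem d_dc_add {α : DiffForm E X} (hα : α.IsSmooth) : α.dc.d + α.d.dc = 0 := by
  funext k x
  match k with
  | 0 => exact add_zero _
  | 1 =>
    -- In degree 1 both terms differentiate the degree-0 component of dᶜα or dα, which is zero by
    -- definition.
    have h1 : (0 : KForm E X 0).d x = 0 :=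
      (KForm.d_eventuallyEq_zero (Filter.EventuallyEq.refl _ _)).self_of_nhds
    have h2 : (0 : KForm E X 0).dc x = 0 :=
      (KForm.dc_eventuallyEq_zero (Filter.EventuallyEq.refl _ _)).self_of_nhds
    exact (congrArg₂ (· + ·) h1 h2).trans (add_zero _)
  | k + 2 =>
    change (α k).dc.d x + (α k).d.dc x = 0
    have hx := mem_chart_target E x
    have hk := hα.apply k
    -- At its own centre the chart at x reads a form as its value at x, so the flat identity applies
    -- there.
    rw [← KForm.inChart_self (α k).dc.d, ← KForm.inChart_self (α k).d.dc, hk.dc.inChart_d hx,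
      hk.d.inChart_dc hx, ← extDeriv_flatDc_add (J := complexJ E) ((hk.contDiffAt hx).of_le
        (WithTop.coe_le_coe.2 (le_top : (2 : ℕ∞) ≤ ⊤)))]
    have ht := (chartAt E x).open_target.mem_nhds hx
    congr 1
    · refine Filter.EventuallyEq.extDeriv_eq ?_
      filter_upwards [ht] with y hy using hk.inChart_dc hy
    · have : (α k).d.inChart x =ᶠ[nhds (chartAt E x x)] extDeriv ((α k).inChart x) := by
        filter_upwards [ht] with y hy using hk.inChart_d hy
      rw [flatDc, flatDc, this.fderiv_eq]

theorem dc_rotate (α : DiffForm E X) : (α.rotate Complex.I).dc = α.d.rotate Complex.I := by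
  funext k
  cases k with
  | zero => rfl
  | succ k =>
    change (((α k).rotate Complex.I).rotate (-Complex.I)).d.rotate Complex.I =
      (α k).d.rotate Complex.I
    rw [KForm.rotate_rotate, mul_neg, Complex.I_mul_I, neg_neg, KForm.rotate_one]

end DiffForm

/-! ### Uniqueness of formal adjoints and the two identities. -/

variable {E : Type*} [NormedAddCommGroup E] [NormedSpace ℂ E]
  {X : Type*} [TopologicalSpace X] [ChartedSpace E X] [IsManifold 𝓘(ℂ, E) ω X]
  [FiniteDimensional ℂ E]

namespace HermitianMetric

variable (g : HermitianMetric E X)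

theorem pointwiseInner_eq (α β : DiffForm E X) : g.pointwiseInner α β =
    fun x => ∑ k ∈ Finset.range (Module.finrank ℝ E + 1), g.innerK (α k) (β k) x := rfl

theorem pointwiseInner_add_right (α β β' : DiffForm E X) (x : X) :
    g.pointwiseInner α (β + β') x = g.pointwiseInner α β x + g.pointwiseInner α β' x := by
  simp only [pointwiseInner, ← Finset.sum_add_distrib, Pi.add_apply, formInner_add_right]

theorem pointwiseInner_sub_right (α β β' : DiffForm E X) (x : X) :
    g.pointwiseInner α (β - β') x = g.pointwiseInner α β x - g.pointwiseInner α β' x := by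
  simp only [pointwiseInner, ← Finset.sum_sub_distrib, Pi.sub_apply, formInner_sub_right]

theorem conj_pointwiseInner (α β : DiffForm E X) (x : X) :
    conj (g.pointwiseInner α β x) = g.pointwiseInner β α x := by
  rw [pointwiseInner_eq, pointwiseInner_eq, map_sum]
  exact Finset.sum_congr rfl fun k _ => g.conj_innerK _ _ x

theorem continuous_pointwiseInner {α β : DiffForm E X} (hα : α.IsSmooth) (hβ : β.IsSmooth) :
    Continuous (g.pointwiseInner α β) := by
  rw [pointwiseInner_eq]
  exact continuous_finset_sum _ fun k _ => g.continuous_innerK (hα.apply k) (hβ.apply k)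

theorem hasCompactSupport_pointwiseInner {α : DiffForm E X} (hα : α.IsCompactlySupported)
    (β : DiffForm E X) : HasCompactSupport (g.pointwiseInner α β) := by
  refine HasCompactSupport.intro' hα isClosed_closure fun x hx => ?_
  refine Finset.sum_eq_zero fun k _ => g.innerK_eq_zero_of_left ?_
  by_contra h
  exact hx (subset_closure ⟨k, h⟩)

theorem isSmooth_Δ {α : DiffForm E X} (hα : α.IsSmooth) : (g.Δ α).IsSmooth := fun k => by
  rw [g.Δ_apply]
  exact g.isSmooth_deltaK (hα.apply (k + 1))

theorem pointwiseInner_rotate_rotate (α β : DiffForm E X) (x : X) :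
    g.pointwiseInner (α.rotate Complex.I) (β.rotate Complex.I) x = g.pointwiseInner α β x := by
  refine Finset.sum_congr rfl fun k _ => ?_
  let A : E ≃L[ℝ] E := ContinuousLinearEquiv.equivOfInverse (complexJ E) (-complexJ E)
    (fun v => by rw [neg_apply, complexJ_complexJ, neg_neg])
    (fun v => by rw [neg_apply, map_neg, complexJ_complexJ, neg_neg])
  have h : (g.metricAt x).bilinearComp (A : E →L[ℝ] E) (A : E →L[ℝ] E) = g.metricAt x := by
    ext u v
    exact (g.isCompatible_metricAt x).isometry u v
  have := formInner_compContinuousLinearMap (g.metricAt_symm x) (g.metricAt_pos x) A (α k x) (β k x)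
  rw [h] at this
  exact this

theorem pointwiseInner_rotate_left (α β : DiffForm E X) (x : X) :
    g.pointwiseInner (α.rotate Complex.I) β x =
      g.pointwiseInner α (β.rotate (-Complex.I)) x := by
  have h : β = (β.rotate (-Complex.I)).rotate Complex.I := by
    funext k
    change β k = ((β k).rotate (-Complex.I)).rotate Complex.I
    rw [KForm.rotate_rotate, neg_mul, Complex.I_mul_I, neg_neg, KForm.rotate_one]
  conv_lhs => rw [h]
  rw [pointwiseInner_rotate_rotate]

variable [MeasurableSpace E] [BorelSpace E] [MeasurableSpace X] [BorelSpace X]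

theorem integrable_pointwiseInner {α β : DiffForm E X} (hα : α.IsSmooth) (hβ : β.IsSmooth)
    (hc : α.IsCompactlySupported) : Integrable (g.pointwiseInner α β) g.volume :=
  (g.continuous_pointwiseInner hα hβ).integrable_of_hasCompactSupport
    (g.hasCompactSupport_pointwiseInner hc β)

theorem integral_pointwiseInner_comm (α β : DiffForm E X) :
    ∫ x, g.pointwiseInner α β x ∂g.volume = conj (∫ x, g.pointwiseInner β α x ∂g.volume) := by
  rw [← integral_conj]
  simp only [conj_pointwiseInner]

/-- Testing with η = χγ makes the integrand χ|γ|², continuous, nonnegative and positive at a point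
where γ and χ are nonzero; its integral is positive since the volume charges open sets. -/
theorem eq_zero_of_integral_eq_zero [T2Space X] [SecondCountableTopology X] {γ : DiffForm E X}
    (hγ : γ.IsSmooth) (h : ∀ η : DiffForm E X, η.IsSmooth → η.IsCompactlySupported →
      ∫ x, g.pointwiseInner η γ x ∂g.volume = 0) : γ = 0 := by
  by_contra hne
  obtain ⟨k, hk⟩ := Function.ne_iff.1 hne
  obtain ⟨x, hx⟩ := Function.ne_iff.1 hk
  obtain ⟨χ, hχ, hχc, hχ0, hχx⟩ := exists_bump E x
  let η : DiffForm E X := fun k z => χ z • γ k z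
  have hη : η.IsSmooth := fun k => (hγ.apply k).smul hχ
  have hηc : η.IsCompactlySupported := by
    refine hχc.of_isClosed_subset isClosed_closure (closure_mono ?_)
    rintro z ⟨j, hj⟩ h0
    refine hj ?_
    change χ z • γ j z = 0
    rw [h0]
    ext v
    simp
  have hself : ∀ z j, 0 ≤ (g.innerK (γ j) (γ j) z).re ∧ (g.innerK (γ j) (γ j) z).im = 0 := by
    intro z j
    obtain ⟨e, he⟩ := g.exists_isONB_metricAt z
    have := Complex.le_def.1 (he.formInner_self_nonneg (γ j z))
    exact ⟨this.1, this.2.symm⟩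
  have hre : ∀ z, (g.pointwiseInner η γ z).re =
      χ z * ∑ j ∈ Finset.range (Module.finrank ℝ E + 1), (g.innerK (γ j) (γ j) z).re := by
    intro z
    rw [pointwiseInner, Complex.re_sum, Finset.mul_sum]
    refine Finset.sum_congr rfl fun j _ => ?_
    change (formInner _ (χ z • γ j z) _).re = _
    rw [formInner_rsmul_left, Complex.smul_re]
    rfl
  have hcont := g.continuous_pointwiseInner hη hγ
  have hpos := Continuous.integral_pos_of_hasCompactSupport_nonneg_nonzero (μ := g.volume)
    (f := fun z => (g.pointwiseInner η γ z).re) (x := x) (Complex.continuous_re.comp hcont)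
    ((g.hasCompactSupport_pointwiseInner hηc γ).comp_left (g := Complex.re) rfl)
    (fun z => by
      change 0 ≤ (g.pointwiseInner η γ z).re
      rw [hre]
      exact mul_nonneg (hχ0 z) (Finset.sum_nonneg fun j _ => (hself z j).1)) (by
      rw [hre]
      refine mul_ne_zero hχx fun h0 => hx ?_
      -- The inner product sums only over degrees up to the real dimension; forms of higher degree
      -- vanish, so the nonzero component is seen.
      have hkn : k ∈ Finset.range (Module.finrank ℝ E + 1) := by
        rw [Finset.mem_range]
        by_contra hlt
        exact hx (form_eq_zero_of_finrank_lt (by omega) _)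
      have h1 := (Finset.sum_eq_zero_iff_of_nonneg fun j _ => (hself x j).1).1 h0 k hkn
      obtain ⟨e, he⟩ := g.exists_isONB_metricAt x
      exact he.formInner_self_eq_zero (Complex.ext h1 (hself x k).2))
  have hre' := integral_re (𝕜 := ℂ) (g.integrable_pointwiseInner hη hγ hηc)
  rw [h η hη hηc] at hre'
  exact hpos.ne' hre'

theorem IsFormalAdjoint.eq [T2Space X] [SecondCountableTopology X]
    {A B B' : DiffForm E X → DiffForm E X} (hB : g.IsFormalAdjoint A B)
    (hB' : g.IsFormalAdjoint A B') {β : DiffForm E X} (hβ : β.IsSmooth) : B β = B' β := by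
  refine sub_eq_zero.1 (g.eq_zero_of_integral_eq_zero ((hB.smooth β hβ).sub (hB'.smooth β hβ))
    fun η hη hηc => ?_)
  simp only [pointwiseInner_sub_right]
  rw [integral_sub (g.integrable_pointwiseInner hη (hB.smooth β hβ) hηc)
    (g.integrable_pointwiseInner hη (hB'.smooth β hβ) hηc), ← hB.adjoint η β hη hβ hηc,
    ← hB'.adjoint η β hη hβ hηc, sub_self]

end HermitianMetric

namespace KahlerMetric

variable [MeasurableSpace E] [BorelSpace E] [MeasurableSpace X] [BorelSpace X] [T2Space X]
  [SecondCountableTopology X] (g : KahlerMetric E X)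

theorem integral_pointwiseInner_Δ {α β : DiffForm E X} (hα : α.IsSmooth) (hβ : β.IsSmooth)
    (hc : α.IsCompactlySupported ∨ β.IsCompactlySupported) :
    ∫ x, g.pointwiseInner (g.Δ α) β x ∂g.volume = ∫ x, g.pointwiseInner α β.dc x ∂g.volume := by
  have hck : ∀ k l, HasCompactSupport (α k) ∨ HasCompactSupport (β l) := fun k l =>
    hc.imp (fun h => h.hasCompactSupport k) (fun h => h.hasCompactSupport l)
  have hL : g.pointwiseInner (g.Δ α) β = fun x => ∑ k ∈ Finset.range (Module.finrank ℝ E),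
      g.innerK (g.deltaK (α (k + 1))) (β k) x := by
    funext x
    rw [HermitianMetric.pointwiseInner_eq]
    dsimp only
    rw [Finset.sum_range_succ]
    simp only [g.Δ_apply]
    -- Δ lowers the degree by one, so its top component comes from a form above the dimension;
    -- dropping it aligns the sum with that for dᶜ, whose degree-0 term drops out.
    have h0 : α (Module.finrank ℝ E + 1) = 0 :=
      funext fun x => form_eq_zero_of_finrank_lt (Nat.lt_succ_self _) _
    rw [h0, g.deltaK_zero, g.innerK_zero_left]
    exact add_zero _
  have hR : g.pointwiseInner α β.dc = fun x => ∑ k ∈ Finset.range (Module.finrank ℝ E),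
      g.innerK (α (k + 1)) (β k).dc x := by
    funext x
    rw [HermitianMetric.pointwiseInner_eq]
    dsimp only
    rw [Finset.sum_range_succ']
    have h0 : g.innerK (α 0) (β.dc 0) x = 0 := g.innerK_eq_zero_of_right rfl
    rw [h0]
    exact add_zero _
  rw [hL, hR, integral_finsetSum, integral_finsetSum]
  · exact Finset.sum_congr rfl fun k _ =>
      g.integral_innerK_deltaK (hα.apply _) (hβ.apply k) (hck _ _)
  · exact fun k _ => g.integrable_innerK (hα.apply _) (hβ.apply k).dc
      ((hck (k + 1) k).imp_right KForm.hasCompactSupport_dc)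
  · exact fun k _ => g.integrable_innerK (g.isSmooth_deltaK (hα.apply _)) (hβ.apply k)
      ((hck (k + 1) k).imp_left (hasCompactSupport_deltaK _))

theorem isFormalAdjoint_Δ_dc : g.IsFormalAdjoint g.Δ DiffForm.dc where
  smooth _ hβ := hβ.dc
  adjoint _ _ hα hβ hc := g.integral_pointwiseInner_Δ hα hβ (.inl hc)

/-- Hermitian symmetry reverses the adjoint relation; the compactly supported form is then the
second argument of the pairing with Δ. -/
theorem integral_pointwiseInner_dc {α β : DiffForm E X} (hα : α.IsSmooth) (hβ : β.IsSmooth)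
    (hc : α.IsCompactlySupported) :
    ∫ x, g.pointwiseInner α.dc β x ∂g.volume = ∫ x, g.pointwiseInner α (g.Δ β) x ∂g.volume := by
  rw [g.integral_pointwiseInner_comm, ← g.integral_pointwiseInner_Δ hβ hα (.inr hc),
    ← g.integral_pointwiseInner_comm]

/-- J is unitary and dᶜJ = Jd, so ⟨dα, β⟩ = ⟨dᶜJα, Jβ⟩, and under the integral dᶜ passes to Δ on the
other side. -/
theorem isFormalAdjoint_d :
    g.IsFormalAdjoint DiffForm.d fun β => (g.Δ (β.rotate Complex.I)).rotate (-Complex.I) where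
  smooth _ hβ := (g.isSmooth_Δ (hβ.rotate _)).rotate _
  adjoint α β hα hβ hc := by
    simp only [← g.pointwiseInner_rotate_left]
    rw [← g.integral_pointwiseInner_dc (hα.rotate _) (hβ.rotate _) (hc.rotate _),
      DiffForm.dc_rotate]
    simp only [HermitianMetric.pointwiseInner_rotate_rotate]

/-- Paired with a compactly supported η, the two terms become the pairings of d dᶜη and dᶜdη with α.
Only the adjoint property of `dStar` is used, not a formula for it. -/
theorem Δ_dStar_add {dStar : DiffForm E X → DiffForm E X}
    (hd : g.IsFormalAdjoint DiffForm.d dStar) {α : DiffForm E X} (hα : α.IsSmooth) :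
    g.Δ (dStar α) + dStar (g.Δ α) = 0 := by
  have hs := hd.smooth α hα
  have hΔ := g.isSmooth_Δ hα
  refine g.eq_zero_of_integral_eq_zero ((g.isSmooth_Δ hs).add (hd.smooth _ hΔ)) fun η hη hηc => ?_
  simp only [HermitianMetric.pointwiseInner_add_right]
  rw [integral_add (g.integrable_pointwiseInner hη (g.isSmooth_Δ hs) hηc)
    (g.integrable_pointwiseInner hη (hd.smooth _ hΔ) hηc), ← hd.adjoint η _ hη hΔ hηc,
    ← g.integral_pointwiseInner_dc hη hs hηc, ← hd.adjoint _ α hη.dc hα hηc.dc,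
    ← g.integral_pointwiseInner_dc hη.d hα hηc.d,
    eq_neg_of_add_eq_zero_left (DiffForm.d_dc_add hη)]
  have hneg : ∀ (β : DiffForm E X) x, g.pointwiseInner (-β) α x = -g.pointwiseInner β α x := by
    intro β x
    simp only [HermitianMetric.pointwiseInner, ← Finset.sum_neg_distrib, Pi.neg_apply, formInner_neg_left]
  simp only [hneg, integral_neg, neg_add_cancel]

end KahlerMetric

end KahlerGeometry

end

theorem mainTheorem9 {E : Type*} [NormedAddCommGroup E] [NormedSpace ℂ E] [FiniteDimensional ℂ E]
    [MeasurableSpace E] [BorelSpace E]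
    {X : Type*} [TopologicalSpace X] [T2Space X] [SecondCountableTopology X]
    [MeasurableSpace X] [BorelSpace X] [ChartedSpace E X] [IsManifold 𝓘(ℂ, E) ω X]
    (g : KahlerMetric E X) :
    (∃ dStar : DiffForm E X → DiffForm E X, g.IsFormalAdjoint DiffForm.d dStar) ∧
    (∃ ΔStar : DiffForm E X → DiffForm E X, g.IsFormalAdjoint g.Δ ΔStar) ∧
    ∀ dStar ΔStar : DiffForm E X → DiffForm E X,
      g.IsFormalAdjoint DiffForm.d dStar → g.IsFormalAdjoint g.Δ ΔStar →
      (∀ α : DiffForm E X, α.IsSmooth → (ΔStar α).d + ΔStar α.d = 0) ∧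
      (∀ α : DiffForm E X, α.IsSmooth → g.Δ (dStar α) + dStar (g.Δ α) = 0) := by
  refine ⟨⟨_, g.isFormalAdjoint_d⟩, ⟨_, g.isFormalAdjoint_Δ_dc⟩, fun dStar ΔStar hd hΔ =>
    ⟨fun α hα => ?_, fun α hα => g.Δ_dStar_add hd hα⟩⟩
  rw [hΔ.eq g.toHermitianMetric g.isFormalAdjoint_Δ_dc hα,
    hΔ.eq g.toHermitianMetric g.isFormalAdjoint_Δ_dc hα.d]
  exact DiffForm.d_dc_add hα
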